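/- Let $q$ be a prime power, let $b$ divide $d$, and regard $V=V'=\mathbb F_{q^b}^{d/b}$ as a $d$-dimensional vector space over $\mathbb F_q$. Write $\mathrm{Tr}_{r^k/r}$ for the relative trace $\mathbb F_{r^k}\to\mathbb F_r$. Points of a polar space on $V$ are the totally isotropic (resp. totally singular) $1$-dimensional $\mathbb F_q$-subspaces $\langle v\rangle$; its generators are the maximal totally isotropic (resp. singular) subspaces; an $m$-ovoid ($m$ a non-negative integer) is a set of points that meets every generator in exactly $m$ points. When $q^b$ is a square, put $\kappa'(x,y)=\sum_i x_iy_i^{q^{b/2}}$ and $H'(x)=\kappa'(x,x)\in\mathbb F_{q^{b/2}}$. Let $\square$ be the set of nonzero squares of $\mathbb F_q$, and let $\epsilon=\tfrac12$ if $q$ is odd, $\epsilon=1$ if $q$ is even. A set of $G$-coset representatives of a $G$-invariant set $\mathcal T$ is a subset $T\subseteq\mathcal T$ containing exactly one element of each coset $G\cdot t$, $t\in\mathcal T$. (1) Let $q$ be a square, $d$ odd, and let $H(d-1,q)$ be the polar space on $V$ of the Hermitian form $\mathrm{Tr}_{q^b/q}\circ\kappa'$. Let $\mathcal T\subseteq\mathbb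 F_{q^{b/2}}^*$ be non-empty, $\mathbb F_{q^{1/2}}^*$-invariant, with $\mathrm{Tr}_{q^{b/2}/q^{1/2}}(t)=0$ for all $t\in\mathcal T$, and let $T$ be a set of $\mathbb F_{q^{1/2}}^*$-coset representatives of $\mathcal T$. If $\mathcal M=\{\langle v\rangle: H'(v)\in\mathcal T\}$ is an $m$-ovoid of $H(d-1,q)$ with $m=\frac{|T|}{q^{1/2}+1}q^{(d-b)/2}$, then $$|T|\ \ge\ \frac{q^{b/2}}{(q^{1/2}-1)(2q^{b/4}+1)}.$$ (2) Let $d/b\ge 4$ be even, let $Q'(x)=x_1x_2+\dots+x_{d/b-3}x_{d/b-2}+x_{d/b-1}^2+a_0x_{d/b-1}x_{d/b}+a_1x_{d/b}^2$ with $X^2+a_0X+a_1$ irreducible over $\mathbb F_{q^b}$, and let $Q^-(d-1,q)$ be the polar space on $V$ of the quadratic form $\mathrm{Tr}_{q^b/q}\circ Q'$. Let $\mathcal T\subseteq\mathbb F_{q^b}^*$ be non-empty, $\square$-invariant, with $\mathrm{Tr}_{q^b/q}(t)=0$ for all $t\in\mathcal T$, and let $T$ be a set of $\square$-coset representatives of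 $\mathcal T$. If $\{\langle v\rangle: Q'(v)\in\mathcal T\}$ is an $m$-ovoid of $Q^-(d-1,q)$ with $m=\epsilon|T|q^{d/2-b}$, then $$|T|\ \ge\ \frac{q^{b}}{\epsilon(q-1)(2q^{b/2}+1)}.$$ (3) Let $b$ be even, $d/b$ odd, and let $Q^-(d-1,q)$ be the polar space on $V$ of the quadratic form $\mathrm{Tr}_{q^{b/2}/q}\circ H'$. Let $\mathcal T\subseteq\mathbb F_{q^{b/2}}^*$ be non-empty, $\square$-invariant, with $\mathrm{Tr}_{q^{b/2}/q}(t)=0$ for all $t\in\mathcal T$, and let $T$ be a set of $\square$-coset representatives of $\mathcal T$. If $\{\langle v\rangle: H'(v)\in\mathcal T\}$ is an $m$-ovoid of $Q^-(d-1,q)$ with $m=\epsilon|T|q^{(d-b)/2}$, then $$|T|\ \ge\ \frac{q^{b/2}}{\epsilon(q-1)(2q^{b/4}+1)}.$$ (4) Let $b$ be even, $d/b$ odd, $\lambda\in\mathbb F_{q^b}^*$ with $\lambda+\lambda^{q^{b/2}}=0$, and let $W(d-1,q)$ be the polar space on $V$ of the symplectic form $\mathrm{Tr}_{q^b/q}\circ\lambda\kappa'$.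 Let $\mathcal T\subseteq\mathbb F_{q^{b/2}}^*$ be non-empty and $\square$-invariant, and let $T$ be a set of $\square$-coset representatives of $\mathcal T$. If $\{\langle v\rangle: H'(v)\in\mathcal T\}$ is an $m$-ovoid of $W(d-1,q)$ with $m=\epsilon|T|q^{(d-b)/2}$, then $$|T|\ \ge\ \frac{q^{b/2}}{\epsilon(q-1)(2q^{b/4}+1)}.$$ -/

import Mathlib

open Polynomial

noncomputable section

namespace PolarSpace

section Geometry

variable {K V : Type*} [Field K] [AddCommGroup V] [Module K V]

/-- Totally isotropic subspaces of `V` for a form `κ` in two variables. -/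
def TotallyIsotropic (κ : V → V → K) (W : Submodule K V) : Prop :=
  ∀ x ∈ W, ∀ y ∈ W, κ x y = 0

/-- Totally singular subspaces of `V` for a quadratic form `Q`. -/
def TotallySingular (Q : V → K) (W : Submodule K V) : Prop :=
  ∀ x ∈ W, Q x = 0

/-- The polar space is given by its totally isotropic (or totally singular) subspaces `S`.
An `m`-ovoid is a set of points of the polar space that meets each generator, that is, each
maximal totally isotropic (singular) subspace, in exactly `m` points. -/
def IsMOvoid (S : Submodule K V → Prop) (m : ℕ) (M : Set (Projectivization K V)) : Prop :=
  (∀ p ∈ M, S p.submodule) ∧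
    ∀ W : Submodule K V, Maximal S W → {p ∈ M | p.submodule ≤ W}.ncard = m

variable (K) in
/-- The set `{⟨v⟩_K : F v ∈ 𝒯}` of one-dimensional `K`-subspaces of `V`. -/
def pointsWithValueIn {E : Type*} (F : V → E) (𝒯 : Set E) : Set (Projectivization K V) :=
  {p | ∃ (v : V) (hv : v ≠ 0), F v ∈ 𝒯 ∧ p = Projectivization.mk K v hv}

end Geometry

section Cosets

variable (K : Type*) [Field K]

/-- The nonzero elements of `K`. -/
def nonzeroElements : Set K := {c | c ≠ 0}

/-- The nonzero squares of `K`. -/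
def nonzeroSquares : Set K := {c | c ≠ 0 ∧ IsSquare c}

variable {K} {E : Type*} [Field E] [Algebra K E]

/-- `𝒯` is a set of nonzero elements of `E` that is invariant under multiplication by `G ⊆ K`. -/
def IsInvariantSet (G : Set K) (𝒯 : Set E) : Prop :=
  (∀ t ∈ 𝒯, t ≠ 0) ∧ ∀ c ∈ G, ∀ t ∈ 𝒯, c • t ∈ 𝒯

/-- `T` contains exactly one element of each coset `G • t`, `t ∈ 𝒯`, and nothing else. -/
def IsCosetReps (G : Set K) (𝒯 : Set E) (T : Finset E) : Prop :=
  (∀ t ∈ T, t ∈ 𝒯) ∧ ∀ x ∈ 𝒯, ∃! t, t ∈ T ∧ ∃ c ∈ G, x = c • t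

/-- `1/2` or `1` according as `q` is odd or even. -/
def epsilon (q : ℕ) : ℝ := if Odd q then 1 / 2 else 1

end Cosets

section Hermitian

variable (L₀ : Type*) {L : Type*} [Field L₀] [Field L] [Algebra L₀ L] {n : ℕ}

/-- The Hermitian form `κ'(x, y) = ∑ xᵢ yᵢ ^ |L₀|` on `Lⁿ`, where `L / L₀` is a quadratic extension
of finite fields. -/
def hermForm (x y : Fin n → L) : L := ∑ i, x i * y i ^ Nat.card L₀

/-- The map `H'(x) = κ'(x, x)`, with values in `L₀`; see `algebraMap_hermNorm`. -/
def hermNorm (x : Fin n → L) : L₀ := ∑ i, Algebra.norm L₀ (x i)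

theorem algebraMap_hermNorm [Finite L₀] [Finite L] (h : Module.finrank L₀ L = 2)
    (x : Fin n → L) : algebraMap L₀ L (hermNorm L₀ x) = hermForm L₀ x x := by
  simp only [hermNorm, hermForm, map_sum]
  refine Finset.sum_congr rfl fun i _ => ?_
  rw [FiniteField.algebraMap_norm_eq_prod_pow, h]
  simp [Finset.prod_range_succ]

end Hermitian

/-- The quadratic form
`Q'(x) = x₁x₂ + x₃x₄ + ⋯ + x₂ₖ₋₁x₂ₖ + (x₂ₖ₊₁² + a₀ x₂ₖ₊₁ x₂ₖ₊₂ + a₁ x₂ₖ₊₂²)` on `L ^ (2k + 2)`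
(coordinates are numbered from `0` in the code). It is elliptic when `X² + a₀ X + a₁` is
irreducible. -/
def ellipticForm {L : Type*} [Field L] {k : ℕ} (a₀ a₁ : L) (x : Fin (2 * k + 2) → L) : L :=
  (∑ i : Fin k, x ⟨2 * i, by omega⟩ * x ⟨2 * i + 1, by omega⟩) +
    (x ⟨2 * k, by omega⟩ ^ 2 + a₀ * x ⟨2 * k, by omega⟩ * x ⟨2 * k + 1, by omega⟩ +
      a₁ * x ⟨2 * k + 1, by omega⟩ ^ 2)

end PolarSpace

end

/-! Let R be the form Q' or H', F the field of its values, f = √|V| = q^(d/2), and D the set of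
vectors v with R(v) ∈ 𝒯. The proof evaluates the Fourier coefficient of D at one of its own elements
z in two ways.

Geometry: D meets every generator in N = m(q-1) vectors, and the prescribed m gives N = f|𝒯|/|F|.
Counting pairs in enlargements of totally isotropic subspaces shows that N determines |D ∩ W^⊥| from
|D ∩ W| (`card_perp_of_card_maximal`). The cases W = 0 and W = ⟨z⟩ give the coefficient N - f
(`sum_addChar_of_card_maximal`). The only input about the polar space is the number of isotropic
vectors in W^⊥, with a parameter ρ that is q for quadratic, √q for Hermitian and 1 for symplectic
spaces.

Arithmetic: every nontrivial Gauss sum of R equals -f, so the coefficient at y is -(f/|F|) times a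
sum over t ∈ 𝒯 of Kloosterman sums K(-t, -R(y)) (`sum_addChar_value_mem`). Weil's bound makes this
at most 2f|𝒯|/√|F|. Comparison gives |F| ≤ |𝒯|(2√|F| + 1), and |𝒯| is |T| times the order of the
group of scalars.

Weil's bound is proved from scratch. Over a quadratic extension, K becomes 2Q - K²
(`kloostermanSum_of_finrank_two`), so an excess over 2√Q, relative to the root of the field size, at
least quadruples at each quadratic step. Stepanov's method on y^Q - y = ax + b/x - γ bounds the sums
in this tower by a fixed constant times that root (`norm_kloostermanSum_traceChar_le`), a
contradiction. -/

open Polynomial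
set_option linter.unusedSectionVars false
noncomputable section

namespace PolarSpace

/-! ### Kloosterman sums over a quadratic extension. -/

section Kloosterman

variable {F : Type*} [Field F] [Fintype F] [DecidableEq F]

/-- The Kloosterman sum `∑_{x ≠ 0} ψ (a x + b / x)`. -/
def kloostermanSum (ψ : AddChar F ℂ) (a b : F) : ℂ := ∑ x with x ≠ 0, ψ (a * x + b / x)

theorem sum_addChar_mul_eq_zero {ψ : AddChar F ℂ} (hψ : ψ ≠ 1) {c : F} (hc : c ≠ 0) :
    ∑ x, ψ (c * x) = 0 := by
  have := AddChar.sum_mulShift c (AddChar.IsPrimitive.of_ne_one hψ)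
  simp_rw [mul_comm _ c, if_neg hc] at this
  exact_mod_cast this

variable {E : Type*} [Field E] [Fintype E] [DecidableEq E] [Algebra F E]

theorem algebraMap_trace_of_finrank_two (h : Module.finrank F E = 2) (x : E) :
    algebraMap F E (Algebra.trace F E x) = x + x ^ Fintype.card F := by
  rw [FiniteField.algebraMap_trace_eq_sum_pow, h]
  simp [Finset.sum_range_succ, Nat.card_eq_fintype_card]

theorem algebraMap_norm_of_finrank_two (h : Module.finrank F E = 2) (x : E) :
    algebraMap F E (Algebra.norm F x) = x * x ^ Fintype.card F := by
  rw [FiniteField.algebraMap_norm_eq_prod_pow, h]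
  simp [Finset.prod_range_succ, Nat.card_eq_fintype_card]

/-- Makes the trace of a x + b / x a function of the trace and norm of x alone, so that the
Kloosterman sum over E can be summed over fibres of (trace, norm). -/
theorem trace_inv_of_finrank_two (h : Module.finrank F E = 2) (x : E) (hx : x ≠ 0) :
    Algebra.trace F E x⁻¹ = Algebra.trace F E x / Algebra.norm F x := by
  apply (algebraMap F E).injective
  rw [map_div₀, algebraMap_trace_of_finrank_two h, algebraMap_trace_of_finrank_two h,
    algebraMap_norm_of_finrank_two h]
  have : x ^ Fintype.card F ≠ 0 := pow_ne_zero _ hx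
  rw [inv_pow]
  field_simp
  ring

/-- A quadratic polynomial over `F` is the characteristic polynomial of at most two elements of the
two quadratic étale algebras `F × F` and `E` together. -/
theorem card_add_mul_add_card_trace_norm_le (h : Module.finrank F E = 2) (p : F × F) :
    (Finset.univ.filter fun u : F × F => (u.1 + u.2, u.1 * u.2) = p).card +
      (Finset.univ.filter fun x : E => (Algebra.trace F E x, Algebra.norm F x) = p).card ≤ 2 := by
  obtain ⟨τ, ν⟩ := p
  have key : ∀ x : E, (Algebra.trace F E x, Algebra.norm F x) = (τ, ν) →
      x ^ 2 - algebraMap F E τ * x + algebraMap F E ν = 0 := by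
    intro x hx
    obtain ⟨h1, h2⟩ := Prod.mk.inj hx
    rw [← h1, ← h2, algebraMap_trace_of_finrank_two h, algebraMap_norm_of_finrank_two h]
    ring
  by_cases hroot : ∃ u : F × F, (u.1 + u.2, u.1 * u.2) = (τ, ν)
  · obtain ⟨⟨u, v⟩, huv⟩ := hroot
    obtain ⟨h1, h2⟩ := Prod.mk.inj huv
    simp only at h1 h2
    have hA : (Finset.univ.filter fun w : F × F => (w.1 + w.2, w.1 * w.2) = (τ, ν)) ⊆
        {(u, v), (v, u)} := by
      rintro ⟨w, z⟩ hw
      simp only [Finset.mem_filter, Finset.mem_univ, true_and, Prod.mk.injEq,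
        Finset.mem_insert, Finset.mem_singleton] at hw ⊢
      have : (w - u) * (w - v) = 0 := by linear_combination -w * h1 + h2 + w * hw.1 - hw.2
      rcases mul_eq_zero.1 this with h' | h'
      · left; have := sub_eq_zero.1 h'; subst this
        exact ⟨rfl, by linear_combination hw.1 - h1⟩
      · right; have := sub_eq_zero.1 h'; subst this
        exact ⟨rfl, by linear_combination hw.1 - h1⟩
    have hB : ∀ x : E, (Algebra.trace F E x, Algebra.norm F x) = (τ, ν) →
        u = v ∧ x = algebraMap F E u := by
      intro x hx
      have h3 := key x hx
      have h4 : (x - algebraMap F E u) * (x - algebraMap F E v) = 0 := by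
        rw [← h1, ← h2, map_add, map_mul] at h3
        linear_combination h3
      obtain ⟨h5, -⟩ := Prod.mk.inj hx
      rcases mul_eq_zero.1 h4 with h' | h'
      · have := sub_eq_zero.1 h'; subst this
        rw [Algebra.trace_algebraMap, h, two_nsmul] at h5
        exact ⟨by linear_combination h5 - h1, rfl⟩
      · have := sub_eq_zero.1 h'; subst this
        rw [Algebra.trace_algebraMap, h, two_nsmul] at h5
        have : u = v := by linear_combination h1 - h5
        exact ⟨this, by rw [this]⟩
    by_cases huv' : u = v
    · subst huv'
      have h1 := Finset.card_le_card hA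
      have h2 : (Finset.univ.filter fun x : E =>
          (Algebra.trace F E x, Algebra.norm F x) = (τ, ν)) ⊆ {algebraMap F E u} := by
        intro x hx
        simp only [Finset.mem_filter, Finset.mem_univ, true_and] at hx
        simpa using (hB x hx).2
      have h2 := Finset.card_le_card h2
      simp at h1 h2 ⊢
      omega
    · have h1 := (Finset.card_le_card hA).trans (Finset.card_le_two)
      have h2 : (Finset.univ.filter fun x : E =>
          (Algebra.trace F E x, Algebra.norm F x) = (τ, ν)) = ∅ := by
        refine Finset.filter_eq_empty_iff.2 fun x _ hx => huv' (hB x hx).1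
      rw [h2, Finset.card_empty]
      omega
  · have h1 : (Finset.univ.filter fun u : F × F => (u.1 + u.2, u.1 * u.2) = (τ, ν)) = ∅ :=
      Finset.filter_eq_empty_iff.2 fun u _ hu => hroot ⟨u, hu⟩
    rw [h1, Finset.card_empty, zero_add]
    have hne : (X ^ 2 - C (algebraMap F E τ) * X + C (algebraMap F E ν) : E[X]).natDegree = 2 := by
      compute_degree!
    have h0 : (X ^ 2 - C (algebraMap F E τ) * X + C (algebraMap F E ν) : E[X]) ≠ 0 := by
      intro h; rw [h] at hne; simp at hne
    calc _ ≤ (X ^ 2 - C (algebraMap F E τ) * X + C (algebraMap F E ν) : E[X]).roots.toFinset.card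
          := by
          refine Finset.card_le_card fun x hx => ?_
          simp only [Finset.mem_filter, Finset.mem_univ, true_and] at hx
          rw [Multiset.mem_toFinset, mem_roots h0]
          simpa [IsRoot] using key x hx
      _ ≤ _ := Multiset.toFinset_card_le _
      _ ≤ _ := card_roots' _
      _ = 2 := hne

/-- Summed over all p the two counts give |F|² + |E| = 2|F|², so the upper bound 2 is attained in
every fibre. -/
theorem card_add_mul_add_card_trace_norm (h : Module.finrank F E = 2) (p : F × F) :
    (Finset.univ.filter fun u : F × F => (u.1 + u.2, u.1 * u.2) = p).card +
      (Finset.univ.filter fun x : E => (Algebra.trace F E x, Algebra.norm F x) = p).card = 2 := by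
  have hE : Fintype.card E = Fintype.card F ^ 2 := by
    rw [Module.card_eq_pow_finrank (K := F), h]
  have hs : ∑ p : F × F, ((Finset.univ.filter fun u : F × F => (u.1 + u.2, u.1 * u.2) = p).card +
      (Finset.univ.filter fun x : E => (Algebra.trace F E x, Algebra.norm F x) = p).card) =
      ∑ p : F × F, 2 := by
    rw [Finset.sum_add_distrib, ← Finset.card_eq_sum_card_fiberwise (fun _ _ => by simp),
      ← Finset.card_eq_sum_card_fiberwise (fun _ _ => by simp)]
    simp [hE]
    ring
  exact (Finset.sum_eq_sum_iff_of_le fun p _ => card_add_mul_add_card_trace_norm_le h p).1 hs p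
    (Finset.mem_univ p)

theorem sum_add_mul_add_sum_trace_norm (h : Module.finrank F E = 2) (G : F × F → ℂ) :
    ∑ u : F × F, G (u.1 + u.2, u.1 * u.2) +
      ∑ x : E, G (Algebra.trace F E x, Algebra.norm F x) = 2 * ∑ p, G p := by
  have e1 : ∑ u : F × F, G (u.1 + u.2, u.1 * u.2) = ∑ p : F × F,
      ((Finset.univ.filter fun u : F × F => (u.1 + u.2, u.1 * u.2) = p).card : ℂ) * G p := by
    rw [← Finset.sum_fiberwise Finset.univ (fun u : F × F => (u.1 + u.2, u.1 * u.2))]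
    refine Finset.sum_congr rfl fun p _ => ?_
    rw [Finset.sum_congr rfl (g := fun _ => G p) fun u hu => by rw [(Finset.mem_filter.1 hu).2]]
    simp
  have e2 : ∑ x : E, G (Algebra.trace F E x, Algebra.norm F x) = ∑ p : F × F,
      ((Finset.univ.filter fun x : E =>
        (Algebra.trace F E x, Algebra.norm F x) = p).card : ℂ) * G p := by
    rw [← Finset.sum_fiberwise Finset.univ
      (fun x : E => (Algebra.trace F E x, Algebra.norm F x))]
    refine Finset.sum_congr rfl fun p _ => ?_
    rw [Finset.sum_congr rfl (g := fun _ => G p) fun u hu => by rw [(Finset.mem_filter.1 hu).2]]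
    simp
  rw [e1, e2, ← Finset.sum_add_distrib, Finset.mul_sum]
  refine Finset.sum_congr rfl fun p _ => ?_
  rw [← add_mul, ← Nat.cast_add, card_add_mul_add_card_trace_norm h]
  simp

/-- The Kloosterman sum over a quadratic extension. -/
theorem kloostermanSum_of_finrank_two (h : Module.finrank F E = 2) {ψ : AddChar F ℂ} (hψ : ψ ≠ 1)
    {a b : F} (ha : a ≠ 0) (hb : b ≠ 0) :
    kloostermanSum (ψ.compAddMonoidHom (Algebra.trace F E).toAddMonoidHom)
      (algebraMap F E a) (algebraMap F E b) =
      2 * Fintype.card F - kloostermanSum ψ a b ^ 2 := by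
  -- With trace τ and norm ν the exponent is aτ + bτ/ν. For τ = u + v, ν = uv it splits as (au +
  -- b/u) + (av + b/v), which gives the square of the sum over F.
  set G : F × F → ℂ := fun p => if p.2 = 0 then 0 else ψ (a * p.1 + b * (p.1 / p.2)) with hG
  have e := sum_add_mul_add_sum_trace_norm (E := E) h G
  have e1 : ∑ u : F × F, G (u.1 + u.2, u.1 * u.2) = kloostermanSum ψ a b ^ 2 := by
    rw [sq, kloostermanSum, Finset.sum_mul_sum, ← Finset.sum_product', Fintype.sum_prod_type,
      Finset.sum_product, Finset.sum_filter]
    refine Finset.sum_congr rfl fun x _ => ?_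
    rw [Finset.sum_filter]
    by_cases hx : x = 0
    · simp [hx, hG]
    simp only [ne_eq, hx, not_false_eq_true, if_true]
    refine Finset.sum_congr rfl fun y _ => ?_
    by_cases hy : y = 0
    · simp [hy, hG]
    simp only [hG, mul_eq_zero, hx, hy, or_self, if_false, not_false_eq_true, if_true,
      ← AddChar.map_add_eq_mul]
    congr 1
    field_simp
    ring
  have e2 : ∑ x : E, G (Algebra.trace F E x, Algebra.norm F x) =
      kloostermanSum (ψ.compAddMonoidHom (Algebra.trace F E).toAddMonoidHom)
      (algebraMap F E a) (algebraMap F E b) := by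
    rw [kloostermanSum, Finset.sum_filter]
    refine Finset.sum_congr rfl fun x _ => ?_
    by_cases hx : x = 0
    · simp [hx, hG, Algebra.norm_zero]
    have hN : Algebra.norm F x ≠ 0 := Algebra.norm_ne_zero_iff.2 hx
    simp only [hG, hN, if_false, ne_eq, hx, not_false_eq_true, if_true,
      AddChar.compAddMonoidHom_apply, LinearMap.toAddMonoidHom_coe, map_add]
    rw [← trace_inv_of_finrank_two h x hx, div_eq_mul_inv, ← Algebra.smul_def, ← Algebra.smul_def,
      map_smul, map_smul, smul_eq_mul, smul_eq_mul]
  have e3 : ∑ p, G p = Fintype.card F := by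
    rw [Fintype.sum_prod_type_right]
    -- For fixed ν ≠ 0 the exponent is (a + b/ν)τ, so only ν = -b/a survives the summation over τ.
    have : ∀ ν : F, ∑ τ : F, G (τ, ν) = if ν = -(b / a) then (Fintype.card F : ℂ) else 0 := by
      intro ν
      by_cases h0 : ν = 0
      · subst h0
        rw [if_neg (by rw [eq_comm, neg_eq_zero]; exact div_ne_zero hb ha)]
        simp [hG]
      simp only [hG, h0, if_false]
      split_ifs with h1
      · have : ∀ τ : F, a * τ + b * (τ / ν) = 0 := by
          intro τ; rw [h1]; field_simp; ring
        simp [this]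
      · have hc : a + b / ν ≠ 0 := by
          intro hc
          apply h1
          field_simp at hc ⊢
          linear_combination hc
        rw [← sum_addChar_mul_eq_zero hψ hc]
        refine Finset.sum_congr rfl fun τ _ => ?_
        congr 1; ring
    simp [this]
  rw [e1, e2, e3] at e
  linear_combination e

end Kloosterman

/-! ### Spans of monomials x^e y^f in a ring where y^Q = y + g. -/

section BoxSpan

variable (k : Type*) {A : Type*} [Field k] [CommRing A] [Algebra k A] (x : Aˣ) (y : A) (Q : ℕ)

/-- The span of the monomials `x ^ e * y ^ f` with `lo ≤ e ≤ hi` and `f < Q`. -/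
def boxSpan (lo hi : ℤ) : Submodule k A :=
  Submodule.span k ((fun p : ℤ × ℕ => ((x ^ p.1 : Aˣ) : A) * y ^ p.2) ''
    ((Finset.Icc lo hi ×ˢ Finset.range Q : Finset (ℤ × ℕ)) : Set (ℤ × ℕ)))

variable {Q} in
theorem monomial_mem_boxSpan {lo hi e : ℤ} {f : ℕ} (h₁ : lo ≤ e) (h₂ : e ≤ hi) (hf : f < Q) :
    ((x ^ e : Aˣ) : A) * y ^ f ∈ boxSpan k x y Q lo hi :=
  Submodule.subset_span ⟨(e, f), by simp [h₁, h₂, hf], rfl⟩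

variable {k x y Q} in
theorem boxSpan_induction {lo hi : ℤ} (N : Submodule k A)
    (h : ∀ (e : ℤ) (f : ℕ), lo ≤ e → e ≤ hi → f < Q → ((x ^ e : Aˣ) : A) * y ^ f ∈ N) :
    boxSpan k x y Q lo hi ≤ N := by
  refine Submodule.span_le.2 ?_
  rintro _ ⟨⟨e, f⟩, hp, rfl⟩
  simp only [Finset.coe_product, Finset.coe_Icc, Finset.coe_range, Set.mem_prod, Set.mem_Icc,
    Set.mem_Iio] at hp
  exact h e f hp.1.1 hp.1.2 hp.2

theorem boxSpan_mono {lo hi lo' hi' : ℤ} (h₁ : lo' ≤ lo) (h₂ : hi ≤ hi') :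
    boxSpan k x y Q lo hi ≤ boxSpan k x y Q lo' hi' :=
  boxSpan_induction _ fun _ _ he he' hf =>
    monomial_mem_boxSpan k x y (h₁.trans he) (he'.trans h₂) hf

variable {k x y Q} in
theorem zpow_mul_mem_boxSpan {lo hi : ℤ} {w : A} (hw : w ∈ boxSpan k x y Q lo hi) (j : ℤ) :
    ((x ^ j : Aˣ) : A) * w ∈ boxSpan k x y Q (lo + j) (hi + j) := by
  suffices h : boxSpan k x y Q lo hi ≤ (boxSpan k x y Q (lo + j) (hi + j)).comap
      (LinearMap.mulLeft k ((x ^ j : Aˣ) : A)) from h hw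
  refine boxSpan_induction _ fun e f he he' hf => ?_
  rw [Submodule.mem_comap, LinearMap.mulLeft_apply, ← mul_assoc, ← Units.val_mul, ← zpow_add]
  exact monomial_mem_boxSpan k x y (by omega) (by omega) hf

/-- The span of the powers `x ^ e` with `|e| ≤ N`. -/
def zpowSpan (N : ℤ) : Submodule k A :=
  Submodule.span k ((fun e : ℤ => ((x ^ e : Aˣ) : A)) '' Set.Icc (-N) N)

variable {k x} in
theorem zpow_mem_zpowSpan {N e : ℤ} (h₁ : -N ≤ e) (h₂ : e ≤ N) :
    ((x ^ e : Aˣ) : A) ∈ zpowSpan k x N := Submodule.subset_span ⟨e, ⟨h₁, h₂⟩, rfl⟩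

variable {k x} in
theorem zpowSpan_mono {N N' : ℤ} (h : N ≤ N') : zpowSpan k x N ≤ zpowSpan k x N' :=
  Submodule.span_mono (Set.image_mono (Set.Icc_subset_Icc (by omega) h))

variable {k x y Q} in
theorem zpowSpan_mul_mem_boxSpan {N : ℤ} {g : A} (hg : g ∈ zpowSpan k x N) {lo hi : ℤ} {w : A}
    (hw : w ∈ boxSpan k x y Q lo hi) : g * w ∈ boxSpan k x y Q (lo - N) (hi + N) := by
  suffices h : zpowSpan k x N ≤ (boxSpan k x y Q (lo - N) (hi + N)).comap
      (LinearMap.mulRight k w) from h hg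
  refine Submodule.span_le.2 ?_
  rintro _ ⟨e, ⟨h₁, h₂⟩, rfl⟩
  exact boxSpan_mono k x y Q (by omega) (by omega) (zpow_mul_mem_boxSpan hw e)

variable {k x y Q} in
-- Only y^(Q-1) overflows, and y^Q = y + g replaces the overflow by exponents of x in [-1, 1]; hence
-- the window grows by one on each side.
theorem mul_mem_boxSpan (hQ : 0 < Q) {g : A} (hg : g ∈ zpowSpan k x 1) (hy : y ^ Q = y + g)
    (hQ1 : 1 < Q) {lo hi : ℤ} {w : A} (hw : w ∈ boxSpan k x y Q lo hi) :
    y * w ∈ boxSpan k x y Q (lo - 1) (hi + 1) := by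
  suffices h : boxSpan k x y Q lo hi ≤ (boxSpan k x y Q (lo - 1) (hi + 1)).comap
      (LinearMap.mulLeft k y) from h hw
  refine boxSpan_induction _ fun e f he he' hf => ?_
  rw [Submodule.mem_comap, LinearMap.mulLeft_apply, mul_left_comm, ← pow_succ']
  by_cases hf' : f + 1 < Q
  · exact monomial_mem_boxSpan k x y (by omega) (by omega) hf'
  · rw [show f + 1 = Q by omega, hy, mul_add]
    refine add_mem ?_ ?_
    · have := monomial_mem_boxSpan k x y (lo := lo - 1) (hi := hi + 1) (e := e) (by omega)
        (by omega) hQ1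
      rwa [pow_one] at this
    · rw [mul_comm]
      refine boxSpan_mono k x y Q (show lo - 1 ≤ e - 1 by omega) (show e + 1 ≤ hi + 1 by omega)
        (zpowSpan_mul_mem_boxSpan hg ?_)
      have := monomial_mem_boxSpan k x y (lo := e) (hi := e) (e := e) le_rfl le_rfl hQ
      rwa [pow_zero, mul_one] at this

variable {k x y Q} in
-- Each factor y + h widens the window by N: the summand h costs N, and y costs 1 ≤ N.
theorem add_pow_mul_mem_boxSpan (hQ1 : 1 < Q) {g : A} (hg : g ∈ zpowSpan k x 1)
    (hy : y ^ Q = y + g) {N : ℤ} (hN : 1 ≤ N) {h : A} (hh : h ∈ zpowSpan k x N)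
    {lo hi : ℤ} {w : A} (hw : w ∈ boxSpan k x y Q lo hi) (f : ℕ) :
    (y + h) ^ f * w ∈ boxSpan k x y Q (lo - f * N) (hi + f * N) := by
  induction f with
  | zero => simpa using hw
  | succ f ih =>
    rw [pow_succ', mul_assoc, add_mul]
    refine add_mem (boxSpan_mono k x y Q ?_ ?_ (mul_mem_boxSpan (by omega) hg hy hQ1 ih))
      (boxSpan_mono k x y Q ?_ ?_ (zpowSpan_mul_mem_boxSpan hh ih)) <;> push_cast <;> linarith

end BoxSpan

/-! ### Iterated Frobenius powers of y. -/

section Frobenius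

variable (F : Type*) {k A : Type*} [Field F] [Fintype F] [Field k] [CommRing A] [Algebra F A]
  [Algebra k A] {x : Aˣ} {y : A}

theorem pow_card_add (u v : A) :
    (u + v) ^ Fintype.card F = u ^ Fintype.card F + v ^ Fintype.card F :=
  map_add (FiniteField.frobeniusAlgHom F A) u v

theorem pow_card_pow_sum (M : ℕ) {ι : Type*} (s : Finset ι) (u : ι → A) :
    (∑ i ∈ s, u i) ^ Fintype.card F ^ M = ∑ i ∈ s, u i ^ Fintype.card F ^ M := by
  induction M with
  | zero => simp
  | succ M ih =>
    simp_rw [pow_succ, pow_mul, ih]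
    exact map_sum (FiniteField.frobeniusAlgHom F A) _ s

theorem pow_card_mem_zpowSpan {N : ℤ} {h : A} (hh : h ∈ zpowSpan k x N) :
    h ^ Fintype.card F ∈ zpowSpan k x (N * Fintype.card F) := by
  have hQ : (0 : ℤ) < Fintype.card F := by exact_mod_cast Fintype.card_pos
  induction hh using Submodule.span_induction with
  | mem w hw =>
    obtain ⟨e, ⟨h₁, h₂⟩, rfl⟩ := hw
    simp only [← Units.val_pow_eq_pow_val, ← zpow_natCast, ← zpow_mul]
    exact zpow_mem_zpowSpan (by nlinarith) (by nlinarith)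
  | zero => simp [zero_pow (Fintype.card_ne_zero (α := F))]
  | add u v _ _ hu hv => rw [pow_card_add]; exact add_mem hu hv
  | smul c u _ hu => rw [_root_.smul_pow]; exact Submodule.smul_mem _ _ hu

/-- The correction obeys h' = g + h^Q, and the Q-th power stretches exponents by Q. High powers of y
are thus cheap: in the box they cost a window in x instead of a degree in y. -/
theorem exists_pow_card_pow_eq_add {g : A} (hg : g ∈ zpowSpan k x 1)
    (hy : y ^ Fintype.card F = y + g) (M : ℕ) :
    ∃ h ∈ zpowSpan k x ((Fintype.card F : ℤ) ^ M), y ^ Fintype.card F ^ (M + 1) = y + h := by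
  have hQ : (0 : ℤ) < Fintype.card F := by exact_mod_cast Fintype.card_pos
  induction M with
  | zero => exact ⟨g, by simpa using hg, by simpa using hy⟩
  | succ M ih =>
    obtain ⟨h, hh, e⟩ := ih
    refine ⟨g + h ^ Fintype.card F, add_mem (zpowSpan_mono ?_ hg) ?_, ?_⟩
    · exact_mod_cast Nat.one_le_pow _ _ Fintype.card_pos
    · rw [pow_succ]; exact pow_card_mem_zpowSpan F hh
    · rw [pow_succ _ (M + 1), pow_mul, e, pow_card_add, hy, add_assoc]

end Frobenius

/-! ### Linear independence of monomials on the generic curve. -/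

section QuadraticAlgebra

open QuadraticAlgebra

variable {k : Type*} [Field k] (β : k) (τ : k[X])

/-- From ω^(e+2) = τ ω^(e+1) - β ω^e with deg τ = Q. The strict inequality in the second conjunct
keeps the leading term from cancelling in the induction. -/
theorem degree_im_omega_pow {Q : ℕ} (hQ : 0 < Q) (hτ : τ.degree = Q) (e : ℕ) :
    ((⟨0, 1⟩ : QuadraticAlgebra k[X] (-C β) τ) ^ (e + 1)).im.degree = (Q * e : ℕ) ∧
      ((⟨0, 1⟩ : QuadraticAlgebra k[X] (-C β) τ) ^ e).im.degree < (Q * e + Q : ℕ) := by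
  induction e with
  | zero => simp [QuadraticAlgebra.im_one]
  | succ e ih =>
    obtain ⟨ih1, ih2⟩ := ih
    have hlt : ((⟨0, 1⟩ : QuadraticAlgebra k[X] (-C β) τ) ^ (e + 1)).im.degree <
        (Q * (e + 1) + Q : ℕ) := by
      rw [ih1]; exact_mod_cast (by nlinarith : Q * e < Q * (e + 1) + Q)
    refine ⟨?_, hlt⟩
    have him : ((⟨0, 1⟩ : QuadraticAlgebra k[X] (-C β) τ) ^ (e + 1 + 1)).im =
        τ * ((⟨0, 1⟩ : QuadraticAlgebra k[X] (-C β) τ) ^ (e + 1)).im -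
          C β * ((⟨0, 1⟩ : QuadraticAlgebra k[X] (-C β) τ) ^ e).im := by
      rw [pow_succ' _ (e + 1), pow_succ' _ e]
      simp [im_mul, re_mul]
      ring
    have hd : (τ * ((⟨0, 1⟩ : QuadraticAlgebra k[X] (-C β) τ) ^ (e + 1)).im).degree =
        (Q * (e + 1) : ℕ) := by
      rw [degree_mul, hτ, ih1, ← Nat.cast_add]; congr 1; ring
    rw [him, degree_sub_eq_left_of_degree_lt, hd]
    rw [hd]
    calc _ ≤ (C β).degree + _ := degree_mul_le _ _
      _ ≤ 0 + _ := by gcongr; exact degree_C_le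
      _ < _ := by rw [zero_add, show Q * (e + 1) = Q * e + Q by ring]; exact ih2

theorem eq_zero_of_sum_eq_zero_of_degree_injOn {ι : Type*} {s : Finset ι} {p : ι → k[X]}
    (h : ∑ i ∈ s, p i = 0) (hp : Set.Pairwise {i | i ∈ s ∧ p i ≠ 0} (Function.onFun Ne (degree ∘ p))) :
    ∀ i ∈ s, p i = 0 := by
  have := degree_sum_eq_of_disjoint p s hp
  rw [h, degree_zero, eq_comm, Finset.sup_eq_bot_iff] at this
  exact fun i hi => degree_eq_bot.1 (this i hi)

/-- The weight Q e + f plays the role of a pole order. For e > 0 the ω-coordinate of ω^e X^f has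
degree Q(e - 1) + f, so distinct weights cannot cancel. Terms with e = 0 have no ω-coordinate; once
the others are gone, they are distinct powers of X in the other coordinate. -/
theorem sum_smul_omega_pow_ne_zero {Q : ℕ} (hQ : 0 < Q) (hτ : τ.degree = Q) {ι : Type*}
    (s : Finset ι) (e f : ι → ℕ)
    (hinj : Set.InjOn (fun i => Q * e i + f i) s) (d : ι → k) (hd : ∃ i ∈ s, d i ≠ 0) :
    ∑ i ∈ s, d i • ((⟨0, 1⟩ : QuadraticAlgebra k[X] (-C β) τ) ^ e i * (⟨X, 0⟩) ^ f i) ≠ 0 := by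
  intro h0
  have hX : ∀ n : ℕ, (⟨X, 0⟩ : QuadraticAlgebra k[X] (-C β) τ) ^ n = ⟨X ^ n, 0⟩ :=
    fun n => (C_pow n X).symm
  have him : ∑ i ∈ s,
      C (d i) * (((⟨0, 1⟩ : QuadraticAlgebra k[X] (-C β) τ) ^ e i).im * X ^ f i) = 0 := by
    have := congrArg (imₗ (R := k[X]) (-C β) τ) h0
    rw [map_sum, map_zero] at this
    refine Eq.trans (Finset.sum_congr rfl fun i _ => ?_) this
    simp [imₗ, hX, im_mul, smul_eq_C_mul]
  have hre : ∑ i ∈ s,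
      C (d i) * (((⟨0, 1⟩ : QuadraticAlgebra k[X] (-C β) τ) ^ e i).re * X ^ f i) = 0 := by
    have := congrArg (reₗ (R := k[X]) (-C β) τ) h0
    rw [map_sum, map_zero] at this
    refine Eq.trans (Finset.sum_congr rfl fun i _ => ?_) this
    simp [reₗ, hX, re_mul, smul_eq_C_mul]
  have hpos : ∀ i ∈ s, e i ≠ 0 → d i = 0 := by
    have hdeg : ∀ i, e i ≠ 0 → d i ≠ 0 → (C (d i) *
        (((⟨0, 1⟩ : QuadraticAlgebra k[X] (-C β) τ) ^ e i).im * X ^ f i)).degree =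
        ((Q * (e i - 1) + f i : ℕ) : WithBot ℕ) := by
      intro i hei hdi
      obtain ⟨n, hn⟩ := Nat.exists_eq_succ_of_ne_zero hei
      rw [degree_C_mul hdi, degree_mul, degree_X_pow, hn, (degree_im_omega_pow β τ hQ hτ n).1]
      simp
    have := eq_zero_of_sum_eq_zero_of_degree_injOn him ?_
    · intro i hi hei
      by_contra hdi
      have h1 := hdeg i hei hdi
      rw [this i hi, degree_zero] at h1
      exact absurd h1.symm (WithBot.natCast_ne_bot _)
    · rintro i ⟨hi, hi0⟩ j ⟨hj, hj0⟩ hij hd'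
      have hne : ∀ i, C (d i) *
        (((⟨0, 1⟩ : QuadraticAlgebra k[X] (-C β) τ) ^ e i).im * X ^ f i) ≠ 0 →
          e i ≠ 0 ∧ d i ≠ 0 := by
        intro i h
        refine ⟨fun h' => h ?_, fun h' => h ?_⟩
        · simp [h', im_one]
        · simp [h']
      obtain ⟨hei, hdi⟩ := hne i hi0
      obtain ⟨hej, hdj⟩ := hne j hj0
      simp only [Function.comp_apply] at hd'
      rw [hdeg i hei hdi, hdeg j hej hdj, Nat.cast_inj] at hd'
      refine hij (hinj hi hj ?_)
      obtain ⟨n, hn⟩ := Nat.exists_eq_succ_of_ne_zero hei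
      obtain ⟨m, hm⟩ := Nat.exists_eq_succ_of_ne_zero hej
      simp only [hn, hm, Nat.succ_eq_add_one, Nat.add_sub_cancel] at hd' ⊢
      linarith
  have hzero : ∀ i ∈ s, d i ≠ 0 → e i = 0 := fun i hi h => by
    by_contra h'; exact h (hpos i hi h')
  have hre' : ∑ i ∈ s, C (d i) * X ^ f i = 0 := by
    refine Eq.trans (Finset.sum_congr rfl fun i hi => ?_) hre
    by_cases hdi : d i = 0
    · simp [hdi]
    · simp [hzero i hi hdi, re_one]
  have := eq_zero_of_sum_eq_zero_of_degree_injOn hre' ?_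
  · obtain ⟨i, hi, hdi⟩ := hd
    simpa [hdi] using this i hi
  · rintro i ⟨hi, hi0⟩ j ⟨hj, hj0⟩ hij hd'
    have hdi : d i ≠ 0 := fun h => hi0 (by simp [h])
    have hdj : d j ≠ 0 := fun h => hj0 (by simp [h])
    simp only [Function.comp_apply] at hd'
    rw [degree_C_mul hdi, degree_C_mul hdj, degree_X_pow, degree_X_pow, Nat.cast_inj] at hd'
    exact hij (hinj hi hj (by simp [hd', hzero i hi hdi, hzero j hj hdj]))

end QuadraticAlgebra

/-! ### Stepanov's method for y^Q - y = a x + b / x - γ. -/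

section Stepanov

universe u v

variable (F : Type v) {k : Type u} [Field F] [Fintype F] [Field k]

section Auxiliary

variable {A : Type*} [CommRing A] [Algebra F A] [Algebra k A] {x : Aˣ} {y g : A}

/-- With R = Q^(M+1), the power y^(f'R) is (y + h)^f' where h has window Q^M, and f' ≤ Q - 1 gives
the radius (Q - 1)Q^M around the exponent of x. -/
theorem pow_mul_pow_mem_boxSpan (hg : g ∈ zpowSpan k x 1) (hy : y ^ Fintype.card F = y + g) (M : ℕ)
    {e e' f f' : ℕ} (hf : f < Fintype.card F) (hf' : f' < Fintype.card F) :
    ((x : A) ^ e' * y ^ f') ^ Fintype.card F ^ (M + 1) * ((x : A) ^ e * y ^ f) ∈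
      boxSpan k x y (Fintype.card F)
        ((e' * Fintype.card F ^ (M + 1) + e : ℤ) - (Fintype.card F - 1) * Fintype.card F ^ M)
        ((e' * Fintype.card F ^ (M + 1) + e : ℤ) + (Fintype.card F - 1) * Fintype.card F ^ M) := by
  obtain ⟨h, hh, e1⟩ := exists_pow_card_pow_eq_add F hg hy M
  have h1 : ((x : A) ^ e' * y ^ f') ^ Fintype.card F ^ (M + 1) * ((x : A) ^ e * y ^ f) =
      (y + h) ^ f' * (((x ^ ((e' * Fintype.card F ^ (M + 1) + e : ℕ) : ℤ) : Aˣ) : A) * y ^ f) := by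
    rw [← e1, zpow_natCast, Units.val_pow_eq_pow_val]
    ring
  have hN : (1 : ℤ) ≤ (Fintype.card F : ℤ) ^ M := by
    exact_mod_cast Nat.one_le_pow _ _ Fintype.card_pos
  rw [h1]
  have hm := add_pow_mul_mem_boxSpan (Fintype.one_lt_card (α := F)) hg hy hN hh
    (monomial_mem_boxSpan k x y (lo := ((e' * Fintype.card F ^ (M + 1) + e : ℕ) : ℤ))
      (hi := ((e' * Fintype.card F ^ (M + 1) + e : ℕ) : ℤ)) le_rfl le_rfl hf) f'
  have hf'' : (f' : ℤ) ≤ Fintype.card F - 1 := by omega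
  have := mul_le_mul_of_nonneg_right hf'' (zero_le_one.trans hN)
  refine boxSpan_mono k x y _ ?_ ?_ hm <;> push_cast <;> linarith

variable (x y) in
/-- The monomial `x ^ e * y ^ f` with `n = Q e + f` and `f < Q`. -/
def digitMonomial (Q n : ℕ) : A := (x : A) ^ (n / Q) * y ^ (n % Q)

/-- Dimension count. There are R·Q(s + 3) = Q(Qs² + 3Qs) products, all in a box spanned by at most
Q(Qs² + (Q - 1)s + 3) monomials; the 3 in s + 3 leaves the slack needed even for Q = 2, s = 1. -/
theorem exists_relation {Q M s R : ℕ} (hQ : Q = Fintype.card F) (hs : s = Q ^ M)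
    (hR' : R = Q ^ (M + 1)) (hg : g ∈ zpowSpan k x 1) (hy : y ^ Q = y + g) :
    ∃ c : Fin R × Fin (Q * (s + 3)) → k,
      ∑ i, c i • (digitMonomial x y Q i.1 ^ R * digitMonomial x y Q i.2) = 0 ∧
        ∃ i, c i ≠ 0 := by
  rw [← Fintype.not_linearIndependent_iff]
  intro hli
  have hR : Q ^ (M + 1) = Q * s := by rw [hs]; ring
  have hQ2 : 2 ≤ Q := hQ ▸ Fintype.one_lt_card (α := F)
  have hmod : ∀ n, n % Q < Fintype.card F := fun n => (Nat.mod_lt n (by omega)).trans_eq hQ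
  have hs1 : 1 ≤ s := hs ▸ Nat.one_le_pow _ _ (by omega)
  rw [hQ] at hy
  set lo : ℤ := -((Q - 1) * s) with hlo
  set hi : ℤ := (s - 1) * (Q * s) + (s + 2) + (Q - 1) * s with hhi
  set S : Set A := (fun p : ℤ × ℕ => ((x ^ p.1 : Aˣ) : A) * y ^ p.2) ''
    ((Finset.Icc lo hi ×ˢ Finset.range Q : Finset (ℤ × ℕ)) : Set (ℤ × ℕ)) with hS
  have : Fintype S := ((Finset.finite_toSet _).image _).fintype
  have hcard := linearIndependent_le_span' _ hli S (by
      rintro _ ⟨⟨i, j⟩, rfl⟩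
      have hm := pow_mul_pow_mem_boxSpan F hg hy M (e := j / Q) (e' := i / Q)
        (hmod j) (hmod i)
      rw [← hQ, ← hR'] at hm
      refine boxSpan_mono k x y _ ?_ ?_ hm
      · rw [hlo]
        have : (0 : ℤ) ≤ ((i / Q : ℕ) : ℤ) * (Q : ℤ) ^ (M + 1) + ((j / Q : ℕ) : ℤ) := by positivity
        have h5 : (Q : ℤ) ^ M = s := by exact_mod_cast hs.symm
        rw [h5]
        linarith
      · have h1 : ((i : ℕ) / Q : ℕ) + 1 ≤ s := Nat.div_lt_of_lt_mul ((hR'.trans hR) ▸ i.2)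
        have h2 : ((j : ℕ) / Q : ℕ) + 1 ≤ s + 3 := Nat.div_lt_of_lt_mul j.2
        have h1' : ((((i : ℕ) / Q : ℕ) : ℕ) : ℤ) ≤ s - 1 := by omega
        have h2' : ((((j : ℕ) / Q : ℕ) : ℕ) : ℤ) ≤ s + 2 := by omega
        have h3 := mul_le_mul_of_nonneg_right h1' (show (0 : ℤ) ≤ Q * s by positivity)
        have h4 : (Q : ℤ) ^ (M + 1) = Q * s := by exact_mod_cast hR
        have h5 : (Q : ℤ) ^ M = s := by exact_mod_cast hs.symm
        rw [hhi, h4, h5]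
        linarith)
  rw [Cardinal.mk_fintype, Nat.cast_le, Fintype.card_prod, Fintype.card_fin, Fintype.card_fin,
    hR', hR] at hcard
  have hle : Fintype.card S ≤ (hi + 1 - lo).toNat * Q := by
    rw [← Nat.card_eq_fintype_card, Nat.card_coe_set_eq]
    refine (Set.ncard_image_le (Finset.finite_toSet _)).trans ?_
    rw [Set.ncard_coe_finset, Finset.card_product, Int.card_Icc, Finset.card_range]
  have h6 := hcard.trans hle
  have h7 : s * Q * (s + 3) ≤ (hi + 1 - lo).toNat := by
    refine Nat.le_of_mul_le_mul_right (le_trans (le_of_eq ?_) h6) (by omega : 0 < Q)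
    ring
  have h8 : ((s * Q * (s + 3) : ℕ) : ℤ) ≤ hi + 1 - lo := by
    have hpos : 0 < s * Q * (s + 3) := by positivity
    omega
  rw [hhi, hlo] at h8
  push_cast at h8
  have : (2 : ℤ) * s ≤ Q * s := by
    exact_mod_cast Nat.mul_le_mul_right s hQ2
  have : (1 : ℤ) ≤ s := by exact_mod_cast hs1
  nlinarith

/-- The box estimate with the R-th power moved to the other factor. Its width, about sR, will bound
the number of zeros of a Laurent polynomial in x. -/
theorem sum_mem_boxSpan {Q M s R : ℕ} (hQ : Q = Fintype.card F) (hs : s = Q ^ M)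
    (hR' : R = Q ^ (M + 1)) (hg : g ∈ zpowSpan k x 1) (hy : y ^ Q = y + g)
    (d : Fin R × Fin (Q * (s + 3)) → k) :
    ∃ lo hi : ℤ, hi - lo ≤ s * R + 5 * R ∧
      ∑ i, d i • (digitMonomial x y Q i.1 * digitMonomial x y Q i.2 ^ R) ∈
        boxSpan k x y Q lo hi := by
  have hR : Q ^ (M + 1) = Q * s := by rw [hs]; ring
  have hQ2 : 2 ≤ Q := hQ ▸ Fintype.one_lt_card (α := F)
  have hmod : ∀ n, n % Q < Fintype.card F := fun n => (Nat.mod_lt n (by omega)).trans_eq hQ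
  have hs1 : 1 ≤ s := hs ▸ Nat.one_le_pow _ _ (by omega)
  rw [hQ] at hy
  have h4 : (Q : ℤ) ^ (M + 1) = Q * s := by exact_mod_cast hR
  have h5 : (Q : ℤ) ^ M = s := by exact_mod_cast hs.symm
  refine ⟨-((Q - 1) * s), (s + 2) * (Q * s) + (s - 1) + (Q - 1) * s, ?_,
    sum_mem fun i _ => Submodule.smul_mem _ _ ?_⟩
  · have h6 : (R : ℤ) = Q * s := by rw [hR']; exact_mod_cast hR
    rw [h6]
    have : (2 : ℤ) * s ≤ Q * s := by
      exact_mod_cast Nat.mul_le_mul_right s hQ2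
    nlinarith
  · obtain ⟨i, j⟩ := i
    have hm := pow_mul_pow_mem_boxSpan F hg hy M (e := i / Q) (e' := j / Q)
      (hmod i) (hmod j)
    rw [← hQ, ← hR'] at hm
    change digitMonomial x y Q i * digitMonomial x y Q j ^ R ∈ _
    rw [mul_comm (digitMonomial x y Q i)]
    refine boxSpan_mono k x y _ ?_ ?_ hm
    · rw [h4, h5]
      have : (0 : ℤ) ≤ ((j / Q : ℕ) : ℤ) * (Q * s) + ((i / Q : ℕ) : ℤ) := by positivity
      linarith
    · have h1 : ((i : ℕ) / Q : ℕ) + 1 ≤ s := Nat.div_lt_of_lt_mul ((hR'.trans hR) ▸ i.2)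
      have h2 : ((j : ℕ) / Q : ℕ) + 1 ≤ s + 3 := Nat.div_lt_of_lt_mul j.2
      have h1' : ((((i : ℕ) / Q : ℕ) : ℕ) : ℤ) ≤ s - 1 := by omega
      have h2' : ((((j : ℕ) / Q : ℕ) : ℕ) : ℤ) ≤ s + 2 := by omega
      have h3 := mul_le_mul_of_nonneg_right h2' (show (0 : ℤ) ≤ Q * s by positivity)
      rw [h4, h5]
      linarith

end Auxiliary

/-- The generic point and the rational points of the curve `y ^ Q - y = a x + b / x - γ`. -/
theorem exists_curve_algebra [Fintype k] [Algebra F k] {a b γ : k} (ha : a ≠ 0) (hb : b ≠ 0) :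
    ∃ (A : Type u) (_ : CommRing A) (_ : Algebra F A) (_ : Algebra k A) (x : Aˣ) (y g : A),
      g ∈ zpowSpan k x 1 ∧ (y ^ Fintype.card F = y + g) ∧
      (∀ x₀ y₀ : k, x₀ ≠ 0 → y₀ ^ Fintype.card F - y₀ = a * x₀ + b / x₀ - γ →
        ∃ φ : A →ₐ[k] k, φ x = x₀ ∧ φ y = y₀) ∧
      ∀ {ι : Type} [Fintype ι] (e f : ι → ℕ),
        Function.Injective (fun i => Fintype.card F * e i + f i) → ∀ d : ι → k, (∃ i, d i ≠ 0) →
        ∑ i, d i • ((x : A) ^ e i * y ^ f i) ≠ 0 := by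
  set Q := Fintype.card F with hQ
  have hQ2 : 1 < Q := Fintype.one_lt_card
  -- The curve equation reads x² - τx + b/a = 0 with y = X, so x is the generator ω of a quadratic
  -- algebra over k[X].
  set τ : k[X] := C a⁻¹ * (X ^ Q - X + C γ) with hτ
  have hdeg : τ.degree = Q := by
    rw [hτ, degree_C_mul (inv_ne_zero ha)]
    have h1 : (-X + C γ : k[X]).degree < (X ^ Q : k[X]).degree := by
      rw [degree_X_pow]
      refine lt_of_le_of_lt (degree_add_le _ _) (max_lt ?_ ?_)
      · rw [degree_neg, degree_X]; exact_mod_cast hQ2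
      · exact lt_of_le_of_lt degree_C_le (by exact_mod_cast (by omega : 0 < Q))
    rw [show (X ^ Q - X + C γ : k[X]) = X ^ Q + (-X + C γ) by ring,
      degree_add_eq_left_of_degree_lt h1, degree_X_pow]
  let B := QuadraticAlgebra k[X] (-C (b / a)) τ
  -- The ring is a product: the generic factor B carries linear independence, and the factor of
  -- functions on the rational points makes evaluation a mere projection.
  let P := {p : k × k // p.1 ≠ 0 ∧ p.2 ^ Q - p.2 = a * p.1 + b / p.1 - γ}
  have hinv : (⟨0, 1⟩ : B) * ⟨C (a / b) * τ, -C (a / b)⟩ = 1 := by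
    have : C (b / a) * C (a / b) = (1 : k[X]) := by
      rw [← C_mul, div_mul_div_cancel₀ ha, div_self hb, C_1]
    ext1
    · simp [QuadraticAlgebra.re_one, this]
    · simp [QuadraticAlgebra.im_one]; ring
  let x : (B × (P → k))ˣ :=
    { val := (⟨0, 1⟩, fun p => p.1.1)
      inv := (⟨C (a / b) * τ, -C (a / b)⟩, fun p => (p.1.1)⁻¹)
      val_inv := by
        ext1
        · exact hinv
        · ext p; exact mul_inv_cancel₀ p.2.1
      inv_val := by
        ext1
        · exact (mul_comm _ _).trans hinv
        · ext p; exact inv_mul_cancel₀ p.2.1 }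
  let y : B × (P → k) := (⟨X, 0⟩, fun p => p.1.2)
  refine ⟨B × (P → k), inferInstance, inferInstance, inferInstance, x, y,
    a • (x : B × (P → k)) + b • ((x⁻¹ : (B × (P → k))ˣ) : B × (P → k)) - γ • (1 : B × (P → k)), ?_, ?_, ?_, ?_⟩
  · refine sub_mem (add_mem (Submodule.smul_mem _ _ ?_) (Submodule.smul_mem _ _ ?_))
      (Submodule.smul_mem _ _ ?_)
    · simpa using zpow_mem_zpowSpan (k := k) (x := x) (N := 1) (e := 1) (by norm_num) (by norm_num)
    · simpa using zpow_mem_zpowSpan (k := k) (x := x) (N := 1) (e := -1) (by norm_num) (by norm_num)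
    · simpa using zpow_mem_zpowSpan (k := k) (x := x) (N := 1) (e := 0) (by norm_num) (by norm_num)
  · ext1
    · have hX : (⟨X, 0⟩ : B) ^ Q = ⟨X ^ Q, 0⟩ := (QuadraticAlgebra.C_pow Q X).symm
      have h1 : C b * C (a / b) = (C a : k[X]) := by rw [← C_mul, mul_div_cancel₀ _ hb]
      have h2 : C a * C a⁻¹ = (1 : k[X]) := by rw [← C_mul, mul_inv_cancel₀ ha, C_1]
      change (⟨X, 0⟩ : B) ^ Q = ⟨X, 0⟩ + (a • (⟨0, 1⟩ : B) + b • (⟨C (a / b) * τ, -C (a / b)⟩ : B) -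
        γ • (1 : B))
      rw [hX]
      ext1
      · change X ^ Q = X + (a • (0 : k[X]) + b • (C (a / b) * τ) - γ • (1 : k[X]))
        simp only [smul_eq_C_mul, hτ]
        linear_combination (-(C a⁻¹ * (X ^ Q - X + C γ))) * h1 - (X ^ Q - X + C γ) * h2
      · change 0 = 0 + (a • (1 : k[X]) + b • (-C (a / b)) - γ • (0 : k[X]))
        simp only [smul_eq_C_mul]
        linear_combination h1
    · ext p
      have hp := p.2.2
      change p.1.2 ^ Q = p.1.2 + (a * p.1.1 + b * (p.1.1)⁻¹ - γ * 1)
      rw [div_eq_mul_inv] at hp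
      linear_combination hp
  · intro x₀ y₀ hx₀ hy₀
    refine ⟨(Pi.evalAlgHom k (fun _ : P => k) ⟨(x₀, y₀), hx₀, hy₀⟩).comp (AlgHom.snd k B _),
      rfl, rfl⟩
  · intro ι _ e f hinj d hd h0
    refine sum_smul_omega_pow_ne_zero (b / a) τ (by omega : 0 < Q) hdeg Finset.univ e f
      hinj.injOn d (by simpa using hd) ?_
    have := congrArg Prod.fst h0
    rw [Prod.fst_sum] at this
    exact this

/-- Stepanov's bound for the number of `x` below a rational point of
`y ^ Q - y = a x + b / x - γ`. -/
theorem card_below_rational_points_le [Fintype k] [DecidableEq k] [Algebra F k] (M : ℕ)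
    (hk : Fintype.card k = (Fintype.card F ^ (M + 1)) ^ 2) {a b : k} (γ : k) (ha : a ≠ 0)
    (hb : b ≠ 0) :
    (Finset.univ.filter fun x : k => x ≠ 0 ∧
      ∃ y : k, y ^ Fintype.card F - y = a * x + b / x - γ).card ≤
      Fintype.card F ^ M * Fintype.card F ^ (M + 1) + 5 * Fintype.card F ^ (M + 1) := by
  obtain ⟨A, _, _, _, x, y, g, hg, hy, heval, hgen⟩ :=
    exists_curve_algebra F (γ := γ) ha hb
  obtain ⟨Q, hQ⟩ : ∃ Q, Q = Fintype.card F := ⟨_, rfl⟩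
  have hQ2 : 1 < Q := hQ ▸ Fintype.one_lt_card
  have hadd : ∀ u v : k, (u + v) ^ Q = u ^ Q + v ^ Q := hQ ▸ pow_card_add F
  have hpow : ∀ t : F, t ^ Q = t := hQ ▸ FiniteField.pow_card
  simp only [← hQ] at hk hy heval hgen ⊢
  obtain ⟨s, hs⟩ : ∃ s, s = Q ^ M := ⟨_, rfl⟩
  obtain ⟨R, hR⟩ : ∃ R, R = Q ^ (M + 1) := ⟨_, rfl⟩
  obtain ⟨c, hc, i₀, hi₀⟩ := exists_relation (k := k) F hQ hs hR hg hy
  obtain ⟨lo, hi, hlh, hmem⟩ := sum_mem_boxSpan (k := k) F hQ hs hR hg hy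
    fun i => c i ^ R
  rw [← hR] at hk
  rw [← hs, ← hR]
  have hkR : ∀ t : k, (t ^ R) ^ R = t := fun t => by
    rw [← pow_mul, ← sq, ← hk, FiniteField.pow_card]
  have hsum : ∀ {ι : Type} (t : Finset ι) (u : ι → k), (∑ i ∈ t, u i) ^ R = ∑ i ∈ t, u i ^ R := by
    intro ι t u; rw [hR, hQ]; exact pow_card_pow_sum F (M + 1) t u
  -- At a rational point values satisfy t^(R²) = t, so G^R takes there the value of the relation ∑
  -- c_ij m_i^R m_j = 0. Hence G vanishes at all rational points, although it is nonzero in A.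
  set G := ∑ i, c i ^ R • (digitMonomial x y Q i.1 * digitMonomial x y Q i.2 ^ R) with hG
  have hG0 : G ≠ 0 := by
    have := hgen (fun i : Fin R × Fin (Q * (s + 3)) => i.1 / Q + i.2 / Q * R)
      (fun i => i.1 % Q + i.2 % Q * R) ?_ (fun i => c i ^ R) ⟨i₀, pow_ne_zero _ hi₀⟩
    · rw [hG]
      convert this using 3 with i
      simp only [digitMonomial, pow_add, pow_mul]
      ring
    · rintro ⟨i, j⟩ ⟨i', j'⟩ h
      -- The product m_i m_j^R has weight i + R j, which determines (i, j) because i < R.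
      have hw : ∀ (i : Fin R) (j : Fin (Q * (s + 3))),
          Q * ((i : ℕ) / Q + (j : ℕ) / Q * R) + ((i : ℕ) % Q + (j : ℕ) % Q * R) = i + R * j := by
        intro i j
        conv_rhs => rw [← Nat.div_add_mod i Q, ← Nat.div_add_mod j Q]
        ring
      simp only [hw] at h
      have hpos : 0 < R := by rw [hR]; positivity
      have h1 := congrArg (· % R) h
      have h2 := congrArg (· / R) h
      simp only [Nat.add_mul_mod_self_left, Nat.mod_eq_of_lt i.2, Nat.mod_eq_of_lt i'.2,
        Nat.add_mul_div_left _ _ hpos, Nat.div_eq_of_lt i.2, Nat.div_eq_of_lt i'.2, zero_add]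
        at h1 h2
      exact Prod.ext (Fin.ext h1) (Fin.ext h2)
  have hvan : ∀ φ : A →ₐ[k] k, φ G = 0 := by
    intro φ
    have h1 : (φ G) ^ R = φ (∑ i, c i • (digitMonomial x y Q i.1 ^ R * digitMonomial x y Q i.2)) := by
      rw [hG, map_sum, map_sum, hsum]
      refine Finset.sum_congr rfl fun i _ => ?_
      rw [map_smul, map_smul, smul_eq_mul, smul_eq_mul, mul_pow, hkR, map_mul, map_mul, mul_pow,
        map_pow, map_pow, hkR]
    rw [hc, map_zero] at h1
    exact eq_zero_of_pow_eq_zero h1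
  obtain ⟨γ', hγ'⟩ : ∃ γ' : ℤ × ℕ → k, ∑ p ∈ Finset.Icc lo hi ×ˢ Finset.range Q,
      γ' p • (((x ^ p.1 : Aˣ) : A) * y ^ p.2) = G :=
    (Submodule.mem_span_image_finset_iff_exists_fun' k).1 hmem
  have hcoef : ∀ x₀ ∈ (Finset.univ.filter fun x : k => x ≠ 0 ∧
      ∃ y : k, y ^ Q - y = a * x + b / x - γ), ∀ f < Q,
      ∑ e ∈ Finset.Icc lo hi, γ' (e, f) * x₀ ^ e = 0 := by
    intro x₀ hx₀ f hf
    simp only [Finset.mem_filter, Finset.mem_univ, true_and] at hx₀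
    obtain ⟨hx0, y₀, hy₀⟩ := hx₀
    -- On the fibre over x₀, G is a polynomial in y of degree less than Q. It vanishes at the Q
    -- points y₀ + t with t ∈ F, so each coefficient vanishes at x₀.
    set p : k[X] := ∑ f ∈ Finset.range Q,
      C (∑ e ∈ Finset.Icc lo hi, γ' (e, f) * x₀ ^ e) * X ^ f with hp
    have hp0 : p = 0 := by
      have hinj : Function.Injective fun t : F => y₀ + algebraMap F k t := fun t t' h =>
        (algebraMap F k).injective (add_left_cancel h)
      refine eq_zero_of_natDegree_lt_card_of_eval_eq_zero p hinj (fun t => ?_) ?_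
      · obtain ⟨φ, hφx, hφy⟩ := heval x₀ (y₀ + algebraMap F k t) hx0 (by
          rw [hadd, ← map_pow, hpow, ← hy₀]; ring)
        have h1 := hvan φ
        rw [← hγ', map_sum, Finset.sum_product_right] at h1
        rw [← h1, hp, eval_finsetSum]
        refine Finset.sum_congr rfl fun f _ => ?_
        rw [eval_mul, eval_C, eval_pow, eval_X, Finset.sum_mul]
        refine Finset.sum_congr rfl fun e _ => ?_
        have hz : φ ((x ^ e : Aˣ) : A) = x₀ ^ e := by
          have : Units.map (φ : A →* k) (x ^ e) = (Units.mk0 x₀ hx0) ^ e := by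
            rw [map_zpow]; congr 1; ext; exact hφx
          have := congrArg (Units.val) this
          rwa [Units.coe_map, Units.val_zpow_eq_zpow_val] at this
        rw [map_smul, smul_eq_mul, map_mul, map_pow, hφy, hz, mul_assoc]
      · have : p.degree < Q := by
          rw [hp]
          refine (degree_sum_le _ _).trans_lt ((Finset.sup_lt_iff (WithBot.bot_lt_coe Q)).2 ?_)
          intro f hf
          exact (degree_C_mul_X_pow_le _ _).trans_lt (by
            exact WithBot.coe_lt_coe.2 (Finset.mem_range.1 hf))
        by_cases h0 : p = 0
        · rw [h0, natDegree_zero]; exact Fintype.card_pos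
        · rw [← hQ]; exact (natDegree_lt_iff_degree_lt h0).2 this
    have := congrArg (fun q => coeff q f) hp0
    simp only [hp, finsetSum_coeff, coeff_C_mul, coeff_X_pow, coeff_zero] at this
    simpa [hf] using this
  obtain ⟨e₁, f₁, he₁, he₁', hf₁, hne⟩ : ∃ (e : ℤ) (f : ℕ), lo ≤ e ∧ e ≤ hi ∧ f < Q ∧
      γ' (e, f) ≠ 0 := by
    by_contra! hcon
    apply hG0
    rw [← hγ']
    refine Finset.sum_eq_zero fun p hp => ?_
    simp only [Finset.mem_product, Finset.mem_Icc, Finset.mem_range] at hp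
    rw [hcon p.1 p.2 hp.1.1 hp.1.2 hp.2, zero_smul]
  have hhl : lo ≤ hi := he₁.trans he₁'
  by_contra! hlt
  set N := (hi - lo).toNat with hN
  -- This is x^(-lo) times a nonzero coefficient of G in y: a polynomial of degree at most hi - lo
  -- with a zero at every counted x₀.
  set p : k[X] := ∑ j ∈ Finset.range (N + 1), C (γ' (lo + j, f₁)) * X ^ j with hp
  have hdeg : p.natDegree ≤ N := by
    refine natDegree_sum_le_of_forall_le _ _ fun j hj => ?_
    exact (natDegree_C_mul_X_pow_le _ _).trans (Nat.lt_succ_iff.1 (Finset.mem_range.1 hj))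
  have hp0 : p = 0 := by
    refine eq_zero_of_natDegree_lt_card_of_eval_eq_zero' p _ (fun x₀ hx₀ => ?_)
      (lt_of_le_of_lt ?_ hlt)
    · have h1 := hcoef x₀ hx₀ f₁ hf₁
      have hx0 : x₀ ≠ 0 := (Finset.mem_filter.1 hx₀).2.1
      have h2 : ∑ e ∈ Finset.Icc lo hi, γ' (e, f₁) * x₀ ^ e = x₀ ^ lo * p.eval x₀ := by
        rw [hp, eval_finsetSum, Finset.mul_sum]
        symm
        refine Finset.sum_bij (fun j _ => lo + (j : ℤ)) ?_ ?_ ?_ ?_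
        · intro j hj
          have := Finset.mem_range.1 hj
          rw [Finset.mem_Icc]; omega
        · intro i _ j _ h; omega
        · intro e he
          rw [Finset.mem_Icc] at he
          exact ⟨(e - lo).toNat, Finset.mem_range.2 (by omega), by omega⟩
        · intro j _
          rw [eval_mul, eval_C, eval_pow, eval_X, zpow_add₀ hx0, zpow_natCast]
          ring
      rw [h2] at h1
      exact (mul_eq_zero.1 h1).resolve_left (zpow_ne_zero _ hx0)
    · have : (N : ℤ) ≤ ((s * R + 5 * R : ℕ) : ℤ) := by
        rw [hN, Int.toNat_of_nonneg (by omega)]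
        push_cast
        exact hlh
      exact hdeg.trans (by exact_mod_cast this)
  apply hne
  have := congrArg (fun q => coeff q (e₁ - lo).toNat) hp0
  simp only [hp, finsetSum_coeff, coeff_C_mul, coeff_X_pow, coeff_zero] at this
  rw [Finset.sum_eq_single (e₁ - lo).toNat] at this
  · rw [if_pos rfl, mul_one, Int.toNat_of_nonneg (by omega)] at this
    simpa using this
  · intro j _ hj; rw [if_neg (Ne.symm hj), mul_zero]
  · intro h; exact absurd (Finset.mem_range.2 (by omega)) h

end Stepanov

/-! ### Weil's bound for Kloosterman sums. -/

section Weil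

universe u v

/-- The character `ψ ∘ Tr` of an extension. -/
def traceChar {F : Type*} (E : Type*) [Field F] [Field E] [Algebra F E] (ψ : AddChar F ℂ) :
    AddChar E ℂ := ψ.compAddMonoidHom (Algebra.trace F E).toAddMonoidHom

@[simp]
theorem traceChar_apply {F E : Type*} [Field F] [Field E] [Algebra F E] (ψ : AddChar F ℂ) (x : E) :
    traceChar E ψ x = ψ (Algebra.trace F E x) := rfl

theorem traceChar_ne_one {F E : Type*} [Field F] [Field E] [Algebra F E] [Finite E]
    {ψ : AddChar F ℂ} (hψ : ψ ≠ 1) : traceChar E ψ ≠ 1 := by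
  have : Finite F := Finite.of_injective _ (algebraMap F E).injective
  obtain ⟨t, ht⟩ := AddChar.ne_one_iff.1 hψ
  obtain ⟨x, rfl⟩ := Algebra.trace_surjective F E t
  exact AddChar.ne_one_iff.2 ⟨x, ht⟩

theorem traceChar_traceChar {F E L : Type*} [Field F] [Field E] [Field L] [Algebra F E]
    [Algebra E L] [Algebra F L] [IsScalarTower F E L] [Finite L] (ψ : AddChar F ℂ) :
    traceChar L (traceChar E ψ) = traceChar L ψ := by
  have : Finite E := Finite.of_injective _ (algebraMap E L).injective
  ext x
  simp [Algebra.trace_trace]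

variable {F : Type u} [Field F] [Fintype F] {k : Type v} [Field k] [Fintype k] [Algebra F k]

/-- The additive form of Hilbert's theorem 90 for finite fields. -/
theorem trace_eq_zero_iff_exists_pow_sub (z : k) :
    Algebra.trace F k z = 0 ↔ ∃ y : k, y ^ Fintype.card F - y = z := by
  classical
  set f : k →ₗ[F] k := (FiniteField.frobeniusAlgHom F k).toLinearMap - LinearMap.id with hf
  have hfa : ∀ y, f y = y ^ Fintype.card F - y := fun y => rfl
  have hle : LinearMap.range f ≤ LinearMap.ker (Algebra.trace F k) := by
    rintro _ ⟨y, rfl⟩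
    rw [LinearMap.mem_ker, hfa, map_sub, sub_eq_zero]
    exact Algebra.trace_eq_of_algEquiv (FiniteField.frobeniusAlgEquivOfAlgebraic F k) y
  -- The kernel of y ↦ y^Q - y is the line F, so its image has codimension one, like the kernel of
  -- the trace that contains it.
  have hker : LinearMap.ker f = Submodule.span F {(1 : k)} := by
    have hsub : Submodule.span F {(1 : k)} ≤ LinearMap.ker f := by
      rw [Submodule.span_singleton_le_iff_mem, LinearMap.mem_ker, hfa, one_pow, sub_self]
    symm
    apply SetLike.coe_injective
    refine Set.eq_of_subset_of_ncard_le hsub ?_ (Set.toFinite _)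
    have h1 : (LinearMap.ker f : Set k) ⊆ ((X ^ Fintype.card F - X : k[X]).roots.toFinset : Set k) := by
      intro y hy
      have hy : y ^ Fintype.card F - y = 0 := hy
      rw [Finset.mem_coe, Multiset.mem_toFinset,
        mem_roots (FiniteField.X_pow_card_sub_X_ne_zero k Fintype.one_lt_card)]
      simp [hy]
    have h2 : (LinearMap.ker f : Set k).ncard ≤ Fintype.card F := by
      refine (Set.ncard_le_ncard h1 (Finset.finite_toSet _)).trans ?_
      rw [Set.ncard_coe_finset]
      refine (Multiset.toFinset_card_le _).trans ((card_roots' _).trans ?_)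
      rw [FiniteField.X_pow_card_sub_X_natDegree_eq k Fintype.one_lt_card]
    refine h2.trans ?_
    have h3 : ((Submodule.span F {(1 : k)} : Submodule F k) : Set k) = Set.range (algebraMap F k) := by
      ext y
      simp [Submodule.mem_span_singleton, Algebra.algebraMap_eq_smul_one]
    rw [h3, ← Nat.card_coe_set_eq, Nat.card_range_of_injective (algebraMap F k).injective,
      Nat.card_eq_fintype_card]
  have heq : LinearMap.range f = LinearMap.ker (Algebra.trace F k) := by
    refine Submodule.eq_of_le_of_finrank_eq hle ?_
    have h1 := LinearMap.finrank_range_add_finrank_ker f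
    have h2 := LinearMap.finrank_range_add_finrank_ker (Algebra.trace F k)
    rw [hker, finrank_span_singleton one_ne_zero] at h1
    rw [LinearMap.range_eq_top.2 (Algebra.trace_surjective F k), finrank_top,
      Module.finrank_self] at h2
    omega
  rw [← LinearMap.mem_ker, ← heq]
  rfl

/-- By Hilbert 90, Stepanov bounds from above how often the trace of a x + b / x takes each value.
These counts sum to |k| - 1, so upper bounds near the mean |k|/Q also control the deviations
downwards. The constant 11 |F| is crude but independent of M. -/
theorem norm_kloostermanSum_traceChar_le [DecidableEq k] {ψ : AddChar F ℂ} (hψ : ψ ≠ 1) (M : ℕ)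
    (hk : Fintype.card k = (Fintype.card F ^ (M + 1)) ^ 2) {a b : k} (ha : a ≠ 0) (hb : b ≠ 0) :
    ‖kloostermanSum (traceChar k ψ) a b‖ ≤ 11 * Fintype.card F * Fintype.card F ^ (M + 1) := by
  classical
  set N : F → ℕ := fun c => ((Finset.univ.filter fun x : k => x ≠ 0).filter
    fun x => Algebra.trace F k (a * x + b / x) = c).card with hN
  have hle : ∀ c, N c ≤ Fintype.card F ^ M * Fintype.card F ^ (M + 1) +
      5 * Fintype.card F ^ (M + 1) := by
    intro c
    obtain ⟨γ, hγ⟩ := Algebra.trace_surjective F k c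
    refine le_trans (le_of_eq ?_) (card_below_rational_points_le F M hk γ ha hb)
    rw [hN]
    simp only [Finset.filter_filter]
    congr 1
    ext x
    simp only [Finset.mem_filter, Finset.mem_univ, true_and]
    rw [← trace_eq_zero_iff_exists_pow_sub, map_sub, hγ, sub_eq_zero]
  have hsum : ∑ c, N c + 1 = Fintype.card k := by
    have h1 := Finset.card_eq_sum_card_fiberwise (s := Finset.univ.filter fun x : k => x ≠ 0)
      (t := Finset.univ) (f := fun x => Algebra.trace F k (a * x + b / x)) (fun _ _ => by simp)
    rw [hN, ← h1, Finset.filter_ne',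
      Finset.card_erase_add_one (Finset.mem_univ _), Finset.card_univ]
  set S : ℝ := Fintype.card F ^ M * Fintype.card F ^ (M + 1) with hS
  set R : ℝ := (Fintype.card F : ℝ) ^ (M + 1) with hR
  have hK : kloostermanSum (traceChar k ψ) a b = ∑ c, ψ c * ((N c : ℝ) - S : ℝ) := by
    have h1 : ∑ c, ψ c * ((N c : ℝ) - S : ℝ) = ∑ c, ψ c * N c := by
      have := AddChar.sum_eq_zero_of_ne_one hψ
      push_cast
      simp_rw [mul_sub, Finset.sum_sub_distrib, ← Finset.sum_mul, this, zero_mul, sub_zero]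
    rw [h1, kloostermanSum, ← Finset.sum_fiberwise (Finset.univ.filter fun x : k => x ≠ 0)
      (fun x => Algebra.trace F k (a * x + b / x))]
    refine Finset.sum_congr rfl fun c _ => ?_
    rw [Finset.sum_congr rfl (g := fun _ => ψ c) fun x hx => by
      rw [traceChar_apply, (Finset.mem_filter.1 hx).2]]
    simp [hN, mul_comm]
  have hδ : ∑ c, ((N c : ℝ) - S) = -1 := by
    rw [Finset.sum_sub_distrib, Finset.sum_const, Finset.card_univ, nsmul_eq_mul]
    have : ((∑ c, N c + 1 : ℕ) : ℝ) = (Fintype.card k : ℕ) := by rw [hsum]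
    rw [hk] at this
    push_cast at this
    rw [hS]
    linear_combination this
  have hR0 : 1 ≤ (Fintype.card F : ℝ) * R := by
    rw [hR, ← pow_succ']
    exact one_le_pow₀ (by exact_mod_cast Fintype.card_pos)
  calc ‖kloostermanSum (traceChar k ψ) a b‖ ≤ ∑ c, ‖ψ c * ((N c : ℝ) - S : ℝ)‖ := by
        rw [hK]; exact norm_sum_le _ _
    -- For u ≤ u₀ and u₀ ≥ 0 one has |u| ≤ 2u₀ - u, and the deviations u sum to only -1.
    _ ≤ ∑ c, (2 * (5 * R) - ((N c : ℝ) - S)) := by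
        refine Finset.sum_le_sum fun c _ => ?_
        rw [norm_mul, AddChar.norm_apply, one_mul, Complex.norm_real, Real.norm_eq_abs]
        have h1 : ((N c : ℕ) : ℝ) ≤ S + 5 * R := by
          rw [hS, hR]; exact_mod_cast hle c
        have h2 : 0 ≤ R := by positivity
        rcases abs_cases ((N c : ℝ) - S) with h | h <;> linarith
    _ = 10 * (Fintype.card F * R) + 1 := by
        rw [Finset.sum_sub_distrib, hδ, Finset.sum_const, Finset.card_univ, nsmul_eq_mul]; ring
    _ ≤ _ := by linarith

theorem exists_quadratic_extension (F : Type u) [Field F] [Fintype F] :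
    ∃ (E : Type) (_ : Field E) (_ : Fintype E) (_ : DecidableEq E) (_ : Algebra F E),
      Module.finrank F E = 2 := by
  classical
  obtain ⟨p, hp⟩ := CharP.exists F
  have : Fact p.Prime := ⟨(CharP.char_is_prime_or_zero F p).resolve_right
    (CharP.char_ne_zero_of_finite F p)⟩
  exact ⟨FiniteField.Extension F p 2, inferInstance, Fintype.ofFinite _, inferInstance,
    inferInstance, FiniteField.finrank_extension F p 2⟩

/-- From |2Q - K²| ≥ |K|² - 2Q ≥ ((2 + δ)² - 2)Q = (2 + 4δ + δ²)Q. -/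
theorem norm_kloostermanSum_quadratic_ge [DecidableEq F] [DecidableEq k]
    (h : Module.finrank F k = 2) {ψ : AddChar F ℂ} (hψ : ψ ≠ 1) {a b : F} (ha : a ≠ 0) (hb : b ≠ 0)
    {δ : ℝ} (hδ : 0 ≤ δ) (hK : (2 + δ) * √(Fintype.card F) ≤ ‖kloostermanSum ψ a b‖) :
    (2 + 4 * δ) * √(Fintype.card k) ≤
      ‖kloostermanSum (traceChar k ψ) (algebraMap F k a) (algebraMap F k b)‖ := by
  have hcard : √(Fintype.card k : ℝ) = Fintype.card F := by
    rw [Module.card_eq_pow_finrank (K := F), h, Nat.cast_pow, Real.sqrt_sq (by positivity)]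
  have hsq : √(Fintype.card F : ℝ) ^ 2 = Fintype.card F := Real.sq_sqrt (by positivity)
  rw [traceChar, kloostermanSum_of_finrank_two h hψ ha hb, hcard]
  have h1 : ‖kloostermanSum ψ a b ^ 2‖ - ‖(2 * Fintype.card F : ℂ)‖ ≤
      ‖2 * (Fintype.card F : ℂ) - kloostermanSum ψ a b ^ 2‖ := by
    rw [norm_sub_rev]; exact norm_sub_norm_le _ _
  rw [norm_pow, norm_mul, Complex.norm_natCast, Complex.norm_ofNat] at h1
  have h2 : ((2 + δ) * √(Fintype.card F)) ^ 2 ≤ ‖kloostermanSum ψ a b‖ ^ 2 := by gcongr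
  rw [mul_pow, hsq] at h2
  nlinarith [sq_nonneg δ, mul_nonneg (sq_nonneg δ) (Nat.cast_nonneg (α := ℝ) (Fintype.card F))]

theorem exists_extension_norm_kloostermanSum_ge [DecidableEq F] {ψ : AddChar F ℂ} (hψ : ψ ≠ 1)
    {a b : F} (ha : a ≠ 0) (hb : b ≠ 0) {δ : ℝ} (hδ : 0 ≤ δ)
    (hK : (2 + δ) * √(Fintype.card F) ≤ ‖kloostermanSum ψ a b‖) (j : ℕ) :
    ∃ (E : Type) (_ : Field E) (_ : Fintype E) (_ : DecidableEq E) (_ : Algebra F E),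
      Module.finrank F E = 2 ^ (j + 1) ∧ (2 + 4 ^ (j + 1) * δ) * √(Fintype.card E) ≤
        ‖kloostermanSum (traceChar E ψ) (algebraMap F E a) (algebraMap F E b)‖ := by
  induction j with
  | zero =>
    obtain ⟨E, _, _, _, _, h⟩ := exists_quadratic_extension F
    refine ⟨E, inferInstance, inferInstance, inferInstance, inferInstance, by simpa using h, ?_⟩
    simpa using norm_kloostermanSum_quadratic_ge h hψ ha hb hδ hK
  | succ j ih =>
    obtain ⟨E, _, _, _, _, h, hE⟩ := ih
    obtain ⟨L, _, _, _, _, hL⟩ := exists_quadratic_extension E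
    let _ : Algebra F L := ((algebraMap E L).comp (algebraMap F E)).toAlgebra
    have : IsScalarTower F E L := IsScalarTower.of_algebraMap_eq' rfl
    refine ⟨L, inferInstance, inferInstance, inferInstance, inferInstance, ?_, ?_⟩
    · rw [← Module.finrank_mul_finrank F E L, h, hL]; ring
    · have := norm_kloostermanSum_quadratic_ge hL (traceChar_ne_one (E := E) hψ)
        ((map_ne_zero (algebraMap F E)).2 ha) ((map_ne_zero (algebraMap F E)).2 hb)
        (by positivity) hE
      rw [traceChar_traceChar, ← IsScalarTower.algebraMap_apply,
        ← IsScalarTower.algebraMap_apply] at this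
      rwa [pow_succ' 4 (j + 1), mul_assoc]

/-- Weil's bound for Kloosterman sums. -/
theorem norm_kloostermanSum_le [DecidableEq F] {ψ : AddChar F ℂ} (hψ : ψ ≠ 1) {a b : F}
    (ha : a ≠ 0) (hb : b ≠ 0) : ‖kloostermanSum ψ a b‖ ≤ 2 * √(Fintype.card F) := by
  by_contra! hlt
  have hQ : 0 < √(Fintype.card F : ℝ) := Real.sqrt_pos.2 (by exact_mod_cast Fintype.card_pos)
  set δ := ‖kloostermanSum ψ a b‖ / √(Fintype.card F) - 2 with hδ
  have hδ0 : 0 < δ := by rw [hδ, sub_pos, lt_div_iff₀ hQ]; exact hlt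
  have hK : (2 + δ) * √(Fintype.card F) ≤ ‖kloostermanSum ψ a b‖ := by
    rw [hδ]; field_simp; linarith
  -- The amplified excess 4^(j+1) δ must exceed the constant 11 |F|; M + 1 = 2^j then matches the
  -- degree 2^(j+1) of E with the Stepanov bound.
  obtain ⟨j, hj⟩ := pow_unbounded_of_one_lt (11 * Fintype.card F / δ) (by norm_num : (1 : ℝ) < 4)
  obtain ⟨E, _, _, _, _, h, hE⟩ := exists_extension_norm_kloostermanSum_ge hψ ha hb hδ0.le hK j
  obtain ⟨M, hM⟩ : ∃ M, 2 ^ j = M + 1 :=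
    ⟨2 ^ j - 1, by have := Nat.one_le_two_pow (n := j); omega⟩
  have hcard : Fintype.card E = (Fintype.card F ^ (M + 1)) ^ 2 := by
    rw [Module.card_eq_pow_finrank (K := F), h, ← hM, ← pow_mul, pow_succ]
  have h1 := hE.trans (norm_kloostermanSum_traceChar_le hψ M hcard
    ((map_ne_zero (algebraMap F E)).2 ha) ((map_ne_zero (algebraMap F E)).2 hb))
  have hR : 0 < (Fintype.card F : ℝ) ^ (M + 1) := by positivity
  rw [hcard, Nat.cast_pow, Nat.cast_pow, Real.sqrt_sq hR.le] at h1
  have h2 := le_of_mul_le_mul_right h1 hR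
  rw [div_lt_iff₀ hδ0] at hj
  have : (4 : ℝ) ^ (j + 1) * δ = 4 * (4 ^ j * δ) := by ring
  have : 0 < (4 : ℝ) ^ j * δ := by positivity
  linarith

end Weil

/-! ### Totally isotropic subspaces enlarged by one vector. -/

section AdjoinVector

variable {K V : Type*} [Field K] [AddCommGroup V] [Module K V]

theorem mem_sup_span_singleton_iff {W : Submodule K V} {x z : V} :
    x ∈ W ⊔ Submodule.span K {z} ↔ ∃ c : K, x - c • z ∈ W := by
  constructor
  · intro h
    obtain ⟨w, hw, y, hy, rfl⟩ := Submodule.mem_sup.1 h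
    obtain ⟨c, rfl⟩ := Submodule.mem_span_singleton.1 hy
    exact ⟨c, by simpa using hw⟩
  · rintro ⟨c, hc⟩
    have := Submodule.add_mem_sup hc (Submodule.smul_mem _ c (Submodule.mem_span_singleton_self z))
    simpa using this

/-- This exchange property turns the count of z with d ∈ W + ⟨z⟩ into the size of (W + ⟨d⟩) \ W. -/
theorem mem_sup_span_singleton_comm {W : Submodule K V} {x z : V} (hx : x ∉ W) (hz : z ∉ W) :
    x ∈ W ⊔ Submodule.span K {z} ↔ z ∈ W ⊔ Submodule.span K {x} := by
  have key : ∀ {x z : V}, x ∉ W → x ∈ W ⊔ Submodule.span K {z} →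
      z ∈ W ⊔ Submodule.span K {x} := by
    intro x z hx h
    obtain ⟨c, hc⟩ := mem_sup_span_singleton_iff.1 h
    have hc0 : c ≠ 0 := by rintro rfl; exact hx (by simpa using hc)
    refine mem_sup_span_singleton_iff.2 ⟨c⁻¹, ?_⟩
    have := W.smul_mem (-c⁻¹) hc
    rwa [smul_sub, smul_smul, neg_mul, inv_mul_cancel₀ hc0, neg_smul, neg_smul, one_smul,
      sub_neg_eq_add, neg_add_eq_sub] at this
  exact ⟨key hx, key hz⟩

theorem natCard_sup_span_singleton [Finite K] [Finite V] {W : Submodule K V} {z : V} (hz : z ∉ W) :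
    Nat.card ↥(W ⊔ Submodule.span K {z}) = Nat.card K * Nat.card W := by
  have hz0 : z ≠ 0 := by rintro rfl; exact hz W.zero_mem
  have hd : W ⊓ Submodule.span K {z} = ⊥ := by
    refine (Submodule.eq_bot_iff _).2 fun y hy => ?_
    obtain ⟨h1, h2⟩ := Submodule.mem_inf.1 hy
    obtain ⟨c, rfl⟩ := Submodule.mem_span_singleton.1 h2
    by_cases hc : c = 0
    · simp [hc]
    · exact absurd ((W.smul_mem_iff hc).1 h1) hz
  have := Submodule.finrank_sup_add_finrank_inf_eq W (Submodule.span K {z})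
  rw [hd, finrank_bot, finrank_span_singleton hz0, add_zero] at this
  rw [Module.natCard_eq_pow_finrank (K := K), this, Module.natCard_eq_pow_finrank (K := K) (V := W),
    pow_succ']

end AdjoinVector

/-- A form `β`, with the set of isotropic (singular) vectors given by `P`, that defines a polar
space. -/
structure IsPolarForm {K V : Type*} [Field K] [AddCommGroup V] [Module K V] (β : V → V → K)
    (P : V → Prop) : Prop where
  add_left : ∀ x y z, β (x + y) z = β x z + β y z
  smul_left : ∀ (c : K) x z, β (c • x) z = c * β x z
  symm : ∀ x y, β x y = 0 → β y x = 0
  zero : P 0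
  smul : ∀ (c : K) x, P x → P (c • x)
  add : ∀ x y, P x → P y → β x y = 0 → P (x + y)
  self : ∀ x, P x → β x x = 0

/-- Totally isotropic (singular) subspaces. -/
def TotallyPolar {K V : Type*} [Field K] [AddCommGroup V] [Module K V] (β : V → V → K)
    (P : V → Prop) (W : Submodule K V) : Prop :=
  (∀ x ∈ W, P x) ∧ ∀ x ∈ W, ∀ y ∈ W, β x y = 0

namespace IsPolarForm

variable {K V : Type*} [Field K] [AddCommGroup V] [Module K V] {β : V → V → K} {P : V → Prop}
  (h : IsPolarForm β P)
include h

theorem right_add_smul {d w z : V} {c : K} (hw : β d w = 0) (hz : β d z = 0) :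
    β d (w + c • z) = 0 := by
  apply h.symm
  rw [h.add_left, h.smul_left, h.symm _ _ hw, h.symm _ _ hz]; ring

theorem totallyPolar_sup_span_singleton {W : Submodule K V} (hW : TotallyPolar β P W) {z : V}
    (hz : P z) (hzW : ∀ w ∈ W, β z w = 0) : TotallyPolar β P (W ⊔ Submodule.span K {z}) := by
  have key : ∀ x ∈ W ⊔ Submodule.span K {z}, ∃ w ∈ W, ∃ c : K, x = w + c • z := by
    intro x hx
    obtain ⟨c, hc⟩ := mem_sup_span_singleton_iff.1 hx
    exact ⟨_, hc, c, by abel⟩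
  refine ⟨fun x hx => ?_, fun x hx y hy => ?_⟩
  · obtain ⟨w, hw, c, rfl⟩ := key x hx
    refine h.add _ _ (hW.1 w hw) (h.smul c z hz) (h.symm _ _ ?_)
    rw [h.smul_left, hzW w hw, mul_zero]
  · obtain ⟨w, hw, c, rfl⟩ := key x hx
    obtain ⟨w', hw', c', rfl⟩ := key y hy
    rw [h.add_left, h.smul_left, h.right_add_smul (hW.2 w hw w' hw') (h.symm _ _ (hzW w hw)),
      h.right_add_smul (hzW w' hw') (h.self z hz)]
    ring

theorem perp_sup_span_singleton_iff {W : Submodule K V} {d z : V} :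
    (∀ w ∈ W ⊔ Submodule.span K {z}, β d w = 0) ↔ (∀ w ∈ W, β d w = 0) ∧ β d z = 0 := by
  refine ⟨fun H => ⟨fun w hw => H w (Submodule.mem_sup_left hw), H z (Submodule.mem_sup_right
    (Submodule.mem_span_singleton_self z))⟩, fun ⟨H1, H2⟩ w hw => ?_⟩
  obtain ⟨c, hc⟩ := mem_sup_span_singleton_iff.1 hw
  have := h.right_add_smul (c := c) (H1 _ hc) H2
  rwa [sub_add_cancel] at this

end IsPolarForm

/-! ### Intersections of an ovoid with perpendicular subspaces. -/

section Counting

open Classical in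
/-- The isotropic vectors that are perpendicular to `W`. -/
def isotropicPerp {K V : Type*} [Field K] [AddCommGroup V] [Module K V] [Fintype V]
    (β : V → V → K) (P : V → Prop) (W : Submodule K V) : Finset V :=
  Finset.univ.filter fun x => P x ∧ ∀ w ∈ W, β x w = 0

open Classical in
/-- A set of isotropic vectors with the same number of elements in each maximal totally isotropic
subspace has the intersection numbers of an `m`-ovoid with all perpendicular subspaces. -/
theorem card_perp_of_card_maximal {K V : Type*} [Field K] [Finite K] [AddCommGroup V] [Module K V]
    [Fintype V] {β : V → V → K} {P : V → Prop} (h : IsPolarForm β P) {ρ f : ℝ} (hρ : 0 < ρ)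
    (hf : 0 < f)
    (hX : ∀ W, TotallyPolar β P W → ρ * (isotropicPerp β P W).card * Nat.card W =
      f ^ 2 - (ρ - 1) * f * Nat.card W)
    {D : Finset V} (hD : ∀ x ∈ D, P x) {N : ℝ}
    (hN : ∀ W, Maximal (TotallyPolar β P) W → ((D.filter (· ∈ W)).card : ℝ) = N)
    (W : Submodule K V) (hW : TotallyPolar β P W) :
    (Nat.card W : ℝ) * (((D.filter fun x => ∀ w ∈ W, β x w = 0).card : ℝ) - N) =
      f * (N - (D.filter (· ∈ W)).card) := by
  have : Fintype K := Fintype.ofFinite K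
  induction W using WellFoundedGT.induction with
  | ind W ih =>
  by_cases hmax : Maximal (TotallyPolar β P) W
  · have heq : (D.filter fun x => ∀ w ∈ W, β x w = 0) = D.filter (· ∈ W) := by
      refine Finset.filter_congr fun x hx => ⟨fun H => ?_, fun H => hW.2 x H⟩
      have := hmax.2 (h.totallyPolar_sup_span_singleton hW (hD x hx) H) le_sup_left
      exact this (Submodule.mem_sup_right (Submodule.mem_span_singleton_self x))
    rw [heq, hN W hmax]
    ring
  set w : ℝ := (Nat.card W : ℝ) with hw
  set q : ℝ := (Nat.card K : ℝ) with hq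
  have hw0 : 0 < w := by rw [hw]; exact_mod_cast Nat.card_pos
  have hq0 : 0 < q := by rw [hq]; exact_mod_cast Nat.card_pos
  -- Z indexes the enlargements W + ⟨z⟩. The pairs (z, d) with d ∈ W + ⟨z⟩ and those with d ⟂ W +
  -- ⟨z⟩ are both counted by the class of d: in W, in W^⊥ outside W, or elsewhere, where d
  -- contributes nothing. The induction hypothesis links the two totals.
  set Z : Finset V := (isotropicPerp β P W).filter (· ∉ W) with hZ
  have hmemZ : ∀ z, z ∈ Z ↔ (P z ∧ ∀ w ∈ W, β z w = 0) ∧ z ∉ W := fun z => by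
    simp [hZ, isotropicPerp]
  have hcardW : ∀ U : Submodule K V, ((Finset.univ.filter (· ∈ U)).card : ℝ) = Nat.card U := by
    intro U
    rw [Nat.card_eq_fintype_card, Fintype.card_subtype]
  -- vectors of `isotropicPerp` outside a smaller subspace
  have hout : ∀ U : Submodule K V, (∀ x ∈ W, P x ∧ ∀ u ∈ U, β x u = 0) →
      (((isotropicPerp β P U).filter (· ∉ W)).card : ℝ) = (isotropicPerp β P U).card - w := by
    intro U hU
    have h1 := Finset.card_filter_add_card_filter_not (s := isotropicPerp β P U) (· ∈ W)
    have h2 : (isotropicPerp β P U).filter (· ∈ W) = Finset.univ.filter (· ∈ W) := by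
      ext x
      simp only [isotropicPerp, Finset.mem_filter, Finset.mem_univ, true_and]
      exact ⟨fun H => H.2, fun H => ⟨hU x H, H⟩⟩
    rw [h2] at h1
    rw [hw, ← hcardW W, eq_sub_iff_add_eq, add_comm]
    exact_mod_cast h1
  have hcardZ : (Z.card : ℝ) = (isotropicPerp β P W).card - w :=
    hout W fun x hx => ⟨hW.1 x hx, hW.2 x hx⟩
  have hZne : Z.Nonempty := by
    obtain ⟨W', hW', hlt⟩ : ∃ W', TotallyPolar β P W' ∧ W < W' := by
      by_contra! hcon
      exact hmax ⟨hW, fun W' hW' hle => by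
        by_contra hnle; exact hcon W' hW' (lt_of_le_not_ge hle hnle)⟩
    obtain ⟨z, hz, hzW⟩ := SetLike.exists_of_lt hlt
    exact ⟨z, (hmemZ z).2 ⟨⟨hW'.1 z hz, fun x hx => hW'.2 z hz x (hlt.le hx)⟩, hzW⟩⟩
  set i : ℝ := ((D.filter (· ∈ W)).card : ℝ) with hi
  set a : ℝ := ((D.filter fun x => ∀ w ∈ W, β x w = 0).card : ℝ) with ha
  -- sums over `D` of functions that are constant on the three classes
  have hsplit : ∀ (g : V → ℕ) (u v : ℝ), (∀ d ∈ D, d ∈ W → (g d : ℝ) = u) →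
      (∀ d ∈ D, d ∉ W → (∀ w ∈ W, β d w = 0) → (g d : ℝ) = v) →
      (∀ d ∈ D, (¬ ∀ w ∈ W, β d w = 0) → (g d : ℝ) = 0) →
      (∑ d ∈ D, (g d : ℝ)) = i * u + (a - i) * v := by
    intro g u v h1 h2 h3
    have e : ∀ d ∈ D, (g d : ℝ) = (if d ∈ W then 1 else 0) * (u - v) +
        (if ∀ w ∈ W, β d w = 0 then 1 else 0) * v := by
      intro d hd
      by_cases hdW : d ∈ W
      · rw [if_pos hdW, if_pos (hW.2 d hdW), h1 d hd hdW]; ring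
      · by_cases hdp : ∀ w ∈ W, β d w = 0
        · rw [if_neg hdW, if_pos hdp, h2 d hd hdW hdp]; ring
        · rw [if_neg hdW, if_neg hdp, h3 d hd hdp]; ring
    rw [Finset.sum_congr rfl e, Finset.sum_add_distrib, ← Finset.sum_mul, ← Finset.sum_mul,
      Finset.sum_boole, Finset.sum_boole]
    ring
  have hXW := hX W hW
  have hXq : ∀ d, P d → d ∉ W → (∀ w ∈ W, β d w = 0) →
      ((isotropicPerp β P (W ⊔ Submodule.span K {d})).card : ℝ) =
        (f ^ 2 - (ρ - 1) * f * (q * w)) / (ρ * (q * w)) := by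
    intro d hd hdW hdp
    have := hX _ (h.totallyPolar_sup_span_singleton hW hd hdp)
    rw [natCard_sup_span_singleton hdW, Nat.cast_mul] at this
    rw [eq_div_iff (by positivity), ← this]; ring
  have hsum1 : ∑ z ∈ Z, ((D.filter (· ∈ W ⊔ Submodule.span K {z})).card : ℝ) =
      i * Z.card + (a - i) * (q * w - w) := by
    rw [← Nat.cast_sum]
    refine (congrArg (Nat.cast : ℕ → ℝ) (Finset.sum_card_bipartiteAbove_eq_sum_card_bipartiteBelow
      (s := Z) (t := D) fun z d => d ∈ W ⊔ Submodule.span K {z})).trans ?_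
    rw [Nat.cast_sum]
    refine hsplit _ _ _ (fun d _ hdW => ?_) (fun d hd hdW hdp => ?_) (fun d _ hdp => ?_)
    · rw [Finset.bipartiteBelow, Finset.filter_true_of_mem]
      exact fun z _ => Submodule.mem_sup_left hdW
    · have e1 : (Finset.bipartiteBelow (fun z d => d ∈ W ⊔ Submodule.span K {z}) Z d) =
          (Finset.univ.filter (· ∈ W ⊔ Submodule.span K {d})) \ Finset.univ.filter (· ∈ W) := by
        ext z
        simp only [Finset.bipartiteBelow, Finset.mem_filter, Finset.mem_sdiff, Finset.mem_univ,
          true_and, hmemZ]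
        constructor
        · rintro ⟨⟨-, hz⟩, hdz⟩
          exact ⟨(mem_sup_span_singleton_comm hdW hz).1 hdz, hz⟩
        · rintro ⟨hzd, hz⟩
          have ht := h.totallyPolar_sup_span_singleton hW (hD d hd) hdp
          exact ⟨⟨⟨ht.1 z hzd, fun x hx => ht.2 z hzd x (Submodule.mem_sup_left hx)⟩, hz⟩,
            (mem_sup_span_singleton_comm hdW hz).2 hzd⟩
      have hsub : Finset.univ.filter (· ∈ W) ⊆
          Finset.univ.filter (· ∈ W ⊔ Submodule.span K {d}) := by
        intro z hz
        simp only [Finset.mem_filter, Finset.mem_univ, true_and] at hz ⊢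
        exact Submodule.mem_sup_left hz
      rw [e1, Finset.card_sdiff_of_subset hsub, Nat.cast_sub (Finset.card_le_card hsub), hcardW,
        hcardW, natCard_sup_span_singleton hdW, Nat.cast_mul]
    · rw [Finset.bipartiteBelow, Finset.filter_false_of_mem, Finset.card_empty, Nat.cast_zero]
      intro z hz hdz
      obtain ⟨⟨hz1, hz2⟩, -⟩ := (hmemZ z).1 hz
      have ht := h.totallyPolar_sup_span_singleton hW hz1 hz2
      exact hdp fun x hx => ht.2 d hdz x (Submodule.mem_sup_left hx)
  have hsum2 : ∑ z ∈ Z, ((D.filter fun x => ∀ u ∈ W ⊔ Submodule.span K {z}, β x u = 0).card : ℝ) =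
      i * Z.card + (a - i) * ((f ^ 2 - (ρ - 1) * f * (q * w)) / (ρ * (q * w)) - w) := by
    rw [← Nat.cast_sum]
    refine (congrArg (Nat.cast : ℕ → ℝ) (Finset.sum_card_bipartiteAbove_eq_sum_card_bipartiteBelow
      (s := Z) (t := D) fun z d => ∀ u ∈ W ⊔ Submodule.span K {z}, β d u = 0)).trans ?_
    rw [Nat.cast_sum]
    simp only [h.perp_sup_span_singleton_iff]
    refine hsplit _ _ _ (fun d _ hdW => ?_) (fun d hd hdW hdp => ?_) (fun d _ hdp => ?_)
    · rw [Finset.bipartiteBelow, Finset.filter_true_of_mem]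
      exact fun z hz => ⟨hW.2 d hdW, h.symm _ _ (((hmemZ z).1 hz).1.2 d hdW)⟩
    · have ht := h.totallyPolar_sup_span_singleton hW (hD d hd) hdp
      rw [← hXq d (hD d hd) hdW hdp, ← hout]
      · congr 2
        ext z
        simp only [Finset.bipartiteBelow, Finset.mem_filter, hmemZ, isotropicPerp, Finset.mem_univ,
          true_and, h.perp_sup_span_singleton_iff]
        constructor
        · rintro ⟨⟨⟨h1, h2⟩, h3⟩, h4, h5⟩
          exact ⟨⟨h1, h2, h.symm _ _ h5⟩, h3⟩
        · rintro ⟨⟨h1, h2, h5⟩, h3⟩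
          exact ⟨⟨⟨h1, h2⟩, h3⟩, hdp, h.symm _ _ h5⟩
      · exact fun x hx => ⟨hW.1 x hx, ht.2 x (Submodule.mem_sup_left hx)⟩
    · rw [Finset.bipartiteBelow, Finset.filter_false_of_mem, Finset.card_empty, Nat.cast_zero]
      exact fun z _ hz => hdp hz.1
  have hind : q * w * (∑ z ∈ Z,
      ((D.filter fun x => ∀ u ∈ W ⊔ Submodule.span K {z}, β x u = 0).card : ℝ) - N * Z.card) =
      f * (N * Z.card - ∑ z ∈ Z, ((D.filter (· ∈ W ⊔ Submodule.span K {z})).card : ℝ)) := by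
    have e : ∀ z ∈ Z, q * w *
        (((D.filter fun x => ∀ u ∈ W ⊔ Submodule.span K {z}, β x u = 0).card : ℝ) - N) =
        f * (N - ((D.filter (· ∈ W ⊔ Submodule.span K {z})).card : ℝ)) := by
      intro z hz
      obtain ⟨⟨hz1, hz2⟩, hz3⟩ := (hmemZ z).1 hz
      have := ih (W ⊔ Submodule.span K {z}) (lt_of_le_of_ne le_sup_left fun he => hz3 (he ▸
        Submodule.mem_sup_right (Submodule.mem_span_singleton_self z)))
        (h.totallyPolar_sup_span_singleton hW hz1 hz2)
      rwa [natCard_sup_span_singleton hz3, Nat.cast_mul] at this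
    have := Finset.sum_congr rfl e
    rw [← Finset.mul_sum, ← Finset.mul_sum, Finset.sum_sub_distrib, Finset.sum_sub_distrib,
      Finset.sum_const, nsmul_eq_mul] at this
    linear_combination this
  rw [hsum1, hsum2] at hind
  have hZpos : 0 < (Z.card : ℝ) := by exact_mod_cast hZne.card_pos
  -- The right side of `hX` minus ρw² factorises. As Z is nonempty, this forces f > ρw, which
  -- permits the final cancellation.
  have hZ' : ρ * w * Z.card = (f + w) * (f - ρ * w) := by
    rw [hcardZ]; linear_combination hXW
  have hpos : 0 < f - ρ * w := by
    by_contra! hcon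
    have h1 : 0 < ρ * w * Z.card := by positivity
    have h2 : (f + w) * (f - ρ * w) ≤ 0 := mul_nonpos_of_nonneg_of_nonpos (by positivity) hcon
    linarith
  have hX' : ρ * (q * w) * ((f ^ 2 - (ρ - 1) * f * (q * w)) / (ρ * (q * w))) =
      f ^ 2 - (ρ - 1) * f * (q * w) := by field_simp
  generalize (f ^ 2 - (ρ - 1) * f * (q * w)) / (ρ * (q * w)) = X' at *
  have hfin : (f - ρ * w) * (f + q * w) * (w * (a - N)) =
      (f - ρ * w) * (f + q * w) * (f * (N - i)) := by
    linear_combination (ρ * w) * hind - w * (a - i) * hX' + (N - i) * (f + q * w) * hZ'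
  exact mul_left_cancel₀ (by positivity) hfin

end Counting

/-! ### The geometric evaluation of the Fourier coefficient. -/

section FourierOvoid

theorem sum_ne_zero_addChar_mul {K : Type*} [Field K] [Fintype K] [DecidableEq K]
    {ψ : AddChar K ℂ} (hψ : ψ ≠ 1) (t : K) :
    ∑ c with c ≠ 0, ψ (c * t) = (if t = 0 then (Fintype.card K : ℂ) else 0) - 1 := by
  rw [Finset.filter_ne', Finset.sum_erase_eq_sub (Finset.mem_univ _), zero_mul,
    AddChar.map_zero_eq_one]
  congr 1
  split_ifs with ht
  · simp [ht]
  · simp_rw [mul_comm _ t]; exact sum_addChar_mul_eq_zero hψ ht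

open Classical in
/-- The Fourier coefficients of a set of vectors as in `card_perp_of_card_maximal` at its own
elements. -/
theorem sum_addChar_of_card_maximal {K V : Type*} [Field K] [Fintype K] [AddCommGroup V]
    [Module K V] [Fintype V] {β : V → V → K} {P : V → Prop} (h : IsPolarForm β P) {ρ f : ℝ}
    (hρ : 0 < ρ) (hf : 0 < f)
    (hX : ∀ W, TotallyPolar β P W → ρ * (isotropicPerp β P W).card * Nat.card W =
      f ^ 2 - (ρ - 1) * f * Nat.card W)
    {D : Finset V} (hD : ∀ x ∈ D, P x) (hD0 : (0 : V) ∉ D)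
    (hDs : ∀ c : K, c ≠ 0 → ∀ x ∈ D, c • x ∈ D) {N : ℝ}
    (hN : ∀ W, Maximal (TotallyPolar β P) W → ((D.filter (· ∈ W)).card : ℝ) = N) :
    (D.card : ℝ) = N * (1 + f) ∧ ∀ {ψ : AddChar K ℂ}, ψ ≠ 1 → ∀ z ∈ D,
      ∑ x ∈ D, ψ (β x z) = ((N - f : ℝ) : ℂ) := by
  have hβ0 : ∀ x, β 0 x = 0 := fun x => by
    have := h.smul_left 0 0 x
    rwa [zero_smul, zero_mul] at this
  have hbot : TotallyPolar β P (⊥ : Submodule K V) := by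
    refine ⟨fun x hx => ?_, fun x hx y _ => ?_⟩
    · rw [(Submodule.mem_bot K).1 hx]; exact h.zero
    · rw [(Submodule.mem_bot K).1 hx, hβ0]
  have hcard : (D.card : ℝ) = N * (1 + f) := by
    have h1 := card_perp_of_card_maximal h hρ hf hX hD hN ⊥ hbot
    have h2 : (D.filter fun x => ∀ w ∈ (⊥ : Submodule K V), β x w = 0) = D := by
      refine Finset.filter_true_of_mem fun x _ w hw => ?_
      rw [(Submodule.mem_bot K).1 hw]
      exact h.symm _ _ (hβ0 x)
    have h3 : D.filter (· ∈ (⊥ : Submodule K V)) = ∅ := by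
      refine Finset.filter_false_of_mem fun x hx hx0 => ?_
      rw [(Submodule.mem_bot K).1 hx0] at hx
      exact hD0 hx
    rw [h2, h3] at h1
    simp only [Nat.card_unique, Finset.card_empty] at h1
    push_cast at h1
    linear_combination h1
  refine ⟨hcard, fun {ψ} hψ z hz => ?_⟩
  have hz0 : z ≠ 0 := by rintro rfl; exact hD0 hz
  have hW : TotallyPolar β P (⊥ ⊔ Submodule.span K {z}) :=
    h.totallyPolar_sup_span_singleton hbot (hD z hz) fun w hw => by
      rw [(Submodule.mem_bot K).1 hw]; exact h.symm _ _ (hβ0 z)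
  -- The line ⟨z⟩ meets D in all its |K| - 1 nonzero vectors, since D is closed under scalars.
  have h1 := card_perp_of_card_maximal h hρ hf hX hD hN _ hW
  have h2 : (D.filter fun x => ∀ w ∈ (⊥ ⊔ Submodule.span K {z} : Submodule K V), β x w = 0) =
      D.filter fun x => β x z = 0 := by
    refine Finset.filter_congr fun x _ => ?_
    rw [h.perp_sup_span_singleton_iff]
    refine ⟨fun H => H.2, fun H => ⟨fun w hw => ?_, H⟩⟩
    rw [(Submodule.mem_bot K).1 hw]; exact h.symm _ _ (hβ0 x)
  have h3 : ((D.filter (· ∈ (⊥ ⊔ Submodule.span K {z} : Submodule K V))).card : ℝ) =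
      Fintype.card K - 1 := by
    have e : D.filter (· ∈ (⊥ ⊔ Submodule.span K {z} : Submodule K V)) =
        (Finset.univ.erase (0 : K)).image fun c => c • z := by
      ext x
      simp only [Finset.mem_filter, bot_sup_eq, Submodule.mem_span_singleton, Finset.mem_image,
        Finset.mem_erase, Finset.mem_univ, and_true]
      constructor
      · rintro ⟨hx, c, rfl⟩
        refine ⟨c, ?_, rfl⟩
        rintro rfl
        rw [zero_smul] at hx
        exact hD0 hx
      · rintro ⟨c, hc, rfl⟩
        exact ⟨hDs c hc z hz, c, rfl⟩
    rw [e, Finset.card_image_of_injective _ (smul_left_injective K hz0),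
      Finset.card_erase_of_mem (Finset.mem_univ _), Finset.card_univ,
      Nat.cast_sub Fintype.card_pos, Nat.cast_one]
  have hznot : z ∉ (⊥ : Submodule K V) := hz0
  have hb : Nat.card (⊥ : Submodule K V) = 1 := Nat.card_unique
  rw [h2, h3, natCard_sup_span_singleton hznot, hb, mul_one, Nat.card_eq_fintype_card] at h1
  have hq : (1 : ℝ) < Fintype.card K := by exact_mod_cast Fintype.one_lt_card
  -- Scalar invariance of D allows ψ to be averaged over its nontrivial multiples, which reduces the
  -- sum to a count of D ∩ z^⊥.
  have hsum : ((Fintype.card K : ℂ) - 1) * ∑ x ∈ D, ψ (β x z) =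
      Fintype.card K * (D.filter fun x => β x z = 0).card - D.card := by
    have e1 : ∀ c ∈ Finset.univ.filter fun c : K => c ≠ 0,
        ∑ x ∈ D, ψ (β x z) = ∑ x ∈ D, ψ (c * β x z) := by
      intro c hc
      have hc : c ≠ 0 := (Finset.mem_filter.1 hc).2
      symm
      refine Finset.sum_bij (fun x _ => c • x) (fun x hx => hDs c hc x hx)
        (fun x _ y _ hxy => smul_right_injective V hc hxy)
        (fun y hy => ⟨c⁻¹ • y, hDs _ (inv_ne_zero hc) y hy, smul_inv_smul₀ hc y⟩)
        (fun x _ => by rw [h.smul_left])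
    have e2 := Finset.sum_congr rfl e1
    rw [Finset.sum_const, Finset.sum_comm, nsmul_eq_mul, Finset.filter_ne',
      Finset.card_erase_of_mem (Finset.mem_univ _), Finset.card_univ,
      Nat.cast_sub Fintype.card_pos, Nat.cast_one] at e2
    rw [e2]
    simp_rw [← Finset.filter_ne', sum_ne_zero_addChar_mul hψ]
    rw [Finset.sum_sub_distrib, ← Finset.sum_filter]
    simp [mul_comm]
  have hq' : ((Fintype.card K : ℂ) - 1) ≠ 0 := by
    have : ((Fintype.card K : ℝ) - 1) ≠ 0 := by linarith
    exact_mod_cast this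
  apply mul_left_cancel₀ hq'
  rw [hsum]
  have : (Fintype.card K : ℝ) * ((D.filter fun x => β x z = 0).card : ℝ) - D.card =
      (Fintype.card K - 1) * (N - f) := by
    rw [hcard]; linear_combination h1
  exact_mod_cast congrArg (Complex.ofReal) this

end FourierOvoid

/-! ### Quadratic forms all of whose Gauss sums equal -f. -/

section Gauss

/-- A quadratic form `R` with polar form `B`. -/
structure IsQuadraticPair {F V : Type*} [Field F] [AddCommGroup V] [Module F V] (R : V → F)
    (B : V → V → F) : Prop where
  map_add : ∀ x y, R (x + y) = R x + R y + B x y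
  map_smul : ∀ (c : F) x, R (c • x) = c ^ 2 * R x
  add_left : ∀ x y z, B (x + y) z = B x z + B y z
  smul_left : ∀ (c : F) x z, B (c • x) z = c * B x z

namespace IsQuadraticPair

variable {F V : Type*} [Field F] [AddCommGroup V] [Module F V] {R : V → F} {B : V → V → F}
  (h : IsQuadraticPair R B)
include h

theorem symm (x y : V) : B x y = B y x := by
  have h1 := h.map_add x y
  rw [add_comm x y, h.map_add] at h1
  linear_combination -h1

theorem map_zero : R 0 = 0 := by
  have := h.map_smul 0 0
  simpa using this

theorem zero_left (z : V) : B 0 z = 0 := by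
  have := h.smul_left 0 0 z
  simpa using this

theorem zero_right (z : V) : B z 0 = 0 := by rw [h.symm, h.zero_left]

theorem smul_right (c : F) (x z : V) : B x (c • z) = c * B x z := by
  rw [h.symm, h.smul_left, h.symm]

theorem add_right (x y z : V) : B x (y + z) = B x y + B x z := by
  rw [h.symm, h.add_left, h.symm y, h.symm z]

variable [Fintype F] [Fintype V] {ψ : AddChar F ℂ} (hψ : ψ ≠ 1) {f : ℝ} (hf : 0 < f)
  (hG : ∀ s : F, s ≠ 0 → ∑ x, ψ (s * R x) = -(f : ℂ)) (hV : (Fintype.card V : ℝ) = f ^ 2)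

include hG in
/-- Completing the square in a Gauss sum. -/
theorem sum_addChar_add {s : F} (hs : s ≠ 0) (y : V) :
    ∑ x, ψ (s * R x + B x y) = -f * ψ (-(R y / s)) := by
  rw [← hG s hs, Finset.sum_mul,
    ← Equiv.sum_comp (Equiv.addRight (s⁻¹ • y)) fun x => ψ (s * R x) * _]
  refine Finset.sum_congr rfl fun x _ => ?_
  rw [← AddChar.map_add_eq_mul]
  congr 1
  simp only [Equiv.coe_addRight]
  rw [h.map_add, h.map_smul, h.smul_right]
  field_simp
  ring

include hψ in
theorem sum_addChar_eq_zero {y : V} (hy : ∃ x, B x y ≠ 0) : ∑ x, ψ (B x y) = 0 := by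
  obtain ⟨x₀, hx₀⟩ := hy
  obtain ⟨t, ht⟩ := AddChar.ne_one_iff.1 hψ
  have e : B ((t / B x₀ y) • x₀) y = t := by rw [h.smul_left, div_mul_cancel₀ _ hx₀]
  have h1 : ∑ x, ψ (B x y) = ψ t * ∑ x, ψ (B x y) := by
    conv_lhs => rw [← Equiv.sum_comp (Equiv.addRight ((t / B x₀ y) • x₀))]
    rw [Finset.mul_sum]
    refine Finset.sum_congr rfl fun x _ => ?_
    rw [Equiv.coe_addRight, h.add_left, e, AddChar.map_add_eq_mul, mul_comm]
  have h2 : (1 - ψ t) * ∑ x, ψ (B x y) = 0 := by linear_combination h1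
  exact (mul_eq_zero.1 h2).resolve_left (sub_ne_zero.2 (Ne.symm ht))

include hψ hf hG hV in
-- The double sum of ψ(R x + B x y) is (-f)² when the square is completed over x, and f² times the
-- order of the radical when y is summed first. So the radical is trivial.
theorem nondegenerate {y : V} (hy : y ≠ 0) : ∃ x, B x y ≠ 0 := by
  classical
  by_contra! hcon
  have hfC : (f : ℂ) ≠ 0 := by exact_mod_cast hf.ne'
  have hV' : (Fintype.card V : ℂ) = f ^ 2 := by exact_mod_cast congrArg Complex.ofReal hV
  -- the quadratic form vanishes on the radical
  have hrad : ∀ y, (∀ x, B x y = 0) → R y = 0 := by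
    intro y hy
    by_contra hRy
    obtain ⟨t, ht⟩ := AddChar.ne_one_iff.1 hψ
    have hs : t / R y ≠ 0 := by
      refine div_ne_zero ?_ hRy
      rintro rfl; exact ht (AddChar.map_zero_eq_one ψ)
    have h1 : ∑ x, ψ (t / R y * R x) = ψ t * ∑ x, ψ (t / R y * R x) := by
      conv_lhs => rw [← Equiv.sum_comp (Equiv.addRight y)]
      rw [Finset.mul_sum]
      refine Finset.sum_congr rfl fun x _ => ?_
      rw [Equiv.coe_addRight, h.map_add, hy, add_zero, mul_add, div_mul_cancel₀ _ hRy,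
        AddChar.map_add_eq_mul, mul_comm]
    rw [hG _ hs] at h1
    exact ht (mul_right_cancel₀ (neg_ne_zero.2 hfC) (by rw [one_mul]; exact h1.symm))
  have e1 : ∑ y, ∑ x, ψ (1 * R x + B x y) = (f : ℂ) ^ 2 := by
    rw [Finset.sum_congr rfl fun y _ => h.sum_addChar_add hG one_ne_zero y, ← Finset.mul_sum]
    have := hG (-1) (by simp)
    simp only [neg_mul, one_mul] at this
    simp only [div_one, this]
    ring
  rw [Finset.sum_comm] at e1
  have e2 : ∀ x, ∑ y, ψ (1 * R x + B x y) =
      if ∀ y, B y x = 0 then (f : ℂ) ^ 2 else 0 := by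
    intro x
    simp_rw [AddChar.map_add_eq_mul, ← Finset.mul_sum, h.symm x]
    split_ifs with hx
    · simp [hx, hrad x hx, hV']
    · push Not at hx
      rw [h.sum_addChar_eq_zero hψ hx, mul_zero]
  rw [Finset.sum_congr rfl fun x _ => e2 x, ← Finset.sum_filter, Finset.sum_const, nsmul_eq_mul]
    at e1
  have e3 : ((Finset.univ.filter fun x : V => ∀ y, B y x = 0).card : ℂ) = 1 :=
    mul_right_cancel₀ (pow_ne_zero 2 hfC) (by rw [one_mul]; exact e1)
  have e4 : (Finset.univ.filter fun x : V => ∀ y, B y x = 0).card = 1 := by exact_mod_cast e3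
  refine hy (Finset.card_le_one.1 e4.le y ?_ 0 ?_)
  · simpa using hcon
  · simpa using h.zero_right

theorem sum_addSubgroup_addChar (x : V) (W : AddSubgroup V) [DecidablePred (· ∈ W)]
    [Decidable (∀ w ∈ W, ψ (B x w) = 1)] :
    ∑ w with w ∈ W, ψ (B x w) = if ∀ w ∈ W, ψ (B x w) = 1 then (Nat.card W : ℂ) else 0 := by
  split_ifs with hx
  · rw [Finset.sum_congr rfl fun w hw => hx w (Finset.mem_filter.1 hw).2]
    rw [Finset.sum_const, nsmul_eq_mul, mul_one, Nat.card_eq_fintype_card, Fintype.card_subtype]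
  · push Not at hx
    obtain ⟨w₀, hw₀, hne⟩ := hx
    have h1 : ∑ w with w ∈ W, ψ (B x w) = ψ (B x w₀) * ∑ w with w ∈ W, ψ (B x w) := by
      rw [Finset.mul_sum]
      symm
      refine Finset.sum_bij (fun w _ => w₀ + w) ?_ ?_ ?_ ?_
      · intro w hw
        simp only [Finset.mem_filter, Finset.mem_univ, true_and] at hw ⊢
        exact W.add_mem hw₀ hw
      · intro w _ w' _ hww; exact add_left_cancel hww
      · intro w hw
        simp only [Finset.mem_filter, Finset.mem_univ, true_and] at hw
        exact ⟨w - w₀, by simpa using W.sub_mem hw hw₀, by abel⟩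
      · intro w _
        rw [h.add_right, AddChar.map_add_eq_mul]
    have h2 : (1 - ψ (B x w₀)) * ∑ w with w ∈ W, ψ (B x w) = 0 := by linear_combination h1
    exact (mul_eq_zero.1 h2).resolve_left (sub_ne_zero.2 (Ne.symm hne))

open Classical in
include hψ hf hG hV in
-- Orthogonality over x kills every w ≠ 0, by nondegeneracy. Perpendicularity is tested through ψ
-- because W will be a K-subspace, in general not an F-subspace.
theorem card_perp_mul_card (W : AddSubgroup V) :
    ((Finset.univ.filter fun x : V => ∀ w ∈ W, ψ (B x w) = 1).card : ℝ) * Nat.card W = f ^ 2 := by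
  have hV' : (Fintype.card V : ℂ) = f ^ 2 := by exact_mod_cast congrArg Complex.ofReal hV
  have e1 : ∑ x, ∑ w with w ∈ W, ψ (B x w) = (f : ℂ) ^ 2 := by
    rw [Finset.sum_comm, Finset.sum_eq_single 0]
    · simp [h.zero_right, hV']
    · intro w _ hw
      exact h.sum_addChar_eq_zero hψ (h.nondegenerate hψ hf hG hV hw)
    · intro h0; simp at h0
  rw [Finset.sum_congr rfl fun x _ => h.sum_addSubgroup_addChar x W, ← Finset.sum_filter,
    Finset.sum_const, nsmul_eq_mul] at e1
  exact_mod_cast e1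

open Classical in
-- The trace condition is detected by scalars c ∈ K. For c ≠ 0 completing the square leaves the
-- factor ψ(-Tr R(w)/c) = 1, so c contributes -f|W|; c = 0 contributes f² by `card_perp_mul_card`.
-- This supplies `hX` with ρ = |K|.
theorem card_isotropic_perp_mul_card {K : Type*} [Field K] [Fintype K] [Algebra K F]
    {ψ : AddChar K ℂ} (hψ : ψ ≠ 1) (hf : 0 < f)
    (hG : ∀ s : F, s ≠ 0 → ∑ x, traceChar F ψ (s * R x) = -(f : ℂ))
    (hV : (Fintype.card V : ℝ) = f ^ 2) (W : AddSubgroup V)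
    (hW : ∀ w ∈ W, Algebra.trace K F (R w) = 0) :
    Fintype.card K * ((Finset.univ.filter fun x : V => Algebra.trace K F (R x) = 0 ∧
      ∀ w ∈ W, traceChar F ψ (B x w) = 1).card : ℝ) * Nat.card W =
      f ^ 2 - (Fintype.card K - 1) * f * Nat.card W := by
  have hψF := traceChar_ne_one (E := F) hψ
  have h0 := h.card_perp_mul_card hψF hf hG hV W
  -- the sum over `x`, `w` and the scalars `c ≠ 0` of `K`
  have e1 : ∑ c : K with c ≠ 0, ∑ x, ∑ w with w ∈ W,
      traceChar F ψ (algebraMap K F c * R x + B x w) =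
      -((Fintype.card K - 1) * f * Nat.card W : ℂ) := by
    have : ∀ c ∈ Finset.univ.filter fun c : K => c ≠ 0, ∑ x, ∑ w with w ∈ W,
        traceChar F ψ (algebraMap K F c * R x + B x w) = -(f * Nat.card W : ℂ) := by
      intro c hc
      have hc : algebraMap K F c ≠ 0 := (_root_.map_ne_zero _).2 (Finset.mem_filter.1 hc).2
      rw [Finset.sum_comm]
      have e : ∀ w ∈ Finset.univ.filter fun w => w ∈ W,
          ∑ x, traceChar F ψ (algebraMap K F c * R x + B x w) = -(f : ℂ) := by
        intro w hw
        rw [h.sum_addChar_add hG hc, traceChar_apply, ← neg_div, div_eq_inv_mul, ← map_inv₀,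
          ← Algebra.smul_def, _root_.map_smul, _root_.map_neg, hW w (Finset.mem_filter.1 hw).2, neg_zero,
          smul_zero, AddChar.map_zero_eq_one, mul_one]
      rw [Finset.sum_congr rfl e, Finset.sum_const, nsmul_eq_mul, Nat.card_eq_fintype_card,
        Fintype.card_subtype]
      ring
    rw [Finset.sum_congr rfl this, Finset.sum_const, nsmul_eq_mul, Finset.filter_ne',
      Finset.card_erase_of_mem (Finset.mem_univ _), Finset.card_univ,
      Nat.cast_sub Fintype.card_pos]
    push_cast
    ring
  have e2 : ∑ c : K with c ≠ 0, ∑ x, ∑ w with w ∈ W,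
      traceChar F ψ (algebraMap K F c * R x + B x w) =
      ∑ x, ((if Algebra.trace K F (R x) = 0 then (Fintype.card K : ℂ) else 0) - 1) *
        if ∀ w ∈ W, traceChar F ψ (B x w) = 1 then (Nat.card W : ℂ) else 0 := by
    rw [Finset.sum_comm]
    refine Finset.sum_congr rfl fun x _ => ?_
    rw [← sum_ne_zero_addChar_mul hψ, ← h.sum_addSubgroup_addChar x W, Finset.sum_mul_sum]
    refine Finset.sum_congr rfl fun c _ => Finset.sum_congr rfl fun w _ => ?_
    rw [AddChar.map_add_eq_mul, traceChar_apply, ← Algebra.smul_def, _root_.map_smul, smul_eq_mul]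
  have e3 : ∑ x, ((if Algebra.trace K F (R x) = 0 then (Fintype.card K : ℂ) else 0) - 1) *
        (if ∀ w ∈ W, traceChar F ψ (B x w) = 1 then (Nat.card W : ℂ) else 0) =
      Fintype.card K * ((Finset.univ.filter fun x : V => Algebra.trace K F (R x) = 0 ∧
      ∀ w ∈ W, traceChar F ψ (B x w) = 1).card : ℂ) * Nat.card W -
      ((Finset.univ.filter fun x : V => ∀ w ∈ W, traceChar F ψ (B x w) = 1).card : ℂ) *
        Nat.card W := by
    simp_rw [sub_mul, Finset.sum_sub_distrib, one_mul, ite_mul, zero_mul, mul_ite, mul_zero,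
      ← ite_and, ← Finset.sum_filter, Finset.sum_const, nsmul_eq_mul]
    ring
  have e4 := e2.symm.trans e1
  rw [e3] at e4
  have e5 : Fintype.card K * ((Finset.univ.filter fun x : V => Algebra.trace K F (R x) = 0 ∧
      ∀ w ∈ W, traceChar F ψ (B x w) = 1).card : ℝ) * Nat.card W -
      ((Finset.univ.filter fun x : V => ∀ w ∈ W, traceChar F ψ (B x w) = 1).card : ℝ) *
        Nat.card W = -((Fintype.card K - 1) * f * Nat.card W) := by exact_mod_cast e4
  linear_combination e5 + h0

/-- The Fourier coefficients of the set of vectors `x` with `R x ∈ 𝒯` are sums of Kloosterman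
sums. -/
theorem sum_addChar_value_mem [DecidableEq F] (hψ : ψ ≠ 1) (hf : 0 < f)
    (hG : ∀ s : F, s ≠ 0 → ∑ x, ψ (s * R x) = -(f : ℂ)) (hV : (Fintype.card V : ℝ) = f ^ 2)
    (𝒯 : Finset F) {y : V} (hy : y ≠ 0) :
    Fintype.card F * ∑ x with R x ∈ 𝒯, ψ (B x y) =
      -f * ∑ t ∈ 𝒯, kloostermanSum ψ (-t) (-R y) := by
  -- The variable s detects R x = t. The term s = 0 vanishes by nondegeneracy; for s ≠ 0 completing
  -- the square leaves ψ(-t s - R y / s), a Kloosterman term.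
  have e1 : ∀ t ∈ 𝒯, ∑ s : F, ∑ x, ψ (s * R x + B x y) * ψ (-t * s) =
      -f * kloostermanSum ψ (-t) (-R y) := by
    intro t _
    rw [← Finset.sum_filter_add_sum_filter_not Finset.univ (fun s : F => s = 0),
      Finset.filter_eq' , if_pos (Finset.mem_univ _), Finset.sum_singleton]
    have h0 : ∑ x, ψ (0 * R x + B x y) * ψ (-t * 0) = 0 := by
      simp only [zero_mul, zero_add, mul_zero, AddChar.map_zero_eq_one, mul_one]
      exact h.sum_addChar_eq_zero hψ (h.nondegenerate hψ hf hG hV hy)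
    rw [h0, zero_add, kloostermanSum, Finset.mul_sum]
    refine Finset.sum_congr rfl fun s hs => ?_
    rw [← Finset.sum_mul, h.sum_addChar_add hG (Finset.mem_filter.1 hs).2, mul_assoc,
      ← AddChar.map_add_eq_mul]
    congr 2
    ring
  rw [Finset.mul_sum, Finset.mul_sum, ← Finset.sum_congr rfl e1]
  have e2 : ∀ t, ∑ s : F, ∑ x, ψ (s * R x + B x y) * ψ (-t * s) =
      ∑ x, if R x = t then (Fintype.card F : ℂ) * ψ (B x y) else 0 := by
    intro t
    rw [Finset.sum_comm]
    refine Finset.sum_congr rfl fun x _ => ?_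
    have : ∀ s, ψ (s * R x + B x y) * ψ (-t * s) = ψ (B x y) * ψ ((R x - t) * s) := by
      intro s
      rw [← AddChar.map_add_eq_mul, ← AddChar.map_add_eq_mul]
      congr 1; ring
    simp_rw [this, ← Finset.mul_sum]
    split_ifs with hx
    · simp [hx, mul_comm]
    · rw [sum_addChar_mul_eq_zero hψ (sub_ne_zero.2 hx), mul_zero]
  rw [Finset.sum_congr rfl fun t _ => e2 t, Finset.sum_comm, Finset.sum_filter]
  refine Finset.sum_congr rfl fun x _ => ?_
  rw [Finset.sum_ite_eq]

theorem norm_sum_addChar_value_mem_le [DecidableEq F] (hψ : ψ ≠ 1) (hf : 0 < f)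
    (hG : ∀ s : F, s ≠ 0 → ∑ x, ψ (s * R x) = -(f : ℂ)) (hV : (Fintype.card V : ℝ) = f ^ 2)
    (𝒯 : Finset F) (h𝒯 : (0 : F) ∉ 𝒯) {y : V} (hy : y ≠ 0) :
    Fintype.card F * ‖∑ x with R x ∈ 𝒯, ψ (B x y)‖ ≤ f * (𝒯.card * (2 * √(Fintype.card F))) := by
  have h1 := congrArg norm (h.sum_addChar_value_mem hψ hf hG hV 𝒯 hy)
  rw [norm_mul, norm_mul, norm_neg, Complex.norm_natCast, Complex.norm_real, Real.norm_eq_abs,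
    abs_of_pos hf] at h1
  rw [h1]
  refine mul_le_mul_of_nonneg_left ?_ hf.le
  refine (norm_sum_le _ _).trans ?_
  rw [← nsmul_eq_mul]
  refine Finset.sum_le_card_nsmul _ _ _ fun t ht => ?_
  have ht0 : -t ≠ 0 := by
    rw [neg_ne_zero]; rintro rfl; exact h𝒯 ht
  -- For singular y the Kloosterman sum degenerates to -1, which also obeys the bound.
  by_cases hRy : R y = 0
  · have hK : kloostermanSum ψ (-t) (-R y) = -1 := by
      have := sum_ne_zero_addChar_mul hψ (-t)
      rw [if_neg ht0, zero_sub] at this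
      rw [← this, kloostermanSum]
      refine Finset.sum_congr rfl fun x _ => ?_
      rw [hRy, neg_zero, zero_div, add_zero, mul_comm]
    rw [hK, norm_neg, norm_one]
    have : (1 : ℝ) ≤ √(Fintype.card F) := by
      rw [Real.one_le_sqrt]; exact_mod_cast Fintype.card_pos
    linarith
  · exact norm_kloostermanSum_le hψ ht0 (neg_ne_zero.2 hRy)

end IsQuadraticPair

end Gauss

/-! ### Comparison of the two evaluations. -/

open Classical in
/-- The bound for the size of a set `𝒯` for which the vectors `x` with `R x ∈ 𝒯` meet all maximal
totally isotropic subspaces in the same number of elements. -/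
theorem card_le_of_card_maximal {K F V : Type*} [Field K] [Fintype K] [Field F] [Fintype F]
    [AddCommGroup V] [Module K V] [Module F V] [Fintype V] {β : V → V → K} {P : V → Prop}
    (h : IsPolarForm β P) {ρ f : ℝ} (hρ : 0 < ρ) (hf : 0 < f)
    (hX : ∀ W, TotallyPolar β P W → ρ * (isotropicPerp β P W).card * Nat.card W =
      f ^ 2 - (ρ - 1) * f * Nat.card W)
    {R : V → F} {B : V → V → F} (hR : IsQuadraticPair R B) {ψ : AddChar F ℂ} (hψ : ψ ≠ 1)
    (hG : ∀ s : F, s ≠ 0 → ∑ x, ψ (s * R x) = -(f : ℂ)) (hV : (Fintype.card V : ℝ) = f ^ 2)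
    {ψ' : AddChar K ℂ} (hψ' : ψ' ≠ 1) {θ : V → V} (hθ : ∀ x, x ≠ 0 → θ x ≠ 0)
    (hβ : ∀ x y, ψ' (β x y) = ψ (B x (θ y)))
    {𝒯 : Finset F} (h0 : (0 : F) ∉ 𝒯) (hne : 𝒯.Nonempty) (hP : ∀ x, R x ∈ 𝒯 → P x)
    (hs : ∀ c : K, c ≠ 0 → ∀ x, R x ∈ 𝒯 → R (c • x) ∈ 𝒯)
    (hN : ∀ W, Maximal (TotallyPolar β P) W →
      (((Finset.univ.filter fun x => R x ∈ 𝒯).filter (· ∈ W)).card : ℝ) * Fintype.card F =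
        f * 𝒯.card) :
    (Fintype.card F : ℝ) ≤ 𝒯.card * (2 * √(Fintype.card F) + 1) := by
  have hF : (0 : ℝ) < Fintype.card F := by exact_mod_cast Fintype.card_pos
  have hT : (0 : ℝ) < 𝒯.card := by exact_mod_cast hne.card_pos
  have hD0 : (0 : V) ∉ Finset.univ.filter fun x => R x ∈ 𝒯 := by simpa [hR.map_zero] using h0
  obtain ⟨hcard, hsum⟩ := sum_addChar_of_card_maximal h hρ hf hX
    (D := Finset.univ.filter fun x => R x ∈ 𝒯) (by simpa using hP) hD0 (by simpa using hs)
    (N := f * 𝒯.card / Fintype.card F) (fun W hW => by rw [eq_div_iff hF.ne', hN W hW])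
  obtain ⟨z, hz⟩ : (Finset.univ.filter fun x => R x ∈ 𝒯).Nonempty := by
    rw [← Finset.card_pos, ← Nat.cast_pos (α := ℝ), hcard]
    positivity
  have hz0 : z ≠ 0 := by rintro rfl; exact hD0 hz
  have h1 := hsum hψ' z hz
  simp only [hβ] at h1
  have h2 := hR.norm_sum_addChar_value_mem_le hψ hf hG hV 𝒯 h0 (hθ z hz0)
  rw [h1, Complex.norm_real, Real.norm_eq_abs] at h2
  -- The coefficient N - f equals f(|𝒯| - |F|)/|F|; against Weil's bound this gives |F| - |𝒯| ≤
  -- 2|𝒯|√|F|.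
  have h3 : f * (Fintype.card F - 𝒯.card) ≤
      Fintype.card F * |f * 𝒯.card / Fintype.card F - f| := by
    have : f * (Fintype.card F - 𝒯.card) =
      Fintype.card F * -(f * 𝒯.card / Fintype.card F - f) := by field_simp; ring
    rw [this]
    exact mul_le_mul_of_nonneg_left (neg_le_abs _) hF.le
  have h4 := le_of_mul_le_mul_left (h3.trans h2) hf
  linarith

/-! ### From projective points to vectors. -/

section Points

open Classical in
/-- The number of vectors of an `m`-ovoid in a maximal subspace. -/
theorem IsMOvoid.card_filter_mem {K V E : Type*} [Field K] [Fintype K] [AddCommGroup V]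
    [Module K V] [Fintype V] {S : Submodule K V → Prop} {m : ℕ} {R : V → E} {𝒯 : Set E}
    (h : IsMOvoid S m (pointsWithValueIn K R 𝒯)) (h0 : R 0 ∉ 𝒯)
    (hs : ∀ c : K, c ≠ 0 → ∀ x, R x ∈ 𝒯 → R (c • x) ∈ 𝒯) {W : Submodule K V}
    (hW : Maximal S W) :
    ((Finset.univ.filter fun x => R x ∈ 𝒯).filter (· ∈ W)).card = m * (Fintype.card K - 1) := by
  have hrep : ∀ p ∈ pointsWithValueIn K R 𝒯, R p.rep ∈ 𝒯 := by
    rintro _ ⟨v, hv, hRv, rfl⟩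
    obtain ⟨a, ha⟩ := Projectivization.exists_smul_eq_mk_rep K v hv
    rw [← ha]
    exact hs _ a.ne_zero _ hRv
  have hsub : ∀ p : Projectivization K V, p.submodule = Submodule.span K {p.rep} :=
    fun p => Projectivization.submodule_eq p
  -- Every point in W accounts for the |K| - 1 nonzero multiples of its representative.
  have e : (((Finset.univ.filter fun x => R x ∈ 𝒯).filter (· ∈ W) : Finset V) : Set V) =
      (fun z : Projectivization K V × K => z.2 • z.1.rep) ''
        ({p ∈ pointsWithValueIn K R 𝒯 | p.submodule ≤ W} ×ˢ {c : K | c ≠ 0}) := by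
    ext x
    simp only [Finset.coe_filter, Finset.mem_filter, Finset.mem_univ, true_and, Set.mem_ofPred_eq,
      Set.mem_image, Set.mem_prod, Prod.exists]
    constructor
    · rintro ⟨hx, hxW⟩
      have hx0 : x ≠ 0 := by rintro rfl; exact h0 hx
      obtain ⟨a, ha⟩ := Projectivization.exists_smul_eq_mk_rep K x hx0
      refine ⟨Projectivization.mk K x hx0, (a⁻¹ : Kˣ), ⟨⟨⟨x, hx0, hx, rfl⟩, ?_⟩, a⁻¹.ne_zero⟩, ?_⟩
      · rw [Projectivization.submodule_mk, Submodule.span_singleton_le_iff_mem]; exact hxW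
      · rw [← ha]
        exact inv_smul_smul a x
    · rintro ⟨p, c, ⟨⟨hp, hpW⟩, hc⟩, rfl⟩
      refine ⟨hs c hc _ (hrep p hp), W.smul_mem c (hpW ?_)⟩
      rw [hsub]
      exact Submodule.mem_span_singleton_self _
  have hinj : Set.InjOn (fun z : Projectivization K V × K => z.2 • z.1.rep)
      ({p ∈ pointsWithValueIn K R 𝒯 | p.submodule ≤ W} ×ˢ {c : K | c ≠ 0}) := by
    rintro ⟨p, c⟩ ⟨_, hc⟩ ⟨p', c'⟩ ⟨_, hc'⟩ heq
    simp only [Set.mem_ofPred_eq] at hc hc' heq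
    have hpp : p = p' := by
      rw [← p.mk_rep, ← p'.mk_rep, Projectivization.mk_eq_mk_iff']
      refine ⟨c⁻¹ * c', ?_⟩
      rw [mul_smul, ← heq, inv_smul_smul₀ hc]
    subst hpp
    exact Prod.ext rfl (smul_left_injective K p.rep_nonzero heq)
  rw [← Set.ncard_coe_finset, e, hinj.ncard_image, Set.ncard_prod, h.2 W hW]
  congr 1
  have : {c : K | c ≠ 0} = ((Finset.univ.erase 0 : Finset K) : Set K) := by ext; simp
  rw [this, Set.ncard_coe_finset, Finset.card_erase_of_mem (Finset.mem_univ _), Finset.card_univ]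

theorem IsMOvoid.of_mem {K V E : Type*} [Field K] [AddCommGroup V]
    [Module K V] {S : Submodule K V → Prop} {m : ℕ} {R : V → E} {𝒯 : Set E}
    (h : IsMOvoid S m (pointsWithValueIn K R 𝒯)) (h0 : R 0 ∉ 𝒯) {x : V} (hx : R x ∈ 𝒯) :
    S (Submodule.span K {x}) := by
  have hx0 : x ≠ 0 := by rintro rfl; exact h0 hx
  rw [← Projectivization.submodule_mk x hx0]
  exact h.1 _ ⟨x, hx0, hx, rfl⟩

end Points

/-! ### Sizes of invariant sets. -/

section Cosets

variable {K E : Type*} [Field K] [Field E] [Algebra K E]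

theorem IsCosetReps.ncard_eq [Finite K] {G : Set K} {𝒯 : Set E} {T : Finset E}
    (h : IsCosetReps G 𝒯 T) (h𝒯 : IsInvariantSet G 𝒯) : 𝒯.ncard = T.card * G.ncard := by
  have e : 𝒯 = (fun z : E × K => z.2 • z.1) '' ((T : Set E) ×ˢ G) := by
    ext x
    simp only [Set.mem_image, Set.mem_prod, Prod.exists]
    constructor
    · intro hx
      obtain ⟨t, ⟨ht, c, hc, rfl⟩, _⟩ := h.2 x hx
      exact ⟨t, c, ⟨ht, hc⟩, rfl⟩
    · rintro ⟨t, c, ⟨ht, hc⟩, rfl⟩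
      exact h𝒯.2 c hc t (h.1 t ht)
  have hinj : Set.InjOn (fun z : E × K => z.2 • z.1) ((T : Set E) ×ˢ G) := by
    rintro ⟨t, c⟩ ⟨ht, hc⟩ ⟨t', c'⟩ ⟨ht', hc'⟩ heq
    simp only at ht hc ht' hc' heq
    obtain ⟨s, -, hs⟩ := h.2 (c • t) (h𝒯.2 c hc t (h.1 t ht))
    have h1 := hs t ⟨ht, c, hc, rfl⟩
    have h2 := hs t' ⟨ht', c', hc', heq⟩
    obtain rfl : t = t' := h1.trans h2.symm
    exact Prod.ext rfl (smul_left_injective K (h𝒯.1 t (h.1 t ht)) heq)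
  conv_lhs => rw [e]
  rw [hinj.ncard_image, Set.ncard_prod, Set.ncard_coe_finset]

variable (K)

theorem ncard_nonzeroElements [Finite K] :
    ((nonzeroElements K).ncard : ℝ) = Nat.card K - 1 := by
  classical
  have : Fintype K := Fintype.ofFinite K
  have e : nonzeroElements K = ((Finset.univ.erase 0 : Finset K) : Set K) := by
    ext; simp [nonzeroElements]
  rw [e, Set.ncard_coe_finset, Finset.card_erase_of_mem (Finset.mem_univ _), Finset.card_univ,
    Nat.cast_sub Fintype.card_pos, Nat.card_eq_fintype_card, Nat.cast_one]

/-- In characteristic 2 every element is a square; otherwise squaring is two-to-one on nonzero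
elements. -/
theorem ncard_nonzeroSquares [Finite K] :
    ((nonzeroSquares K).ncard : ℝ) = epsilon (Nat.card K) * (Nat.card K - 1) := by
  classical
  have : Fintype K := Fintype.ofFinite K
  by_cases h2 : ringChar K = 2
  · have hne : ¬ Odd (Nat.card K) := by
      rw [Nat.not_odd_iff_even, Nat.card_eq_fintype_card, Nat.even_iff]
      exact FiniteField.even_card_of_char_two h2
    rw [epsilon, if_neg hne, one_mul, ← ncard_nonzeroElements K]
    congr 2
    ext c
    simp only [nonzeroSquares, nonzeroElements, Set.mem_ofPred_eq, and_iff_left_iff_imp]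
    exact fun _ => FiniteField.isSquare_of_char_two h2 c
  · have ho : Odd (Nat.card K) := by
      rw [Nat.card_eq_fintype_card, Nat.odd_iff]; exact FiniteField.odd_card_of_char_ne_two h2
    rw [epsilon, if_pos ho]
    have e : nonzeroSquares K =
        ((Finset.univ.filter fun c : K => c ≠ 0 ∧ IsSquare c : Finset K) : Set K) := by
      ext; simp [nonzeroSquares]
    have hc : (Finset.univ.erase (0 : K)).card =
        (Finset.univ.filter fun c : K => c ≠ 0 ∧ IsSquare c).card * 2 := by
      rw [Finset.card_eq_sum_card_fiberwise (f := fun c => c * c)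
        (t := Finset.univ.filter fun c : K => c ≠ 0 ∧ IsSquare c)]
      · refine Finset.sum_const_nat fun s hs => ?_
        obtain ⟨hs0, r, rfl⟩ := (Finset.mem_filter.1 hs).2
        have hr : r ≠ 0 := by rintro rfl; exact hs0 (mul_zero 0)
        have e : (Finset.univ.erase (0 : K)).filter (fun c => c * c = r * r) = {r, -r} := by
          ext c
          simp only [Finset.mem_filter, Finset.mem_erase, Finset.mem_univ, and_true,
            Finset.mem_insert, Finset.mem_singleton, mul_self_eq_mul_self_iff]
          refine ⟨fun H => H.2, fun H => ⟨?_, H⟩⟩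
          rintro rfl
          rcases H with H | H
          · exact hr H.symm
          · exact hr (neg_eq_zero.1 H.symm)
        rw [e, Finset.card_pair]
        exact fun H => hr ((Ring.eq_self_iff_eq_zero_of_char_ne_two h2).1 H.symm)
      · intro c hc
        have : c ≠ 0 := by simpa using hc
        simp [this]
    have hc' : ((Finset.univ.erase (0 : K)).card : ℝ) = Nat.card K - 1 := by
      rw [Finset.card_erase_of_mem (Finset.mem_univ _), Finset.card_univ,
        Nat.cast_sub Fintype.card_pos, Nat.card_eq_fintype_card, Nat.cast_one]
    rw [e, Set.ncard_coe_finset, ← hc', hc]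
    push_cast
    ring

end Cosets

/-! ### The bound for ovoids, and the case of quadratic forms. -/

section Ovoids

open Classical in
/-- The bound for the size of `𝒯` when the vectors `x` with `R x ∈ 𝒯` form an `m`-ovoid. -/
theorem IsMOvoid.card_le {K F V : Type*} [Field K] [Fintype K] [Field F] [Fintype F]
    [AddCommGroup V] [Module K V] [Module F V] [Fintype V] {S : Submodule K V → Prop}
    {β : V → V → K} {P : V → Prop} (h : IsPolarForm β P) (hS : ∀ W, S W ↔ TotallyPolar β P W)
    {ρ f : ℝ} (hρ : 0 < ρ) (hf : 0 < f)
    (hX : ∀ W, TotallyPolar β P W → ρ * (isotropicPerp β P W).card * Nat.card W =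
      f ^ 2 - (ρ - 1) * f * Nat.card W)
    {R : V → F} {B : V → V → F} (hR : IsQuadraticPair R B) {ψ : AddChar F ℂ} (hψ : ψ ≠ 1)
    (hG : ∀ s : F, s ≠ 0 → ∑ x, ψ (s * R x) = -(f : ℂ)) (hV : (Fintype.card V : ℝ) = f ^ 2)
    {ψ' : AddChar K ℂ} (hψ' : ψ' ≠ 1) {θ : V → V} (hθ : ∀ x, x ≠ 0 → θ x ≠ 0)
    (hβ : ∀ x y, ψ' (β x y) = ψ (B x (θ y))) {m : ℕ} {𝒯 : Set F} (h0 : (0 : F) ∉ 𝒯)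
    (hne : 𝒯.Nonempty) (hs : ∀ c : K, c ≠ 0 → ∀ x, R x ∈ 𝒯 → R (c • x) ∈ 𝒯)
    (hm : (m : ℝ) * (Nat.card K - 1) * Nat.card F = f * 𝒯.ncard)
    (hM : IsMOvoid S m (pointsWithValueIn K R 𝒯)) :
    (Nat.card F : ℝ) ≤ 𝒯.ncard * (2 * √(Nat.card F) + 1) := by
  have hR0 : R 0 ∉ 𝒯 := by rwa [hR.map_zero]
  have hT : 𝒯.ncard = 𝒯.toFinset.card := Set.ncard_eq_toFinset_card' 𝒯
  rw [hT, Nat.card_eq_fintype_card]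
  rw [hT, Nat.card_eq_fintype_card, Nat.card_eq_fintype_card] at hm
  refine card_le_of_card_maximal h hρ hf hX hR hψ hG hV hψ' hθ hβ (𝒯 := 𝒯.toFinset)
    (by simpa using h0) (by simpa using hne) ?_ (by simpa using hs) ?_
  · intro x hx
    exact ((hS _).1 (hM.of_mem hR0 (Set.mem_toFinset.1 hx))).1 x
      (Submodule.mem_span_singleton_self x)
  · intro W hW
    have : S = TotallyPolar β P := funext fun W => propext (hS W)
    have h1 := hM.card_filter_mem hR0 hs (this ▸ hW)
    simp only [Set.mem_toFinset]
    rw [h1, Nat.cast_mul, Nat.cast_sub Fintype.card_pos, Nat.cast_one]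
    exact hm

/-- Perpendicularity can be tested with a character. -/
theorem perp_iff_addChar {K V : Type*} [Field K] [AddCommGroup V] [Module K V] {β : V → V → K}
    {ψ' : AddChar K ℂ} (hψ' : ψ' ≠ 1)
    (hσ : ∀ t : K, ∃ c : K, ∀ x y, β x (c • y) = t * β x y) (W : Submodule K V) (x : V) :
    (∀ w ∈ W, β x w = 0) ↔ ∀ w ∈ W, ψ' (β x w) = 1 := by
  refine ⟨fun H w hw => by rw [H w hw, AddChar.map_zero_eq_one], fun H w hw => ?_⟩
  by_contra hne
  obtain ⟨t, ht⟩ := AddChar.ne_one_iff.1 hψ'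
  obtain ⟨c, hc⟩ := hσ (t / β x w)
  have := H _ (W.smul_mem c hw)
  rw [hc, div_mul_cancel₀ _ hne] at this
  exact ht this

/-- If β y x ≠ 0, rescaling y gives β y x any value, one with ψ' ≠ 1 included, while β x y stays 0.
Needed for the Hermitian form, which becomes symmetric only after a further trace. -/
theorem symm_of_addChar {K V : Type*} [Field K] [AddCommGroup V] [Module K V] {β : V → V → K}
    {ψ' : AddChar K ℂ} (hψ' : ψ' ≠ 1) (hl : ∀ (c : K) x z, β (c • x) z = c * β x z)
    (hσ : ∀ c : K, ∃ t : K, ∀ x y, β x (c • y) = t * β x y)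
    (hs : ∀ x y, ψ' (β x y) = ψ' (β y x)) {x y : V} (h : β x y = 0) : β y x = 0 := by
  by_contra hne
  obtain ⟨t, ht⟩ := AddChar.ne_one_iff.1 hψ'
  obtain ⟨s, hc⟩ := hσ (t / β y x)
  have := hs ((t / β y x) • y) x
  rw [hl, hc, h, mul_zero, AddChar.map_zero_eq_one, div_mul_cancel₀ _ hne] at this
  exact ht this

theorem exists_addChar_ne_one (K : Type*) [Field K] [Finite K] : ∃ ψ : AddChar K ℂ, ψ ≠ 1 := by
  obtain ⟨ψ, h⟩ := AddChar.exists_apply_ne_zero.2 (one_ne_zero (α := K))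
  exact ⟨ψ, AddChar.ne_one_iff.2 ⟨1, h⟩⟩

/-- The case of the polar spaces of quadratic forms `Tr_{F/K} ∘ R`. -/
theorem IsMOvoid.card_le_of_totallySingular {K F V : Type*} [Field K] [Finite K] [Field F]
    [Finite F] [Algebra K F] [AddCommGroup V] [Module K V] [Module F V] [IsScalarTower K F V]
    [Fintype V] {R : V → F} {B : V → V → F} (hR : IsQuadraticPair R B) {f : ℝ} (hf : 0 < f)
    (hG : ∀ ψ : AddChar F ℂ, ψ ≠ 1 → ∀ s : F, s ≠ 0 → ∑ x, ψ (s * R x) = -(f : ℂ))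
    (hV : (Fintype.card V : ℝ) = f ^ 2) {m : ℕ} {𝒯 : Set F} (hne : 𝒯.Nonempty)
    (h𝒯 : IsInvariantSet (nonzeroSquares K) 𝒯)
    (hm : (m : ℝ) * (Nat.card K - 1) * Nat.card F = f * 𝒯.ncard)
    (hM : IsMOvoid (TotallySingular fun x => Algebra.trace K F (R x)) m
      (pointsWithValueIn K R 𝒯)) :
    (Nat.card F : ℝ) ≤ 𝒯.ncard * (2 * √(Nat.card F) + 1) := by
  classical
  have : Fintype K := Fintype.ofFinite K
  have : Fintype F := Fintype.ofFinite F
  obtain ⟨ψ', hψ'⟩ := exists_addChar_ne_one K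
  have hψ : traceChar F ψ' ≠ 1 := traceChar_ne_one hψ'
  have hsm : ∀ (c : K) (x : V), c • x = algebraMap K F c • x := fun c x =>
    (algebraMap_smul F c x).symm
  have hl : ∀ (c : K) (x z : V), Algebra.trace K F (B (c • x) z) =
      c * Algebra.trace K F (B x z) := fun c x z => by
    rw [hsm, hR.smul_left, ← Algebra.smul_def, map_smul, smul_eq_mul]
  have hr : ∀ (c : K) (x z : V), Algebra.trace K F (B x (c • z)) =
      c * Algebra.trace K F (B x z) := fun c x z => by rw [hR.symm, hl, hR.symm]
  have hRs : ∀ (c : K) (x : V), R (c • x) = (c * c) • R x := fun c x => by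
    rw [hsm, hR.map_smul, Algebra.smul_def, map_mul, sq]
  have h : IsPolarForm (fun x y => Algebra.trace K F (B x y))
      (fun x => Algebra.trace K F (R x) = 0) :=
    { add_left := fun x y z => by rw [hR.add_left, map_add]
      smul_left := hl
      symm := fun x y h => by rwa [hR.symm]
      zero := by rw [hR.map_zero, map_zero]
      smul := fun c x hx => by rw [hRs, map_smul, hx, smul_zero]
      add := fun x y hx hy hxy => by rw [hR.map_add, map_add, map_add, hx, hy, hxy]; simp
      self := fun x hx => by
        have h1 := hR.map_add x x
        have h2 : R (x + x) = (2 : K) • (2 : K) • R x := by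
          rw [smul_smul, ← hRs, two_smul]
        have h3 := congrArg (Algebra.trace K F) h1
        rw [h2, map_add, map_add, map_smul, map_smul, hx] at h3
        simpa using h3.symm }
  refine hM.card_le h (ρ := Nat.card K) (fun W => ⟨fun H => ⟨H, fun x hx y hy => ?_⟩, fun H => H.1⟩)
    (by exact_mod_cast Nat.card_pos) hf ?_ hR hψ (hG _ hψ) hV hψ' (θ := id) (fun _ hx => hx)
    (fun _ _ => rfl) (fun H => h𝒯.1 0 H rfl) hne ?_ hm
  · have h1 := H _ (W.add_mem hx hy)
    simp only [hR.map_add, map_add] at h1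
    have hx' := H x hx
    have hy' := H y hy
    simp only at hx' hy'
    simpa [hx', hy'] using h1
  · intro W hW
    have h1 := hR.card_isotropic_perp_mul_card hψ' hf (hG _ hψ) hV W.toAddSubgroup hW.1
    have e : isotropicPerp (fun x y => Algebra.trace K F (B x y))
        (fun x => Algebra.trace K F (R x) = 0) W =
        Finset.univ.filter fun x : V => Algebra.trace K F (R x) = 0 ∧
          ∀ w ∈ W.toAddSubgroup, traceChar F ψ' (B x w) = 1 := by
      refine Finset.filter_congr fun x _ => and_congr_right fun _ => ?_
      exact perp_iff_addChar (β := fun x y => Algebra.trace K F (B x y)) hψ'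
        (fun t => ⟨t, fun x y => hr t x y⟩) W x
    rw [Nat.card_eq_fintype_card, e]
    exact h1
  · intro c hc x hx
    rw [hRs]
    exact h𝒯.2 _ ⟨mul_ne_zero hc hc, c, rfl⟩ _ hx

end Ovoids

/-! ### The Hermitian form and its Gauss sums. -/

section HermitianForm

variable (L₀ : Type*) {L : Type*} [Field L₀] [Field L] [Finite L₀] [Finite L] [Algebra L₀ L] {n : ℕ}

theorem add_pow_natCard (x y : L) : (x + y) ^ Nat.card L₀ = x ^ Nat.card L₀ + y ^ Nat.card L₀ := by
  have : Fintype L₀ := Fintype.ofFinite L₀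
  rw [Nat.card_eq_fintype_card]
  exact map_add (FiniteField.frobeniusAlgHom L₀ L) x y

theorem sum_pow_natCard {ι : Type*} (s : Finset ι) (x : ι → L) :
    (∑ i ∈ s, x i) ^ Nat.card L₀ = ∑ i ∈ s, x i ^ Nat.card L₀ := by
  have : Fintype L₀ := Fintype.ofFinite L₀
  rw [Nat.card_eq_fintype_card]
  exact map_sum (FiniteField.frobeniusAlgHom L₀ L) x s

theorem pow_natCard_pow_natCard (h : Module.finrank L₀ L = 2) (x : L) :
    (x ^ Nat.card L₀) ^ Nat.card L₀ = x := by
  have : Fintype L := Fintype.ofFinite L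
  rw [← pow_mul, ← sq, ← h, ← Module.natCard_eq_pow_finrank, Nat.card_eq_fintype_card,
    FiniteField.pow_card]

theorem hermForm_add_left (x y z : Fin n → L) :
    hermForm L₀ (x + y) z = hermForm L₀ x z + hermForm L₀ y z := by
  simp [hermForm, add_mul, Finset.sum_add_distrib]

theorem hermForm_add_right (x y z : Fin n → L) :
    hermForm L₀ x (y + z) = hermForm L₀ x y + hermForm L₀ x z := by
  simp [hermForm, add_pow_natCard, mul_add, Finset.sum_add_distrib]

theorem hermForm_smul_left (c : L) (x y : Fin n → L) :
    hermForm L₀ (c • x) y = c * hermForm L₀ x y := by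
  simp [hermForm, Finset.mul_sum, mul_assoc]

theorem hermForm_smul_right (c : L) (x y : Fin n → L) :
    hermForm L₀ x (c • y) = c ^ Nat.card L₀ * hermForm L₀ x y := by
  simp [hermForm, Finset.mul_sum, mul_pow, mul_left_comm]

theorem hermForm_swap (h : Module.finrank L₀ L = 2) (x y : Fin n → L) :
    hermForm L₀ y x = hermForm L₀ x y ^ Nat.card L₀ := by
  simp [hermForm, sum_pow_natCard, mul_pow, pow_natCard_pow_natCard L₀ h, mul_comm]

theorem hermNorm_smul (c : L) (x : Fin n → L) :
    hermNorm L₀ (c • x) = Algebra.norm L₀ c * hermNorm L₀ x := by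
  simp [hermNorm, Finset.mul_sum]

theorem algebraMap_trace_natCard (h : Module.finrank L₀ L = 2) (x : L) :
    algebraMap L₀ L (Algebra.trace L₀ L x) = x + x ^ Nat.card L₀ := by
  rw [FiniteField.algebraMap_trace_eq_sum_pow, h]
  simp [Finset.sum_range_succ]

/-- Since κ'(y, x) is the conjugate of κ'(x, y), the cross terms of H'(x + y) form a relative trace.
-/
theorem isQuadraticPair_hermNorm (h : Module.finrank L₀ L = 2) :
    IsQuadraticPair (hermNorm L₀ : (Fin n → L) → L₀)
      (fun x y => Algebra.trace L₀ L (hermForm L₀ x y)) where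
  map_add x y := by
    apply (algebraMap L₀ L).injective
    rw [map_add, map_add, algebraMap_hermNorm L₀ h, algebraMap_hermNorm L₀ h,
      algebraMap_hermNorm L₀ h, algebraMap_trace_natCard L₀ h, ← hermForm_swap L₀ h,
      hermForm_add_left, hermForm_add_right, hermForm_add_right]
    ring
  map_smul c x := by
    rw [← algebraMap_smul L c x, hermNorm_smul, Algebra.norm_algebraMap, h]
  add_left x y z := by rw [hermForm_add_left, map_add]
  smul_left c x z := by
    rw [← algebraMap_smul L c x, hermForm_smul_left, ← Algebra.smul_def, map_smul, smul_eq_mul]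

/-- The hyperbolic form uv on F × F and the norm form of E have Gauss sums with total 0, by the
two-to-one count of (trace, norm); the hyperbolic one is |F|. -/
theorem sum_addChar_norm {F E : Type*} [Field F] [Fintype F] [Field E] [Fintype E] [Algebra F E]
    (h : Module.finrank F E = 2) {ψ : AddChar F ℂ} (hψ : ψ ≠ 1) {s : F} (hs : s ≠ 0) :
    ∑ x : E, ψ (s * Algebra.norm F x) = -(Fintype.card F : ℂ) := by
  classical
  have e := sum_add_mul_add_sum_trace_norm h fun p : F × F => ψ (s * p.2)
  have e1 : ∑ u : F × F, ψ (s * (u.1 * u.2)) = Fintype.card F := by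
    rw [Fintype.sum_prod_type, Finset.sum_eq_single 0]
    · simp
    · intro a _ ha
      simp_rw [← mul_assoc]
      exact sum_addChar_mul_eq_zero hψ (mul_ne_zero hs ha)
    · simp
  have e2 : ∑ p : F × F, ψ (s * p.2) = 0 := by
    rw [Fintype.sum_prod_type]
    simp [sum_addChar_mul_eq_zero hψ hs]
  simp only [e1, e2] at e
  linear_combination e

theorem sum_addChar_sum {F ι : Type*} [Field F] [Fintype ι] [DecidableEq ι] {X : Type*} [Fintype X]
    (ψ : AddChar F ℂ) (s : F) (g : ι → X → F) :
    ∑ x : ι → X, ψ (s * ∑ i, g i (x i)) = ∏ i, ∑ a, ψ (s * g i a) := by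
  rw [Finset.prod_univ_sum, Fintype.piFinset_univ]
  refine Finset.sum_congr rfl fun x _ => ?_
  rw [Finset.mul_sum]
  exact map_prod ψ.toMonoidHom (fun i => Multiplicative.ofAdd (s * g i (x i))) Finset.univ

/-- A product of n Gauss sums -|L₀|; n odd provides the negative sign. -/
theorem sum_addChar_hermNorm [Fintype L] (h : Module.finrank L₀ L = 2) (hn : Odd n)
    {ψ : AddChar L₀ ℂ} (hψ : ψ ≠ 1) {s : L₀} (hs : s ≠ 0) :
    ∑ x : Fin n → L, ψ (s * hermNorm L₀ x) = -(((Nat.card L₀ : ℝ) ^ n : ℝ) : ℂ) := by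
  have : Fintype L₀ := Fintype.ofFinite L₀
  have := sum_addChar_sum (ι := Fin n) ψ s fun _ (z : L) => Algebra.norm L₀ z
  simp only [hermNorm, this, sum_addChar_norm h hψ hs]
  simp [hn.neg_pow]

theorem card_fin_fun [Fintype L] (h : Module.finrank L₀ L = 2) (n : ℕ) :
    (Fintype.card (Fin n → L) : ℝ) = ((Nat.card L₀ : ℝ) ^ n) ^ 2 := by
  rw [Fintype.card_fun, Fintype.card_fin, ← Nat.card_eq_fintype_card (α := L),
    Module.natCard_eq_pow_finrank (K := L₀), h]
  push_cast
  ring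

end HermitianForm

/-! ### The elliptic quadratic form and its Gauss sums. -/

section Elliptic

variable {L : Type*} [Field L] {k : ℕ}

/-- The polar form of `ellipticForm a₀ a₁`. -/
def ellipticPolar (a₀ a₁ : L) (x y : Fin (2 * k + 2) → L) : L :=
  ellipticForm a₀ a₁ (x + y) - ellipticForm a₀ a₁ x - ellipticForm a₀ a₁ y

theorem ellipticPolar_eq (a₀ a₁ : L) (x y : Fin (2 * k + 2) → L) : ellipticPolar a₀ a₁ x y =
    (∑ i : Fin k, (x ⟨2 * i, by omega⟩ * y ⟨2 * i + 1, by omega⟩ +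
      y ⟨2 * i, by omega⟩ * x ⟨2 * i + 1, by omega⟩)) +
    (2 * x ⟨2 * k, by omega⟩ * y ⟨2 * k, by omega⟩ +
      a₀ * (x ⟨2 * k, by omega⟩ * y ⟨2 * k + 1, by omega⟩ +
        y ⟨2 * k, by omega⟩ * x ⟨2 * k + 1, by omega⟩) +
      2 * a₁ * x ⟨2 * k + 1, by omega⟩ * y ⟨2 * k + 1, by omega⟩) := by
  have : ∀ i : Fin k, (x ⟨2 * i, by omega⟩ + y ⟨2 * i, by omega⟩) *
      (x ⟨2 * i + 1, by omega⟩ + y ⟨2 * i + 1, by omega⟩) =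
      x ⟨2 * i, by omega⟩ * x ⟨2 * i + 1, by omega⟩ + y ⟨2 * i, by omega⟩ * y ⟨2 * i + 1, by omega⟩ +
      (x ⟨2 * i, by omega⟩ * y ⟨2 * i + 1, by omega⟩ +
      y ⟨2 * i, by omega⟩ * x ⟨2 * i + 1, by omega⟩) := fun i => by ring
  simp only [ellipticPolar, ellipticForm, Pi.add_apply, this, Finset.sum_add_distrib]
  ring

theorem isQuadraticPair_ellipticForm (a₀ a₁ : L) :
    IsQuadraticPair (ellipticForm (k := k) a₀ a₁) (ellipticPolar a₀ a₁) where
  map_add x y := by rw [ellipticPolar]; ring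
  map_smul c x := by
    simp only [ellipticForm, Pi.smul_apply, smul_eq_mul, mul_add, Finset.mul_sum]
    congr 1
    · exact Finset.sum_congr rfl fun i _ => by ring
    · ring
  add_left x y z := by
    simp only [ellipticPolar_eq, Pi.add_apply, add_mul, mul_add, Finset.sum_add_distrib]
    ring
  smul_left c x z := by
    simp only [ellipticPolar_eq, Pi.smul_apply, smul_eq_mul, mul_add, Finset.mul_sum,
      Finset.sum_add_distrib]
    simp only [mul_left_comm _ c, mul_assoc]

/-- The pairs of coordinates of a vector in `L ^ (2k + 2)`. -/
def coordinatePairs (L : Type*) (k : ℕ) : (Fin (2 * k + 2) → L) ≃ (Fin (k + 1) → L × L) where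
  toFun x i := (x ⟨2 * i, by omega⟩, x ⟨2 * i + 1, by omega⟩)
  invFun y j := if (j : ℕ) % 2 = 0 then (y ⟨j / 2, by omega⟩).1 else (y ⟨j / 2, by omega⟩).2
  left_inv x := by
    ext j
    dsimp only
    split_ifs with h
    · congr 1; ext; simp only; omega
    · congr 1; ext; simp only; omega
  right_inv y := by
    ext i
    · simp
    · have : (2 * (i : ℕ) + 1) / 2 = i := by omega
      simp [this]

/-- Irreducibility makes `QuadraticAlgebra L (-a₁) a₀` a quadratic extension field whose norm form
is this binary form. -/
theorem sum_addChar_anisotropic [Fintype L] {a₀ a₁ : L}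
    (h : Irreducible (X ^ 2 + C a₀ * X + C a₁ : L[X])) {ψ : AddChar L ℂ} (hψ : ψ ≠ 1) {s : L}
    (hs : s ≠ 0) : ∑ p : L × L, ψ (s * (p.1 ^ 2 + a₀ * p.1 * p.2 + a₁ * p.2 ^ 2)) =
      -(Fintype.card L : ℂ) := by
  have : Fact (∀ r : L, r ^ 2 ≠ -a₁ + a₀ * r) := ⟨fun r hr => by
    have hroot : (X ^ 2 + C a₀ * X + C a₁ : L[X]).IsRoot (-r) := by
      simp only [IsRoot.def, eval_add, eval_pow, eval_X, eval_mul, eval_C]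
      linear_combination hr
    have h1 := degree_eq_one_of_irreducible_of_root h hroot
    have h2 : (X ^ 2 + C a₀ * X + C a₁ : L[X]).degree = 2 := by compute_degree!
    rw [h2] at h1
    exact absurd h1 (by decide)⟩
  have : Fintype (QuadraticAlgebra L (-a₁) a₀) :=
    Fintype.ofEquiv _ (QuadraticAlgebra.equivProd (-a₁) a₀).symm
  have h1 := sum_addChar_norm (QuadraticAlgebra.finrank_eq_two (a := -a₁) (b := a₀)) hψ hs
  rw [← h1, ← Equiv.sum_comp (QuadraticAlgebra.equivProd (-a₁) a₀)]
  refine Finset.sum_congr rfl fun z _ => ?_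
  have hn : Algebra.norm L z = QuadraticAlgebra.norm z := by
    rw [← QuadraticAlgebra.det_toLinearMap_eq_norm, Algebra.norm_apply]
    rfl
  rw [hn, QuadraticAlgebra.norm_def]
  congr 2
  simp only [QuadraticAlgebra.equivProd, Equiv.coe_fn_mk]
  ring

theorem sum_addChar_ellipticForm [Fintype L] {a₀ a₁ : L}
    (h : Irreducible (X ^ 2 + C a₀ * X + C a₁ : L[X])) {ψ : AddChar L ℂ} (hψ : ψ ≠ 1) {s : L}
    (hs : s ≠ 0) : ∑ x : Fin (2 * k + 2) → L, ψ (s * ellipticForm a₀ a₁ x) =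
      -(((Nat.card L : ℝ) ^ (k + 1) : ℝ) : ℂ) := by
  -- The k hyperbolic planes contribute |L| each and the last, anisotropic plane -|L|.
  set g : Fin (k + 1) → L × L → L := Fin.lastCases
    (fun p => p.1 ^ 2 + a₀ * p.1 * p.2 + a₁ * p.2 ^ 2) (fun _ p => p.1 * p.2) with hg
  have e : ∀ x : Fin (2 * k + 2) → L,
      ellipticForm a₀ a₁ x = ∑ i, g i (coordinatePairs L k x i) := by
    intro x
    rw [Fin.sum_univ_castSucc]
    simp [hg, coordinatePairs, ellipticForm]
  simp_rw [e]
  rw [Equiv.sum_comp (coordinatePairs L k) fun y => ψ (s * ∑ i, g i (y i)), sum_addChar_sum,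
    Fin.prod_univ_castSucc]
  have e1 : ∑ u : L × L, ψ (s * (u.1 * u.2)) = Fintype.card L := by
    classical
    rw [Fintype.sum_prod_type, Finset.sum_eq_single 0]
    · simp
    · intro a _ ha
      simp_rw [← mul_assoc]
      exact sum_addChar_mul_eq_zero hψ (mul_ne_zero hs ha)
    · simp
  simp only [hg, Fin.lastCases_castSucc, Fin.lastCases_last, e1, sum_addChar_anisotropic h hψ hs]
  simp [pow_succ]

end Elliptic

/-! ### The symplectic polar spaces. -/

section Symplectic

variable {K L₀ L : Type*} [Field K] [Field L₀] [Field L] [Finite K] [Finite L₀] [Finite L]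
  [Algebra K L₀] [Algebra K L] [Algebra L₀ L] [IsScalarTower K L₀ L] {n : ℕ}

theorem hermNorm_smul_of_tower (h : Module.finrank L₀ L = 2) (c : K) (x : Fin n → L) :
    hermNorm L₀ (c • x) = (c * c) • hermNorm L₀ x := by
  rw [← algebraMap_smul L₀ c x, (isQuadraticPair_hermNorm L₀ h).map_smul, Algebra.smul_def,
    map_mul, sq]

section

variable (h : Module.finrank L₀ L = 2) {lam : L} (hlam : lam + lam ^ Nat.card L₀ = 0)
include h hlam

theorem trace_mul_hermForm_swap (x y : Fin n → L) :
    Algebra.trace L₀ L (lam * hermForm L₀ y x) = -Algebra.trace L₀ L (lam * hermForm L₀ x y) := by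
  apply (algebraMap L₀ L).injective
  rw [map_neg, algebraMap_trace_natCard L₀ h, algebraMap_trace_natCard L₀ h, mul_pow, mul_pow,
    ← hermForm_swap L₀ h, ← hermForm_swap L₀ h]
  linear_combination (hermForm L₀ x y + hermForm L₀ y x) * hlam

theorem trace_mul_hermForm_self (x : Fin n → L) :
    Algebra.trace L₀ L (lam * hermForm L₀ x x) = 0 := by
  apply (algebraMap L₀ L).injective
  rw [map_zero, algebraMap_trace_natCard L₀ h, mul_pow, ← hermForm_swap L₀ h]
  linear_combination hermForm L₀ x x * hlam

/-- As λ^|L₀| = -λ, the factor -λ leaves the semilinear argument as λ. So the symplectic pairing is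
the polar form of H' after the twist θ : y ↦ -λ y. -/
theorem hermForm_neg_smul (x y : Fin n → L) :
    hermForm L₀ x (-lam • y) = lam * hermForm L₀ x y := by
  have h1 := add_pow_natCard L₀ lam (-lam)
  rw [add_neg_cancel, zero_pow Nat.card_pos.ne'] at h1
  rw [hermForm_smul_right]
  linear_combination (-h1 - hlam) * hermForm L₀ x y

theorem isPolarForm_symplectic : IsPolarForm
    (fun x y : Fin n → L => Algebra.trace K L (lam * hermForm L₀ x y)) fun _ => True where
  add_left x y z := by rw [hermForm_add_left, mul_add, map_add]
  smul_left c x z := by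
    rw [← algebraMap_smul L c x, hermForm_smul_left, mul_left_comm, ← Algebra.smul_def, map_smul,
      smul_eq_mul]
  symm x y hxy := by
    rw [← Algebra.trace_trace (S := L₀)] at hxy ⊢
    rw [trace_mul_hermForm_swap h hlam, map_neg, hxy, neg_zero]
  zero := trivial
  smul _ _ _ := trivial
  add _ _ _ _ _ := trivial
  self x _ := by
    rw [← Algebra.trace_trace (S := L₀), trace_mul_hermForm_self h hlam, map_zero]

end

/-- The case of the symplectic polar spaces. -/
theorem IsMOvoid.card_le_of_symplectic (h : Module.finrank L₀ L = 2) (hn : Odd n) {lam : L}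
    (hlam0 : lam ≠ 0) (hlam : lam + lam ^ Nat.card L₀ = 0) {m : ℕ} {𝒯 : Set L₀} (hne : 𝒯.Nonempty)
    (h𝒯 : IsInvariantSet (nonzeroSquares K) 𝒯)
    (hm : (m : ℝ) * (Nat.card K - 1) * Nat.card L₀ = (Nat.card L₀ : ℝ) ^ n * 𝒯.ncard)
    (hM : IsMOvoid (TotallyIsotropic
      fun x y : Fin n → L => Algebra.trace K L (lam * hermForm L₀ x y)) m
      (pointsWithValueIn K (hermNorm L₀) 𝒯)) :
    (Nat.card L₀ : ℝ) ≤ 𝒯.ncard * (2 * √(Nat.card L₀) + 1) := by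
  classical
  have : Fintype K := Fintype.ofFinite K
  have : Fintype L₀ := Fintype.ofFinite L₀
  have : Fintype L := Fintype.ofFinite L
  obtain ⟨ψ', hψ'⟩ := exists_addChar_ne_one K
  have hψ : traceChar L₀ ψ' ≠ 1 := traceChar_ne_one hψ'
  have hf : 0 < (Nat.card L₀ : ℝ) ^ n := pow_pos (by exact_mod_cast Nat.card_pos) n
  have hG := fun s (hs : s ≠ 0) => sum_addChar_hermNorm L₀ h hn hψ hs
  have hV := card_fin_fun (L := L) L₀ h n
  have hβ : ∀ x y : Fin n → L, ψ' (Algebra.trace K L (lam * hermForm L₀ x y)) =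
      traceChar L₀ ψ' (Algebra.trace L₀ L (hermForm L₀ x (-lam • y))) := by
    intro x y
    rw [hermForm_neg_smul h hlam, traceChar_apply, Algebra.trace_trace]
  refine hM.card_le (isPolarForm_symplectic h hlam) (ρ := 1)
    (fun W => ⟨fun H => ⟨fun _ _ => trivial, H⟩, fun H => H.2⟩) one_pos hf ?_
    (isQuadraticPair_hermNorm L₀ h) hψ hG hV hψ' (θ := fun y => -lam • y)
    (fun x hx => smul_ne_zero (neg_ne_zero.2 hlam0) hx) hβ (fun H => h𝒯.1 0 H rfl) hne ?_ hm
  · intro W _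
    have hinj : Function.Injective (DistribSMul.toAddMonoidHom (Fin n → L) (-lam)) :=
      smul_right_injective _ (neg_ne_zero.2 hlam0)
    -- W' = θ(W) has the same order as W, and the symplectic perp of W is the perp of W' for the
    -- polar form of H'. All vectors are isotropic, so ρ = 1 and `hX` becomes |W^⊥| |W| = f².
    set W' := W.toAddSubgroup.map (DistribSMul.toAddMonoidHom (Fin n → L) (-lam)) with hW'
    have h1 := (isQuadraticPair_hermNorm L₀ h).card_perp_mul_card hψ hf hG hV W'
    have hc : Nat.card W' = Nat.card W :=
      (Nat.card_congr (W.toAddSubgroup.equivMapOfInjective _ hinj).toEquiv).symm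
    have e : isotropicPerp (fun x y : Fin n → L => Algebra.trace K L (lam * hermForm L₀ x y))
        (fun _ => True) W = Finset.univ.filter fun x : Fin n → L =>
          ∀ w ∈ W', traceChar L₀ ψ' (Algebra.trace L₀ L (hermForm L₀ x w)) = 1 := by
      ext x
      simp only [isotropicPerp, Finset.mem_filter, Finset.mem_univ, true_and]
      have h2 := perp_iff_addChar
        (β := fun x y : Fin n → L => Algebra.trace K L (lam * hermForm L₀ x y)) hψ'
        (fun t => ⟨t, fun x y => by
          have hP := isPolarForm_symplectic (K := K) (n := n) h hlam
          have hs : ∀ x y : Fin n → L, Algebra.trace K L (lam * hermForm L₀ y x) =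
              -Algebra.trace K L (lam * hermForm L₀ x y) := fun x y => by
            rw [← Algebra.trace_trace (S := L₀), trace_mul_hermForm_swap h hlam, map_neg,
              Algebra.trace_trace]
          exact (hs _ _).trans (by rw [hP.smul_left, ← mul_neg, ← hs])⟩) W x
      rw [h2]
      simp only [hβ]
      constructor
      · rintro H _ ⟨w, hw, rfl⟩
        exact H w hw
      · intro H w hw
        exact H _ ⟨w, hw, rfl⟩
    rw [hc] at h1
    rw [e, one_mul, h1, sub_self, zero_mul, zero_mul, sub_zero]
  · intro c hc x hx
    rw [hermNorm_smul_of_tower h]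
    exact h𝒯.2 _ ⟨mul_ne_zero hc hc, c, rfl⟩ _ hx

end Symplectic

/-! ### The Hermitian polar spaces, with L over K of odd degree b. -/

section HermitianSubfield

variable {K₀ K L₀ L : Type*} [Field K₀] [Field K] [Field L₀] [Field L] [Finite K₀] [Finite K]
  [Finite L₀] [Finite L] [Algebra K₀ K] [Algebra K₀ L₀] [Algebra K₀ L] [Algebra K L]
  [Algebra L₀ L] [IsScalarTower K₀ K L] [IsScalarTower K₀ L₀ L] {n b : ℕ}
  (hK : Module.finrank K₀ K = 2) (hL : Module.finrank L₀ L = 2) (hb : Module.finrank K L = b)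
include hK hL hb

theorem natCard_eq_pow : Nat.card L₀ = Nat.card K₀ ^ b := by
  have h1 := Module.natCard_eq_pow_finrank (K := L₀) (V := L)
  have h2 := Module.natCard_eq_pow_finrank (K := K) (V := L)
  have h3 := Module.natCard_eq_pow_finrank (K := K₀) (V := K)
  rw [hL] at h1
  rw [hb, h3, hK, ← pow_mul, mul_comm, pow_mul, h1] at h2
  exact Nat.pow_left_injective two_ne_zero h2

variable (hbo : Odd b)
include hbo

/-- |L₀| = |K₀|^b, and on K the |K₀|-power map is an involution, so odd b leaves one application:
the conjugation of L over L₀ restricts to that of K over K₀. -/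
theorem pow_natCard_of_odd (c : K) : c ^ Nat.card L₀ = c ^ Nat.card K₀ := by
  obtain ⟨j, rfl⟩ := hbo
  rw [natCard_eq_pow hK hL hb]
  clear hb
  induction j with
  | zero => simp
  | succ j ih =>
    rw [show 2 * (j + 1) + 1 = (2 * j + 1) + 1 + 1 by ring, pow_succ, pow_succ, pow_mul, pow_mul, ih,
      pow_natCard_pow_natCard K₀ hK]

theorem trace_algebraMap_of_odd (c : K) :
    Algebra.trace L₀ L (algebraMap K L c) = algebraMap K₀ L₀ (Algebra.trace K₀ K c) := by
  apply (algebraMap L₀ L).injective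
  rw [algebraMap_trace_natCard L₀ hL, ← IsScalarTower.algebraMap_apply K₀ L₀ L,
    IsScalarTower.algebraMap_apply K₀ K L, algebraMap_trace_natCard K₀ hK, map_add, ← map_pow,
    pow_natCard_of_odd hK hL hb hbo]

theorem norm_algebraMap_of_odd (c : K) :
    Algebra.norm L₀ (algebraMap K L c) = algebraMap K₀ L₀ (Algebra.norm K₀ c) := by
  apply (algebraMap L₀ L).injective
  rw [← IsScalarTower.algebraMap_apply K₀ L₀ L, IsScalarTower.algebraMap_apply K₀ K L,
    FiniteField.algebraMap_norm_eq_prod_pow, FiniteField.algebraMap_norm_eq_prod_pow, hK, hL]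
  simp only [Finset.prod_range_succ, Finset.prod_range_zero, pow_zero, pow_one, one_mul]
  rw [map_mul, ← map_pow, pow_natCard_of_odd hK hL hb hbo]

/-- Both sides pair equally with every c ∈ K under the trace to K₀, which is nondegenerate. It shows
that x is isotropic exactly when H'(x) has trace 0 in K₀. -/
theorem trace_algebraMap_eq (a : L₀) :
    Algebra.trace K L (algebraMap L₀ L a) = algebraMap K₀ K (Algebra.trace K₀ L₀ a) := by
  by_contra hne
  have hu := sub_ne_zero.2 hne
  obtain ⟨t, ht⟩ := Algebra.trace_surjective K₀ K 1
  have key : ∀ c : K, Algebra.trace K₀ K (c * (Algebra.trace K L (algebraMap L₀ L a) -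
      algebraMap K₀ K (Algebra.trace K₀ L₀ a))) = 0 := by
    intro c
    have e1 : Algebra.trace K₀ K (c * Algebra.trace K L (algebraMap L₀ L a)) =
        Algebra.trace K₀ K c * Algebra.trace K₀ L₀ a := by
      rw [← smul_eq_mul c, ← map_smul, Algebra.trace_trace, ← Algebra.trace_trace (S := L₀),
        Algebra.smul_def, mul_comm, ← Algebra.smul_def, map_smul,
        trace_algebraMap_of_odd hK hL hb hbo, smul_eq_mul, mul_comm, ← Algebra.smul_def, map_smul,
        smul_eq_mul]
    have e2 : Algebra.trace K₀ K (c * algebraMap K₀ K (Algebra.trace K₀ L₀ a)) =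
        Algebra.trace K₀ K c * Algebra.trace K₀ L₀ a := by
      rw [mul_comm, ← Algebra.smul_def, map_smul, smul_eq_mul, mul_comm]
    rw [mul_sub, map_sub, e1, e2, sub_self]
  have := key (t / (Algebra.trace K L (algebraMap L₀ L a) -
      algebraMap K₀ K (Algebra.trace K₀ L₀ a)))
  rw [div_mul_cancel₀ _ hu, ht] at this
  exact one_ne_zero this

/-- The case of the hermitian polar spaces. -/
theorem IsMOvoid.card_le_of_hermitian (hn : Odd n) {m : ℕ} {𝒯 : Set L₀} (hne : 𝒯.Nonempty)
    (h𝒯 : IsInvariantSet (nonzeroElements K₀) 𝒯)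
    (hm : (m : ℝ) * (Nat.card K - 1) * Nat.card L₀ = (Nat.card L₀ : ℝ) ^ n * 𝒯.ncard)
    (hM : IsMOvoid (TotallyIsotropic
      fun x y : Fin n → L => Algebra.trace K L (hermForm L₀ x y)) m
      (pointsWithValueIn K (hermNorm L₀) 𝒯)) :
    (Nat.card L₀ : ℝ) ≤ 𝒯.ncard * (2 * √(Nat.card L₀) + 1) := by
  classical
  have : Fintype K₀ := Fintype.ofFinite K₀
  have : Fintype K := Fintype.ofFinite K
  have : Fintype L₀ := Fintype.ofFinite L₀
  have : Fintype L := Fintype.ofFinite L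
  obtain ⟨ψ₀, hψ₀⟩ := exists_addChar_ne_one K₀
  have hψ' : traceChar K ψ₀ ≠ 1 := traceChar_ne_one hψ₀
  have hψ : traceChar L₀ ψ₀ ≠ 1 := traceChar_ne_one hψ₀
  have hf : 0 < (Nat.card L₀ : ℝ) ^ n := pow_pos (by exact_mod_cast Nat.card_pos) n
  have hG := fun s (hs : s ≠ 0) => sum_addChar_hermNorm L₀ hL hn hψ hs
  have hV := card_fin_fun (L := L) L₀ hL n
  have hR := isQuadraticPair_hermNorm (n := n) L₀ hL
  have htr : ∀ z : L, Algebra.trace K₀ K (Algebra.trace K L z) =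
      Algebra.trace K₀ L₀ (Algebra.trace L₀ L z) := fun z => by
    rw [Algebra.trace_trace, Algebra.trace_trace]
  have hβ : ∀ x y : Fin n → L, traceChar K ψ₀ (Algebra.trace K L (hermForm L₀ x y)) =
      traceChar L₀ ψ₀ (Algebra.trace L₀ L (hermForm L₀ x y)) := by
    intro x y
    rw [traceChar_apply, traceChar_apply, htr]
  have hl : ∀ (c : K) (x z : Fin n → L), Algebra.trace K L (hermForm L₀ (c • x) z) =
      c * Algebra.trace K L (hermForm L₀ x z) := fun c x z => by
    rw [← algebraMap_smul L c x, hermForm_smul_left, ← Algebra.smul_def, map_smul, smul_eq_mul]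
  have hr : ∀ (c : K) (x y : Fin n → L), Algebra.trace K L (hermForm L₀ x (c • y)) =
      c ^ Nat.card K₀ * Algebra.trace K L (hermForm L₀ x y) := fun c x y => by
    rw [← algebraMap_smul L c y, hermForm_smul_right, ← map_pow,
      pow_natCard_of_odd hK hL hb hbo, ← Algebra.smul_def, map_smul, smul_eq_mul]
  have hσ : ∀ t : K, ∃ c : K, ∀ x y : Fin n → L, Algebra.trace K L (hermForm L₀ x (c • y)) =
      t * Algebra.trace K L (hermForm L₀ x y) := fun t => by
    refine ⟨t ^ Nat.card K₀, fun x y => ?_⟩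
    rw [hr, pow_natCard_pow_natCard K₀ hK]
  have hself : ∀ x : Fin n → L, Algebra.trace K L (hermForm L₀ x x) =
      algebraMap K₀ K (Algebra.trace K₀ L₀ (hermNorm L₀ x)) := fun x => by
    rw [← trace_algebraMap_eq hK hL hb hbo, algebraMap_hermNorm L₀ hL]
  have hsmul : ∀ (c : K) (x : Fin n → L),
      hermNorm L₀ (c • x) = Algebra.norm K₀ c • hermNorm L₀ x := fun c x => by
    rw [← algebraMap_smul L c x, hermNorm_smul, norm_algebraMap_of_odd hK hL hb hbo,
      Algebra.smul_def]
  have h : IsPolarForm (fun x y : Fin n → L => Algebra.trace K L (hermForm L₀ x y))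
      (fun x => Algebra.trace K₀ L₀ (hermNorm L₀ x) = 0) :=
    { add_left := fun x y z => by rw [hermForm_add_left, map_add]
      smul_left := hl
      symm := fun x y hxy => symm_of_addChar
        (β := fun x y : Fin n → L => Algebra.trace K L (hermForm L₀ x y)) hψ' hl
        (fun c => ⟨_, hr c⟩) (fun x y => by rw [hβ, hβ, hR.symm]) hxy
      zero := by rw [hR.map_zero, map_zero]
      smul := fun c x hx => by rw [hsmul, map_smul, hx, smul_zero]
      add := fun x y hx hy hxy => by
        rw [hR.map_add, map_add, map_add, hx, hy, ← htr, hxy, map_zero]; simp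
      self := fun x hx => by rw [hself, hx, map_zero] }
  -- Isotropy is a single condition with values in K₀, whence ρ = |K₀| = √q.
  refine hM.card_le h (ρ := Nat.card K₀)
    (fun W => ⟨fun H => ⟨fun x hx => ?_, H⟩, fun H => H.2⟩)
    (by exact_mod_cast Nat.card_pos) hf ?_ hR hψ hG hV hψ' (θ := id) (fun _ hx => hx)
    hβ (fun H => h𝒯.1 0 H rfl) hne ?_ hm
  · apply (algebraMap K₀ K).injective
    rw [← hself, map_zero]
    exact H x hx x hx
  · intro W hW
    have h1 := hR.card_isotropic_perp_mul_card hψ₀ hf hG hV W.toAddSubgroup hW.1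
    have e : isotropicPerp (fun x y : Fin n → L => Algebra.trace K L (hermForm L₀ x y))
        (fun x => Algebra.trace K₀ L₀ (hermNorm L₀ x) = 0) W =
        Finset.univ.filter fun x : Fin n → L => Algebra.trace K₀ L₀ (hermNorm L₀ x) = 0 ∧
          ∀ w ∈ W.toAddSubgroup, traceChar L₀ ψ₀ (Algebra.trace L₀ L (hermForm L₀ x w)) = 1 := by
      refine Finset.filter_congr fun x _ => and_congr_right fun _ => ?_
      rw [perp_iff_addChar (β := fun x y : Fin n → L => Algebra.trace K L (hermForm L₀ x y)) hψ'
        hσ W x]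
      simp only [hβ]
      rfl
    rw [Nat.card_eq_fintype_card, e]
    exact h1
  · intro c hc x hx
    rw [hsmul]
    exact h𝒯.2 _ (Algebra.norm_ne_zero_iff.2 hc) _ hx

end HermitianSubfield

/-! ### Real powers of q. -/

section Numerics

theorem rpow_half_of_eq {q e F : ℝ} (hq : 0 < q) (hF : q ^ e = F) : q ^ (e / 2) = √F := by
  rw [← hF, Real.sqrt_eq_rpow, ← Real.rpow_mul hq.le]
  congr 1
  ring

theorem rpow_div_four {q b F : ℝ} (hq : 0 < q) (hF : q ^ (b / 2) = F) : q ^ (b / 4) = √F := by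
  rw [← rpow_half_of_eq hq hF]
  congr 1
  ring

theorem rpow_mul_natCast_sub {q e F : ℝ} (hq : 0 < q) (hF : q ^ e = F) (n : ℕ) :
    q ^ (e * n - e) = F ^ n / F := by
  rw [Real.rpow_sub hq, Real.rpow_mul_natCast hq.le, hF]

theorem rpow_half_finrank {K L₀ L : Type*} [Field K] [Field L₀] [Field L] [Finite K] [Finite L₀]
    [Finite L] [Algebra K L] [Algebra L₀ L] {q b : ℕ} (hq : Nat.card K = q)
    (hL : Module.finrank L₀ L = 2) (hb : Module.finrank K L = b) :
    (q : ℝ) ^ ((b : ℝ) / 2) = Nat.card L₀ := by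
  have h1 := Module.natCard_eq_pow_finrank (K := L₀) (V := L)
  rw [Module.natCard_eq_pow_finrank (K := K) (V := L), hb, hq, hL] at h1
  have hq0 : (0 : ℝ) < q := by rw [← hq]; exact_mod_cast Nat.card_pos
  rw [rpow_half_of_eq hq0 (Real.rpow_natCast _ _), ← Nat.cast_pow, h1, Nat.cast_pow,
    Real.sqrt_sq (Nat.cast_nonneg _)]

theorem div_le_of_le_mul {F T g s : ℝ} (hg : 0 < g) (h : F ≤ T * g * (2 * √s + 1)) :
    T ≥ F / (g * (2 * √s + 1)) := by
  rw [ge_iff_le, div_le_iff₀ (by positivity), ← mul_assoc]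
  exact h

theorem epsilon_mul_pos {K : Type*} [Field K] [Finite K] {q : ℕ} (hq : Nat.card K = q) :
    0 < epsilon q * ((q : ℝ) - 1) := by
  have : (1 : ℝ) < q := by rw [← hq]; exact_mod_cast Finite.one_lt_card
  refine mul_pos ?_ (by linarith)
  unfold epsilon
  split_ifs <;> norm_num

end Numerics

end PolarSpace

end

/-! ### The four families. -/

theorem mainTheorem9 :
    -- `H(d-1,q)` from `H(d/b-1,q^b)`, `d` odd; `|K₀| = q^(1/2)`, `|L₀| = q^(b/2)`, `|L| = q^b`
    (∀ (K₀ K L₀ L : Type*) [Field K₀] [Field K] [Field L₀] [Field L]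
        [Finite K₀] [Finite K] [Finite L₀] [Finite L]
        [Algebra K₀ K] [Algebra K₀ L₀] [Algebra K₀ L] [Algebra K L] [Algebra L₀ L]
        [IsScalarTower K₀ K L] [IsScalarTower K₀ L₀ L]
        (q b d n m : ℕ) (𝒯 : Set L₀) (T : Finset L₀),
        Nat.card K = q → Module.finrank K₀ K = 2 → Module.finrank L₀ L = 2 →
        Module.finrank K L = b → d = n * b → Odd d →
        𝒯.Nonempty →
        PolarSpace.IsInvariantSet (PolarSpace.nonzeroElements K₀) 𝒯 →
        (∀ t ∈ 𝒯, Algebra.trace K₀ L₀ t = 0) →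
        PolarSpace.IsCosetReps (PolarSpace.nonzeroElements K₀) 𝒯 T →
        (m : ℝ) = (T.card : ℝ) / ((q : ℝ) ^ (1 / 2 : ℝ) + 1) *
          (q : ℝ) ^ (((d : ℝ) - (b : ℝ)) / 2) →
        PolarSpace.IsMOvoid
          (PolarSpace.TotallyIsotropic
            fun x y : Fin n → L => Algebra.trace K L (PolarSpace.hermForm L₀ x y))
          m (PolarSpace.pointsWithValueIn K (PolarSpace.hermNorm (L := L) (n := n) L₀) 𝒯) →
        (T.card : ℝ) ≥ (q : ℝ) ^ ((b : ℝ) / 2) /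
          (((q : ℝ) ^ (1 / 2 : ℝ) - 1) * (2 * (q : ℝ) ^ ((b : ℝ) / 4) + 1))) ∧
    -- `Q⁻(d-1,q)` from `Q⁻(d/b-1,q^b)`, `d/b = 2k+2 ≥ 4`; `|L| = q^b`
    (∀ (K L : Type*) [Field K] [Field L] [Finite K] [Finite L] [Algebra K L]
        (q b d k m : ℕ) (a₀ a₁ : L) (𝒯 : Set L) (T : Finset L),
        Nat.card K = q → Module.finrank K L = b → d = (2 * k + 2) * b → 2 * k + 2 ≥ 4 →
        Irreducible (Polynomial.X ^ 2 + Polynomial.C a₀ * Polynomial.X + Polynomial.C a₁) →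
        𝒯.Nonempty →
        PolarSpace.IsInvariantSet (PolarSpace.nonzeroSquares K) 𝒯 →
        (∀ t ∈ 𝒯, Algebra.trace K L t = 0) →
        PolarSpace.IsCosetReps (PolarSpace.nonzeroSquares K) 𝒯 T →
        (m : ℝ) = PolarSpace.epsilon q * (T.card : ℝ) * (q : ℝ) ^ ((d : ℝ) / 2 - (b : ℝ)) →
        PolarSpace.IsMOvoid
          (PolarSpace.TotallySingular
            fun x : Fin (2 * k + 2) → L => Algebra.trace K L (PolarSpace.ellipticForm a₀ a₁ x))
          m (PolarSpace.pointsWithValueIn K (PolarSpace.ellipticForm (k := k) a₀ a₁) 𝒯) →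
        (T.card : ℝ) ≥ (q : ℝ) ^ (b : ℝ) /
          (PolarSpace.epsilon q * ((q : ℝ) - 1) * (2 * (q : ℝ) ^ ((b : ℝ) / 2) + 1))) ∧
    -- `Q⁻(d-1,q)` from `H(d/b-1,q^b)`, `b` even, `d/b = n` odd; `|L₀| = q^(b/2)`, `|L| = q^b`
    (∀ (K L₀ L : Type*) [Field K] [Field L₀] [Field L] [Finite K] [Finite L₀] [Finite L]
        [Algebra K L₀] [Algebra K L] [Algebra L₀ L] [IsScalarTower K L₀ L]
        (q b d n m : ℕ) (𝒯 : Set L₀) (T : Finset L₀),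
        Nat.card K = q → Module.finrank L₀ L = 2 →
        Module.finrank K L = b → d = n * b → Odd n →
        𝒯.Nonempty →
        PolarSpace.IsInvariantSet (PolarSpace.nonzeroSquares K) 𝒯 →
        (∀ t ∈ 𝒯, Algebra.trace K L₀ t = 0) →
        PolarSpace.IsCosetReps (PolarSpace.nonzeroSquares K) 𝒯 T →
        (m : ℝ) = PolarSpace.epsilon q * (T.card : ℝ) *
          (q : ℝ) ^ (((d : ℝ) - (b : ℝ)) / 2) →
        PolarSpace.IsMOvoid
          (PolarSpace.TotallySingular
            fun x : Fin n → L => Algebra.trace K L₀ (PolarSpace.hermNorm L₀ x))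
          m (PolarSpace.pointsWithValueIn K (PolarSpace.hermNorm (L := L) (n := n) L₀) 𝒯) →
        (T.card : ℝ) ≥ (q : ℝ) ^ ((b : ℝ) / 2) /
          (PolarSpace.epsilon q * ((q : ℝ) - 1) * (2 * (q : ℝ) ^ ((b : ℝ) / 4) + 1))) ∧
    -- `W(d-1,q)` from `H(d/b-1,q^b)`, `b` even, `d/b = n` odd; `|L₀| = q^(b/2)`, `|L| = q^b`
    (∀ (K L₀ L : Type*) [Field K] [Field L₀] [Field L] [Finite K] [Finite L₀] [Finite L]
        [Algebra K L₀] [Algebra K L] [Algebra L₀ L] [IsScalarTower K L₀ L]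
        (q b d n m : ℕ) (lam : L) (𝒯 : Set L₀) (T : Finset L₀),
        Nat.card K = q → Module.finrank L₀ L = 2 →
        Module.finrank K L = b → d = n * b → Odd n →
        lam ≠ 0 → lam + lam ^ Nat.card L₀ = 0 →
        𝒯.Nonempty →
        PolarSpace.IsInvariantSet (PolarSpace.nonzeroSquares K) 𝒯 →
        PolarSpace.IsCosetReps (PolarSpace.nonzeroSquares K) 𝒯 T →
        (m : ℝ) = PolarSpace.epsilon q * (T.card : ℝ) *
          (q : ℝ) ^ (((d : ℝ) - (b : ℝ)) / 2) →
        PolarSpace.IsMOvoid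
          (PolarSpace.TotallyIsotropic
            fun x y : Fin n → L => Algebra.trace K L (lam * PolarSpace.hermForm L₀ x y))
          m (PolarSpace.pointsWithValueIn K (PolarSpace.hermNorm (L := L) (n := n) L₀) 𝒯) →
        (T.card : ℝ) ≥ (q : ℝ) ^ ((b : ℝ) / 2) /
          (PolarSpace.epsilon q * ((q : ℝ) - 1) * (2 * (q : ℝ) ^ ((b : ℝ) / 4) + 1))) := by
  refine ⟨?_, ?_, ?_, ?_⟩
  · intro K₀ K L₀ L _ _ _ _ _ _ _ _ _ _ _ _ _ _ _ q b d n m 𝒯 T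
      hq hK hL hb hd hodd hne h𝒯 _ hT hm hM
    rw [hd, Nat.odd_mul] at hodd
    have hqK : (q : ℝ) = (Nat.card K₀ : ℝ) ^ 2 := by
      rw [← hq, Module.natCard_eq_pow_finrank (K := K₀), hK]; norm_cast
    have hq0 : (q : ℝ) ^ (1 / 2 : ℝ) = Nat.card K₀ := by
      rw [hqK, ← Real.sqrt_eq_rpow, Real.sqrt_sq (Nat.cast_nonneg _)]
    have hqpos : (0 : ℝ) < q := by rw [← hq]; exact_mod_cast Nat.card_pos
    have hF := PolarSpace.rpow_half_finrank hq hL hb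
    have hK1 : (1 : ℝ) < Nat.card K₀ := by exact_mod_cast Finite.one_lt_card
    have h1 : (𝒯.ncard : ℝ) = T.card * (Nat.card K₀ - 1) := by
      rw [hT.ncard_eq h𝒯, Nat.cast_mul, PolarSpace.ncard_nonzeroElements]
    -- With f = |L₀|^n, the power q^((d-b)/2) is f / |L₀|.
    rw [show ((d : ℝ) - b) / 2 = b / 2 * n - b / 2 by rw [hd]; push_cast; ring,
      PolarSpace.rpow_mul_natCast_sub hqpos hF, hq0] at hm
    -- The required identity m(q - 1)|L₀| = f|𝒯| holds because q - 1 = (√q - 1)(√q + 1) and |𝒯| =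
    -- |T|(√q - 1).
    have h2 := hM.card_le_of_hermitian hK hL hb hodd.2 hodd.1 hne h𝒯 (by
      have hL0 : (Nat.card L₀ : ℝ) ≠ 0 := by exact_mod_cast Nat.card_pos.ne'
      have : (Nat.card K₀ : ℝ) + 1 ≠ 0 := by positivity
      rw [hm, h1, hq, hqK]
      field_simp
      ring)
    rw [h1] at h2
    rw [hF, hq0, PolarSpace.rpow_div_four hqpos hF]
    exact PolarSpace.div_le_of_le_mul (by linarith) h2
  · intro K L _ _ _ _ _ q b d k m a₀ a₁ 𝒯 T hq hb hd _ hirr hne h𝒯 _ hT hm hM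
    have : Fintype L := Fintype.ofFinite L
    have hqpos : (0 : ℝ) < q := by rw [← hq]; exact_mod_cast Nat.card_pos
    have hF : (q : ℝ) ^ (b : ℝ) = Nat.card L := by
      rw [Real.rpow_natCast, ← hq, ← hb, Module.natCard_eq_pow_finrank (K := K) (V := L)]
      norm_cast
    have hL0 : (0 : ℝ) < Nat.card L := by exact_mod_cast Nat.card_pos
    have h1 : (𝒯.ncard : ℝ) = T.card * (PolarSpace.epsilon q * (q - 1)) := by
      rw [hT.ncard_eq h𝒯, Nat.cast_mul, PolarSpace.ncard_nonzeroSquares, hq]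
    -- Here d/2 = b(k + 1), so f = |L|^(k+1) and the power of q in m is f / |L|.
    rw [show (d : ℝ) / 2 - b = b * (k + 1 : ℕ) - b by rw [hd]; push_cast; ring,
      PolarSpace.rpow_mul_natCast_sub hqpos hF] at hm
    have h2 := hM.card_le_of_totallySingular (PolarSpace.isQuadraticPair_ellipticForm a₀ a₁)
      (pow_pos hL0 (k + 1))
      (fun ψ hψ s hs => PolarSpace.sum_addChar_ellipticForm hirr hψ hs)
      (by rw [Fintype.card_fun, Fintype.card_fin, Nat.card_eq_fintype_card]; push_cast; ring)
      hne h𝒯 (by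
        rw [hm, h1, hq]
        field_simp)
    rw [h1] at h2
    rw [hF, PolarSpace.rpow_half_of_eq hqpos hF]
    exact PolarSpace.div_le_of_le_mul (PolarSpace.epsilon_mul_pos hq) h2
  · intro K L₀ L _ _ _ _ _ _ _ _ _ _ q b d n m 𝒯 T hq hL hb hd hodd hne h𝒯 _ hT hm hM
    have : Fintype L := Fintype.ofFinite L
    have hqpos : (0 : ℝ) < q := by rw [← hq]; exact_mod_cast Nat.card_pos
    have hF := PolarSpace.rpow_half_finrank hq hL hb
    have hL0 : (0 : ℝ) < Nat.card L₀ := by exact_mod_cast Nat.card_pos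
    have h1 : (𝒯.ncard : ℝ) = T.card * (PolarSpace.epsilon q * (q - 1)) := by
      rw [hT.ncard_eq h𝒯, Nat.cast_mul, PolarSpace.ncard_nonzeroSquares, hq]
    rw [show ((d : ℝ) - b) / 2 = b / 2 * n - b / 2 by rw [hd]; push_cast; ring,
      PolarSpace.rpow_mul_natCast_sub hqpos hF] at hm
    have h2 := hM.card_le_of_totallySingular (PolarSpace.isQuadraticPair_hermNorm L₀ hL)
      (pow_pos hL0 n)
      (fun ψ hψ s hs => PolarSpace.sum_addChar_hermNorm L₀ hL hodd hψ hs)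
      (PolarSpace.card_fin_fun L₀ hL n) hne h𝒯 (by
        rw [hm, h1, hq]
        field_simp)
    rw [h1] at h2
    rw [hF, PolarSpace.rpow_div_four hqpos hF]
    exact PolarSpace.div_le_of_le_mul (PolarSpace.epsilon_mul_pos hq) h2
  · intro K L₀ L _ _ _ _ _ _ _ _ _ _ q b d n m lam 𝒯 T hq hL hb hd hodd hlam0 hlam hne h𝒯 hT hm hM
    have hqpos : (0 : ℝ) < q := by rw [← hq]; exact_mod_cast Nat.card_pos
    have hF := PolarSpace.rpow_half_finrank hq hL hb
    have hL0 : (0 : ℝ) < Nat.card L₀ := by exact_mod_cast Nat.card_pos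
    have h1 : (𝒯.ncard : ℝ) = T.card * (PolarSpace.epsilon q * (q - 1)) := by
      rw [hT.ncard_eq h𝒯, Nat.cast_mul, PolarSpace.ncard_nonzeroSquares, hq]
    rw [show ((d : ℝ) - b) / 2 = b / 2 * n - b / 2 by rw [hd]; push_cast; ring,
      PolarSpace.rpow_mul_natCast_sub hqpos hF] at hm
    have h2 := hM.card_le_of_symplectic hL hodd hlam0 hlam hne h𝒯 (by
        rw [hm, h1, hq]
        field_simp)
    rw [h1] at h2
    rw [hF, PolarSpace.rpow_div_four hqpos hF]
    exact PolarSpace.div_le_of_le_mul (PolarSpace.epsilon_mul_pos hq) h2
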